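/- Consider on $\mathbb{R}^3\times(0,\infty)$ the Boussinesq system (with $\nu=\kappa=\beta=1$) $$\partial_t\theta+u\cdot\nabla\theta=\Delta\theta,\qquad \partial_t u+u\cdot\nabla u+\nabla p=\Delta u+\theta e_3,\qquad \nabla\cdot u=0,\qquad u|_{t=0}=u_0,\ \theta|_{t=0}=\theta_0,$$ where $e_3=(0,0,1)$. Let $e^{t\Delta}$ be the heat semigroup and $\mathbb{P}$ the Leray projector onto divergence-free fields, i.e. the Fourier multiplier $\delta_{jk}-\xi_j\xi_k/|\xi|^2$. A *mild solution* is a pair $(u,\theta)$ with $u(0)=u_0$, $\theta(0)=\theta_0$ and, for every $t>0$ (as an identity a.e. in $x$), $$\theta(t)=e^{t\Delta}\theta_0-\int_0^t e^{(t-s)\Delta}\nabla\cdot(\theta u)(s)\,ds,$$ $$u(t)=e^{t\Delta}u_0-\int_0^t e^{(t-s)\Delta}\mathbb{P}\nabla\cdot(u\otimes u)(s)\,ds+\int_0^t e^{(t-s)\Delta}\mathbb{P}(\theta(s)e_3)\,ds,$$ the operators $e^{t\Delta}$, $e^{t\Delta}\nabla\cdot$, $e^{t\Delta}\mathbb{P}$,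 $e^{t\Delta}\mathbb{P}\nabla\cdot$ ($t>0$) acting by convolution with their kernels. Let $\mathcal{X}$ be the space of locally integrable divergence-free (in the sense of distributions, at each time) vector fields $u=u(x,t)$ with $$\|u\|_{\mathcal{X}}=\operatorname*{ess\,sup}_{x\in\mathbb{R}^3,\,t>0}(\sqrt t+|x|)\,|u(x,t)|<\infty,$$ such that $u(t)\to u(0)$ in the sense of distributions as $t\to0^+$ and $\operatorname{ess\,sup}_x|x|\,|u(x,t)-u(x,t')|\to0$ as $t\to t'$, for every $t'>0$. Let $\mathcal{Y}$ be the space of locally integrable scalar functions $\theta=\theta(x,t)$ with $$\|\theta\|_{\mathcal{Y}}=\operatorname*{ess\,sup}_{t>0}\|\theta(t)\|_{L^1}+\operatorname*{ess\,sup}_{x\in\mathbb{R}^3,\,t>0}(\sqrt t+|x|)^3\,|\theta(x,t)|<\infty,$$ such that $\theta(t)\to\theta(0)$ in the sense of distributions as $t\to0^+$, and $\|\theta(t)-\theta(t')\|_{L^1}\to0$ and $\operatorname{ess\,sup}_x|x|^3|\theta(x,t)-\theta(x,t')|\to0$ as $t\to t'$, for every $t'>0$. (In both spaces the values at time $0$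 are locally integrable functions.) **Proposition 2.3.** There are absolute constants $\varepsilon_0>0$ and $C>0$ such that, for every $0<\varepsilon\le\varepsilon_0$, the following holds. If $u_0:\mathbb{R}^3\to\mathbb{R}^3$ is a (measurable) vector field, divergence-free in the sense of distributions, and $\theta_0:\mathbb{R}^3\to\mathbb{R}$ is a (measurable) function, with $$\|\theta_0\|_{L^1}<\varepsilon,\qquad \operatorname*{ess\,sup}_{x}|x|^3|\theta_0(x)|<\varepsilon,\qquad \operatorname*{ess\,sup}_{x}|x|\,|u_0(x)|<\varepsilon,$$ then there is a mild solution $(u,\theta)\in\mathcal{X}\times\mathcal{Y}$ with data $(u_0,\theta_0)$ such that $$\|u\|_{\mathcal{X}}\le C\varepsilon\qquad\text{and}\qquad\|\theta\|_{\mathcal{Y}}\le C\varepsilon,$$ and it is the only such solution: any mild solution in $\mathcal{X}\times\mathcal{Y}$ with the same data satisfying these two bounds coincides with $(u,\theta)$ almost everywhere in $x$ at every time $t\ge0$. -/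

import Mathlib

open MeasureTheory Set Filter Topology
open scoped ENNReal ContDiff FourierTransform

noncomputable section

namespace Boussinesq

/-- The physical space `ℝ³` with its Euclidean norm. -/
abbrev E3 : Type := EuclideanSpace ℝ (Fin 3)

/-- Lebesgue measure on the space-time slab `(0, T) × ℝ³` (points are pairs `(t, x)`). -/
def slab (T : ℝ) : Measure (ℝ × E3) :=
  (volume : Measure (ℝ × E3)).restrict (Ioo 0 T ×ˢ univ)

/-- Lebesgue measure on `(0, ∞) × ℝ³`. -/
def halfSpaceTime : Measure (ℝ × E3) :=
  (volume : Measure (ℝ × E3)).restrict (Ioi 0 ×ˢ univ)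

/-- The partial derivative `∂f/∂x_l` at `x`. -/
def partialDeriv (l : Fin 3) (f : E3 → ℝ) (x : E3) : ℝ :=
  fderiv ℝ f x (EuclideanSpace.single l 1)

/-! ### Kernels -/

/-- The heat kernel `g_t(x) = (4πt)^{-3/2} exp(-|x|²/(4t))` on `ℝ³`. -/
def heatKernel (t : ℝ) (x : E3) : ℝ :=
  (4 * Real.pi * t) ^ (-(3 / 2) : ℝ) * Real.exp (-(‖x‖ ^ 2) / (4 * t))

/-- The `(k, j)` entry of the Fourier multiplier of `e^{tΔ} ℙ`, where `ℙ` is the Leray projector on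
divergence-free fields: `exp(-4π²t|ξ|²) (δ_{kj} - ξ_k ξ_j / |ξ|²)`, for the convention
`f̂(ξ) = ∫ f(x) exp(-2πi x·ξ) dx`. -/
def heatLeraySymbol (t : ℝ) (k j : Fin 3) (ξ : E3) : ℝ :=
  Real.exp (-(4 * Real.pi ^ 2 * t * ‖ξ‖ ^ 2)) *
    ((if k = j then 1 else 0) - ξ k * ξ j / ‖ξ‖ ^ 2)

/-- The `(k, j)` entry of the convolution kernel of `e^{tΔ} ℙ`: the inverse Fourier transform of the
multiplier. (The multiplier is real and even, so the inverse transform is real.) -/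
def heatLerayKernel (t : ℝ) (k j : Fin 3) (x : E3) : ℝ :=
  (𝓕⁻ (fun ξ : E3 ↦ ((heatLeraySymbol t k j ξ : ℝ) : ℂ)) x).re

/-! ### The function spaces

Velocity fields are functions `u : ℝ → E3 → E3` and temperatures are functions `θ : ℝ → E3 → ℝ`,
the first argument being the time; only times `t ≥ 0` matter. -/

/-- The field `v` is divergence-free in the sense of distributions:
`∫ v · ∇φ = 0` for all test functions `φ`. -/
def DivFree (v : E3 → E3) : Prop :=
  ∀ φ : E3 → ℝ, ContDiff ℝ ∞ φ → HasCompactSupport φ → ∫ x, fderiv ℝ φ x (v x) = 0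

/-- `f(t) → f(0)` in the sense of distributions as `t → 0+`. -/
def TendstoInitial {F : Type*} [NormedAddCommGroup F] [NormedSpace ℝ F] (f : ℝ → E3 → F) : Prop :=
  ∀ φ : E3 → ℝ, ContDiff ℝ ∞ φ → HasCompactSupport φ →
    Tendsto (fun t : ℝ ↦ ∫ x, φ x • f t x) (𝓝[>] 0) (𝓝 (∫ x, φ x • f 0 x))

/-- `ess sup_x |x|^m |f(x)|`, as an extended nonnegative real. -/
def weightedSup {F : Type*} [NormedAddCommGroup F] (m : ℕ) (f : E3 → F) : ℝ≥0∞ :=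
  essSup (fun x : E3 ↦ ENNReal.ofReal (‖x‖ ^ m) * ‖f x‖ₑ) volume

/-- `ess sup_{x, t > 0} (√t + |x|)^m |f(x, t)|`, as an extended nonnegative real. -/
def parabolicSup {F : Type*} [NormedAddCommGroup F] (m : ℕ) (f : ℝ → E3 → F) : ℝ≥0∞ :=
  essSup (fun p : ℝ × E3 ↦ ENNReal.ofReal ((√p.1 + ‖p.2‖) ^ m) * ‖f p.1 p.2‖ₑ) halfSpaceTime

/-- The norm of the velocity space `𝒳`. -/
def normX (u : ℝ → E3 → E3) : ℝ≥0∞ := parabolicSup 1 u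

/-- The norm of the temperature space `𝒴`: the norm of `L^∞_t(L^1)` plus the weighted supremum. -/
def normY (θ : ℝ → E3 → ℝ) : ℝ≥0∞ :=
  essSup (fun t : ℝ ↦ eLpNorm (θ t) 1 volume) (volume.restrict (Ioi 0)) + parabolicSup 3 θ

/-- Membership in `𝒳`: locally integrable divergence-free fields of finite norm, continuous in
time: `u(t) → u(0)` as distributions as `t → 0`, and `ess sup_x |x| |u(x,t) - u(x,t')| → 0` as
`t → t'` for every `t' > 0`. -/
structure MemX (u : ℝ → E3 → E3) : Prop where
  locallyIntegrable : LocallyIntegrableOn (fun p : ℝ × E3 ↦ u p.1 p.2) (Ici 0 ×ˢ univ) volume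
  locallyIntegrable_slice : ∀ t : ℝ, 0 ≤ t → LocallyIntegrable (u t) volume
  divFree : ∀ t : ℝ, 0 ≤ t → DivFree (u t)
  norm_lt_top : normX u < ⊤
  tendsto_initial : TendstoInitial u
  continuous_time : ∀ t' : ℝ, 0 < t' →
    Tendsto (fun t : ℝ ↦ weightedSup 1 (fun x ↦ u t x - u t' x)) (𝓝 t') (𝓝 0)

/-- Membership in `𝒴`: locally integrable functions of finite norm, continuous in time:
`θ(t) → θ(0)` as distributions as `t → 0`, and both `‖θ(t) - θ(t')‖₁` and
`ess sup_x |x|³ |θ(x,t) - θ(x,t')|` tend to `0` as `t → t'` for every `t' > 0`. -/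
structure MemY (θ : ℝ → E3 → ℝ) : Prop where
  locallyIntegrable : LocallyIntegrableOn (fun p : ℝ × E3 ↦ θ p.1 p.2) (Ici 0 ×ˢ univ) volume
  locallyIntegrable_slice : ∀ t : ℝ, 0 ≤ t → LocallyIntegrable (θ t) volume
  norm_lt_top : normY θ < ⊤
  tendsto_initial : TendstoInitial θ
  continuous_time_L1 : ∀ t' : ℝ, 0 < t' →
    Tendsto (fun t : ℝ ↦ eLpNorm (fun x ↦ θ t x - θ t' x) 1 volume) (𝓝 t') (𝓝 0)
  continuous_time_sup : ∀ t' : ℝ, 0 < t' →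
    Tendsto (fun t : ℝ ↦ weightedSup 3 (fun x ↦ θ t x - θ t' x)) (𝓝 t') (𝓝 0)

/-! ### The integral formulation -/

/-- `e^{tΔ} f`, for `t > 0` and a scalar function `f`. -/
def heatSemigroup (t : ℝ) (f : E3 → ℝ) (x : E3) : ℝ :=
  ∫ y, heatKernel t (x - y) * f y

/-- `∫₀ᵗ e^{(t-s)Δ} ∇·(θu)(s) ds` at the point `x`; the kernel of `e^{tΔ} ∂_l` is `∂_l g_t`. -/
def convectionTheta (u : ℝ → E3 → E3) (θ : ℝ → E3 → ℝ) (t : ℝ) (x : E3) : ℝ :=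
  ∫ p, ∑ l : Fin 3,
    partialDeriv l (heatKernel (t - p.1)) (x - p.2) * (θ p.1 p.2 * u p.1 p.2 l) ∂(slab t)

/-- The `k`-th component of `∫₀ᵗ e^{(t-s)Δ} ℙ ∇·(u⊗u)(s) ds` at the point `x`, where
`∇·(u⊗u)` is the field with components `∑_l ∂_l (u_l u_j)`. -/
def convectionU (u : ℝ → E3 → E3) (t : ℝ) (x : E3) (k : Fin 3) : ℝ :=
  ∫ p, ∑ j : Fin 3, ∑ l : Fin 3,
    partialDeriv l (heatLerayKernel (t - p.1) k j) (x - p.2) * (u p.1 p.2 l * u p.1 p.2 j) ∂(slab t)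

/-- The `k`-th component of `∫₀ᵗ e^{(t-s)Δ} ℙ (θ(s) e₃) ds` at the point `x`
(the vertical direction `e₃` is the one with index `2 : Fin 3`). -/
def buoyancy (θ : ℝ → E3 → ℝ) (t : ℝ) (x : E3) (k : Fin 3) : ℝ :=
  ∫ p, heatLerayKernel (t - p.1) k 2 (x - p.2) * θ p.1 p.2 ∂(slab t)

/-- `(u, θ)` is a mild solution in `𝒳 × 𝒴` of the Boussinesq system
`∂ₜθ + u·∇θ = Δθ`, `∂ₜu + u·∇u + ∇p = Δu + θ e₃`, `∇·u = 0` with initial data `(u₀, θ₀)`, that is, a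
solution of the integral formulation
`θ(t) = e^{tΔ}θ₀ - ∫₀ᵗ e^{(t-s)Δ} ∇·(θu)(s) ds`,
`u(t) = e^{tΔ}u₀ - ∫₀ᵗ e^{(t-s)Δ} ℙ∇·(u⊗u)(s) ds + ∫₀ᵗ e^{(t-s)Δ} ℙ(θ(s)e₃) ds` at all times `t ≥ 0`.
At `t = 0` this says that `u(0) = u₀` and `θ(0) = θ₀`. -/
structure IsMildSolution (u₀ : E3 → E3) (θ₀ : E3 → ℝ) (u : ℝ → E3 → E3) (θ : ℝ → E3 → ℝ) :
    Prop where
  memX : MemX u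
  memY : MemY θ
  initial_u : u 0 =ᵐ[volume] u₀
  initial_theta : θ 0 =ᵐ[volume] θ₀
  eq_theta : ∀ t : ℝ, 0 < t → ∀ᵐ x : E3,
    θ t x = heatSemigroup t θ₀ x - convectionTheta u θ t x
  eq_u : ∀ t : ℝ, 0 < t → ∀ᵐ x : E3, ∀ k : Fin 3,
    u t x k = heatSemigroup t (fun y ↦ u₀ y k) x - convectionU u t x k + buoyancy θ t x k

end Boussinesq

end

noncomputable section

namespace Boussinesq

/-! The pair solves a fixed point problem for the map (`mildU`, `mildTheta`), and everything is
measured by pointwise powers of the parabolic norm √t + |x|: order 1 for the velocity, order 3 for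
the temperature. The kernels of e^{tΔ}∇ and e^{tΔ}ℙ∇ have parabolic order 4, and that of e^{tΔ}ℙ has
order 3. If a kernel has order a, a force has order b and a + b = m + 4 with 2 ≤ a, b ≤ 4, then
their convolution in space, at times τ and s, is at most a constant times (τ^{-1/2} + s^{-1/2})
(√(τ+s) + |x|)^{-m} (`exists_lintegral_conv_le`). Integration in time gives √t (√t + |x|)^{-m},
which is at most (√t + |x|)^{-(m-1)} (`exists_duhamel_bound`). The three Duhamel terms have orders
(4,2), (3,3) and (4,4), for u⊗u, θe₃ and θu, so they land in orders 1, 1 and 3: the map respects the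
weights.

The kernel bounds need no Fourier decay analysis. The singular multiplier satisfies e^{-4π²t|ξ|²}
ξ_kξ_j/|ξ|² = ∫_t^∞ 4π² ξ_kξ_j e^{-4π²s|ξ|²} ds, so the kernel of e^{tΔ}(1-ℙ) is -∫_t^∞ ∂_k∂_j g_s
ds. It is therefore a polynomial combination of the Gaussian tails `heatTail`, which are bounded by
hand and are closed under differentiation (`heatLerayKernel_eq`, `hasFDerivAt_heatTail`).

The convection terms are quadratic, hence contractive on small balls. The buoyancy term is linear
with a constant that is not small; it is tamed by measuring the temperature difference with a large
weight `lam` (`exists_contraction`). The Picard iterates from zero then converge geometrically at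
every point with t > 0 (`Contracts.exists_fixedPoint`).

The remaining properties are read off from the integral equations. The L¹ bound on the temperature
is not part of the iteration: it holds because a kernel and a force of order 4 are both integrable
in space (`exists_duhamel_L1_bound`). Continuity in time comes from the time increments of the
kernels. The velocity is divergence-free because the columns of the Leray kernel are. The initial
values are attained because the Duhamel terms, paired with a test function, are O(√t).

Uniqueness is the same contraction applied repeatedly to the difference of two solutions
(`Contracts.unique`). It gives equality almost everywhere in space-time, and the equations upgrade
this to every time, since their right-hand sides depend only on the space-time classes. -/

/-- The parabolic norm `√t + |x|`. -/
def pnorm (t : ℝ) (x : E3) : ℝ := √t + ‖x‖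

lemma pnorm_nonneg (t : ℝ) (x : E3) : 0 ≤ pnorm t x := by unfold pnorm; positivity

lemma pnorm_pos {t : ℝ} (ht : 0 < t) (x : E3) : 0 < pnorm t x := by
  have := Real.sqrt_pos.2 ht
  unfold pnorm; positivity

lemma norm_le_pnorm (t : ℝ) (x : E3) : ‖x‖ ≤ pnorm t x := by
  have := Real.sqrt_nonneg t
  unfold pnorm; linarith

lemma sqrt_le_pnorm (t : ℝ) (x : E3) : √t ≤ pnorm t x := by
  have := norm_nonneg x
  unfold pnorm; linarith

lemma pnorm_mono {s t : ℝ} (h : s ≤ t) (x : E3) : pnorm s x ≤ pnorm t x := by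
  have := Real.sqrt_le_sqrt h
  unfold pnorm; linarith

lemma continuous_pnorm : Continuous (fun p : ℝ × E3 ↦ pnorm p.1 p.2) := by
  unfold pnorm; fun_prop

lemma measurable_pnorm : Measurable (fun p : ℝ × E3 ↦ pnorm p.1 p.2) :=
  continuous_pnorm.measurable

/-! ### Gaussian moments and their tails in time. -/

/-- `g_s(x) / (2s)^m`, where `g` is the heat kernel. -/
def heatMoment (m : ℕ) (s : ℝ) (x : E3) : ℝ := heatKernel s x / (2 * s) ^ m

/-- `∫_t^∞ g_s(x) / (2s)^m ds`. -/
def heatTail (m : ℕ) (t : ℝ) (x : E3) : ℝ := ∫ s in Ioi t, heatMoment m s x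

lemma heatKernel_nonneg {t : ℝ} (ht : 0 < t) (x : E3) : 0 ≤ heatKernel t x := by
  unfold heatKernel; positivity

lemma heatMoment_zero (s : ℝ) (x : E3) : heatMoment 0 s x = heatKernel s x := by
  simp [heatMoment]

lemma heatMoment_nonneg (m : ℕ) {s : ℝ} (hs : 0 < s) (x : E3) : 0 ≤ heatMoment m s x :=
  div_nonneg (heatKernel_nonneg hs x) (by positivity)

lemma measurable_heatKernel : Measurable (fun p : ℝ × E3 ↦ heatKernel p.1 p.2) := by
  unfold heatKernel; fun_prop

lemma measurable_heatMoment (m : ℕ) : Measurable (fun p : ℝ × E3 ↦ heatMoment m p.1 p.2) := by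
  unfold heatMoment
  exact measurable_heatKernel.div (by fun_prop)

lemma measurable_heatTail (m : ℕ) : Measurable (fun p : ℝ × E3 ↦ heatTail m p.1 p.2) := by
  have h : (fun p : ℝ × E3 ↦ heatTail m p.1 p.2) =
      fun p : ℝ × E3 ↦ ∫ s, (if p.1 < s then heatMoment m s p.2 else 0) := by
    ext p
    rw [heatTail, ← integral_indicator measurableSet_Ioi]
    rfl
  rw [h]
  refine (StronglyMeasurable.integral_prod_right' (f := fun q : (ℝ × E3) × ℝ ↦
    if q.1.1 < q.2 then heatMoment m q.2 q.1.2 else 0) ?_).measurable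
  refine (Measurable.ite ?_ ?_ measurable_const).stronglyMeasurable
  · exact measurableSet_lt (by fun_prop) (by fun_prop)
  · exact (measurable_heatMoment m).comp (measurable_snd.prodMk (measurable_snd.comp measurable_fst))

/-- With s = σ² and r = |x|/σ, the polynomial weight is absorbed by the Gaussian: (1 + r)^k ≤ e^{kr}
≤ e^{k² + r²/4}. -/
lemma heatMoment_le (m : ℕ) {s : ℝ} (hs : 0 < s) (x : E3) :
    heatMoment m s x ≤ Real.exp ((3 + 2 * m : ℕ) ^ 2) / pnorm s x ^ (3 + 2 * m) := by
  set k := 3 + 2 * m with hk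
  obtain ⟨σ, hσ, rfl⟩ : ∃ σ : ℝ, 0 < σ ∧ s = σ ^ 2 :=
    ⟨√s, Real.sqrt_pos.2 hs, (Real.sq_sqrt hs.le).symm⟩
  have hN := pnorm_pos hs x
  rw [le_div_iff₀ (by positivity)]
  have hpn : pnorm (σ ^ 2) x = σ * (1 + ‖x‖ / σ) := by
    rw [pnorm, Real.sqrt_sq hσ.le]; field_simp
  have h1 : (4 * Real.pi * σ ^ 2) ^ (-(3 / 2) : ℝ) ≤ 1 / σ ^ 3 := by
    have : (σ ^ 2) ^ (-(3 / 2) : ℝ) = 1 / σ ^ 3 := by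
      rw [← Real.rpow_natCast, ← Real.rpow_mul hσ.le, one_div, ← Real.rpow_natCast,
        ← Real.rpow_neg hσ.le]
      norm_num
    rw [← this]
    refine Real.rpow_le_rpow_of_nonpos (by positivity) ?_ (by norm_num)
    nlinarith [Real.pi_gt_three, sq_nonneg σ]
  have h2 : heatMoment m (σ ^ 2) x ≤ 1 / σ ^ k * Real.exp (-(‖x‖ / σ) ^ 2 / 4) := by
    have e : -(‖x‖ ^ 2) / (4 * σ ^ 2) = -(‖x‖ / σ) ^ 2 / 4 := by field_simp
    rw [heatMoment, heatKernel, e, div_le_iff₀ (by positivity), mul_right_comm (1 / σ ^ k)]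
    refine mul_le_mul_of_nonneg_right (h1.trans ?_) (Real.exp_nonneg _)
    rw [hk, pow_add, pow_mul, mul_pow, div_mul_eq_mul_div, div_le_div_iff₀ (by positivity)
      (by positivity)]
    have : (1 : ℝ) ≤ 2 ^ m := one_le_pow₀ (by norm_num)
    have h3 : 0 < σ ^ 3 * (σ ^ 2) ^ m := by positivity
    nlinarith
  have h3 : (1 + ‖x‖ / σ) ^ k ≤ Real.exp ((k : ℝ) ^ 2 + (‖x‖ / σ) ^ 2 / 4) := by
    have : 1 + ‖x‖ / σ ≤ Real.exp (‖x‖ / σ) := by linarith [Real.add_one_le_exp (‖x‖ / σ)]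
    refine (pow_le_pow_left₀ (by positivity) this k).trans ?_
    rw [← Real.exp_nat_mul]
    refine Real.exp_le_exp.2 ?_
    nlinarith [sq_nonneg (‖x‖ / σ / 2 - k)]
  calc heatMoment m (σ ^ 2) x * pnorm (σ ^ 2) x ^ k
      ≤ (1 / σ ^ k * Real.exp (-(‖x‖ / σ) ^ 2 / 4)) *
        (σ ^ k * Real.exp ((k : ℝ) ^ 2 + (‖x‖ / σ) ^ 2 / 4)) := by
        rw [hpn, mul_pow]
        gcongr
    _ = Real.exp (-(‖x‖ / σ) ^ 2 / 4) * Real.exp ((k : ℝ) ^ 2 + (‖x‖ / σ) ^ 2 / 4) := by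
        field_simp
    _ = Real.exp ((k : ℝ) ^ 2) := by rw [← Real.exp_add]; congr 1; ring

/-- Since √s has derivative 1/(2√s), powers of the parabolic norm acquire an elementary primitive
once one factor √s + |x| is traded for √s. This is how the tails in time are integrated. -/
lemma hasDerivAt_inv_pnorm_pow (n : ℕ) {s : ℝ} (hs : 0 < s) (x : E3) :
    HasDerivAt (fun s ↦ -(2 / (n + 1 : ℝ)) * (pnorm s x ^ (n + 1))⁻¹)
      ((√s)⁻¹ * (pnorm s x ^ (n + 2))⁻¹) s := by
  have hN := pnorm_pos hs x
  have hq := Real.sqrt_pos.2 hs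
  have h1 : HasDerivAt (fun s ↦ pnorm s x) (1 / (2 * √s)) s :=
    (Real.hasDerivAt_sqrt hs.ne').add_const _
  have h2 := ((h1.pow (n + 1)).inv (by simp; positivity)).const_mul (-(2 / (n + 1 : ℝ)))
  refine h2.congr_deriv ?_
  simp only [Nat.add_sub_cancel, Nat.cast_add, Nat.cast_one, Pi.pow_apply]
  field_simp
  ring

lemma tendsto_pnorm_atTop (x : E3) : Tendsto (fun s ↦ pnorm s x) atTop atTop :=
  tendsto_atTop_add_const_right _ _ Real.tendsto_sqrt_atTop

lemma tendsto_inv_pnorm_pow (n : ℕ) (x : E3) :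
    Tendsto (fun s ↦ (pnorm s x ^ (n + 1))⁻¹) atTop (𝓝 0) :=
  ((tendsto_pow_atTop (Nat.succ_ne_zero n)).comp (tendsto_pnorm_atTop x)).inv_tendsto_atTop

lemma inv_pnorm_pow_le (n : ℕ) {s : ℝ} (hs : 0 < s) (x : E3) :
    (pnorm s x ^ (n + 3))⁻¹ ≤ (√s)⁻¹ * (pnorm s x ^ (n + 2))⁻¹ := by
  have hN := pnorm_pos hs x
  have hq := Real.sqrt_pos.2 hs
  rw [← mul_inv]
  refine inv_anti₀ (by positivity) ?_
  rw [pow_succ' _ (n + 2)]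
  exact mul_le_mul_of_nonneg_right (sqrt_le_pnorm s x) (by positivity)

lemma integrableOn_inv_pnorm_aux (n : ℕ) {t : ℝ} (ht : 0 < t) (x : E3) :
    IntegrableOn (fun s ↦ (√s)⁻¹ * (pnorm s x ^ (n + 2))⁻¹) (Ioi t) ∧
    ∫ s in Ioi t, (√s)⁻¹ * (pnorm s x ^ (n + 2))⁻¹ = 2 / (n + 1 : ℝ) * (pnorm t x ^ (n + 1))⁻¹ := by
  have hd : ∀ s ∈ Ici t, HasDerivAt (fun s ↦ -(2 / (n + 1 : ℝ)) * (pnorm s x ^ (n + 1))⁻¹)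
      ((√s)⁻¹ * (pnorm s x ^ (n + 2))⁻¹) s := fun s hs ↦
    hasDerivAt_inv_pnorm_pow n (ht.trans_le hs) x
  have hp : ∀ s ∈ Ioi t, 0 ≤ (√s)⁻¹ * (pnorm s x ^ (n + 2))⁻¹ := fun s hs ↦ by
    have := pnorm_nonneg s x
    positivity
  have hl := (tendsto_inv_pnorm_pow n x).const_mul (-(2 / (n + 1 : ℝ)))
  refine ⟨integrableOn_Ioi_deriv_of_nonneg' hd hp hl, ?_⟩
  rw [integral_Ioi_of_hasDerivAt_of_nonneg' hd hp hl]
  ring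

lemma measurable_pnorm_left (x : E3) : Measurable (fun s ↦ pnorm s x) :=
  measurable_pnorm.comp (measurable_id.prodMk measurable_const)

lemma integrableOn_inv_pnorm_pow (n : ℕ) {t : ℝ} (ht : 0 < t) (x : E3) :
    IntegrableOn (fun s ↦ (pnorm s x ^ (n + 3))⁻¹) (Ioi t) := by
  refine (integrableOn_inv_pnorm_aux n ht x).1.mono'
    (((measurable_pnorm_left x).pow_const _).inv.aestronglyMeasurable) ?_
  filter_upwards [ae_restrict_mem measurableSet_Ioi] with s hs
  have h0 : 0 < s := ht.trans hs
  have := pnorm_pos h0 x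
  rw [Real.norm_of_nonneg (by positivity)]
  exact inv_pnorm_pow_le n h0 x

lemma integral_inv_pnorm_pow_le (n : ℕ) {t : ℝ} (ht : 0 < t) (x : E3) :
    ∫ s in Ioi t, (pnorm s x ^ (n + 3))⁻¹ ≤ 2 * (pnorm t x ^ (n + 1))⁻¹ := by
  have hN := pnorm_pos ht x
  calc _ ≤ ∫ s in Ioi t, (√s)⁻¹ * (pnorm s x ^ (n + 2))⁻¹ := by
        refine setIntegral_mono_on (integrableOn_inv_pnorm_pow n ht x)
          (integrableOn_inv_pnorm_aux n ht x).1 measurableSet_Ioi fun s hs ↦ ?_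
        exact inv_pnorm_pow_le n (ht.trans hs) x
    _ = 2 / (n + 1 : ℝ) * (pnorm t x ^ (n + 1))⁻¹ := (integrableOn_inv_pnorm_aux n ht x).2
    _ ≤ _ := by
        refine mul_le_mul_of_nonneg_right ?_ (by positivity)
        rw [div_le_iff₀ (by positivity)]
        have : (0 : ℝ) ≤ n := by positivity
        linarith

lemma measurable_heatMoment_left (m : ℕ) (x : E3) : Measurable (fun s ↦ heatMoment m s x) :=
  (measurable_heatMoment m).comp (measurable_id.prodMk measurable_const)

lemma integrableOn_heatMoment (m : ℕ) {t : ℝ} (ht : 0 < t) (x : E3) :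
    IntegrableOn (fun s ↦ heatMoment m s x) (Ioi t) := by
  refine ((integrableOn_inv_pnorm_pow (2 * m) ht x).const_mul
    (Real.exp ((3 + 2 * m : ℕ) ^ 2))).mono' (measurable_heatMoment_left m x).aestronglyMeasurable ?_
  filter_upwards [ae_restrict_mem measurableSet_Ioi] with s hs
  have h0 : 0 < s := ht.trans hs
  rw [Real.norm_of_nonneg (heatMoment_nonneg m h0 x), add_comm (2 * m), ← div_eq_mul_inv]
  exact heatMoment_le m h0 x

lemma heatTail_nonneg (m : ℕ) {t : ℝ} (ht : 0 < t) (x : E3) : 0 ≤ heatTail m t x :=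
  setIntegral_nonneg measurableSet_Ioi fun _ hs ↦ heatMoment_nonneg m (ht.trans hs) x

lemma heatTail_le (m : ℕ) {t : ℝ} (ht : 0 < t) (x : E3) :
    heatTail m t x ≤ 2 * Real.exp ((3 + 2 * m : ℕ) ^ 2) / pnorm t x ^ (1 + 2 * m) := by
  calc heatTail m t x ≤ ∫ s in Ioi t, Real.exp ((3 + 2 * m : ℕ) ^ 2) * (pnorm s x ^ (2 * m + 3))⁻¹ := by
        refine setIntegral_mono_on (integrableOn_heatMoment m ht x)
          ((integrableOn_inv_pnorm_pow (2 * m) ht x).const_mul _) measurableSet_Ioi fun s hs ↦ ?_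
        rw [add_comm (2 * m), ← div_eq_mul_inv]
        exact heatMoment_le m (ht.trans hs) x
    _ ≤ Real.exp ((3 + 2 * m : ℕ) ^ 2) * (2 * (pnorm t x ^ (2 * m + 1))⁻¹) := by
        rw [integral_const_mul]
        exact mul_le_mul_of_nonneg_left (integral_inv_pnorm_pow_le _ ht x) (Real.exp_nonneg _)
    _ = _ := by rw [add_comm 1, div_eq_mul_inv]; ring

lemma heatTail_sub_le (m : ℕ) {t h : ℝ} (ht : 0 < t) (hh : 0 ≤ h) (x : E3) :
    |heatTail m (t + h) x - heatTail m t x| ≤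
      Real.exp ((3 + 2 * m : ℕ) ^ 2) * h / pnorm t x ^ (3 + 2 * m) := by
  have hN := pnorm_pos ht x
  have hsplit : heatTail m t x = (∫ s in Ioc t (t + h), heatMoment m s x) + heatTail m (t + h) x := by
    rw [heatTail, heatTail, ← Ioc_union_Ioi_eq_Ioi (show t ≤ t + h by linarith)]
    exact setIntegral_union (Ioc_disjoint_Ioi le_rfl) measurableSet_Ioi
      ((integrableOn_heatMoment m ht x).mono_set Ioc_subset_Ioi_self)
      ((integrableOn_heatMoment m ht x).mono_set (Ioi_subset_Ioi (by linarith)))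
  rw [hsplit, sub_add_cancel_right, abs_neg]
  have := norm_setIntegral_le_of_norm_le_const (μ := volume) (s := Ioc t (t + h))
    (f := fun s ↦ heatMoment m s x)
    (C := Real.exp ((3 + 2 * m : ℕ) ^ 2) / pnorm t x ^ (3 + 2 * m)) (by simp) (fun s hs ↦ by
      rw [Real.norm_of_nonneg (heatMoment_nonneg m (ht.trans hs.1) x)]
      refine (heatMoment_le m (ht.trans hs.1) x).trans ?_
      gcongr
      exact pnorm_mono hs.1.le x)
  rw [Real.norm_eq_abs] at this
  refine this.trans_eq ?_
  rw [measureReal_def, Real.volume_Ioc, ENNReal.toReal_ofReal (by linarith)]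
  ring

lemma hasDerivAt_heatMoment (m : ℕ) {s : ℝ} (hs : 0 < s) (x : E3) :
    HasDerivAt (fun s ↦ heatMoment m s x)
      (‖x‖ ^ 2 * heatMoment (m + 2) s x - (3 + 2 * m) * heatMoment (m + 1) s x) s := by
  have h1 : HasDerivAt (fun s : ℝ ↦ (4 * Real.pi * s) ^ (-(3 / 2) : ℝ))
      (-(3 / (2 * s)) * (4 * Real.pi * s) ^ (-(3 / 2) : ℝ)) s := by
    have := ((hasDerivAt_id s).const_mul (4 * Real.pi)).rpow_const (p := -(3 / 2))
      (Or.inl (by simp; positivity))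
    refine this.congr_deriv ?_
    simp only [id]
    rw [Real.rpow_sub_one (by positivity)]
    field_simp
  have h2 : HasDerivAt (fun s : ℝ ↦ Real.exp (-(‖x‖ ^ 2) / (4 * s)))
      (‖x‖ ^ 2 / (4 * s ^ 2) * Real.exp (-(‖x‖ ^ 2) / (4 * s))) s := by
    have := (((hasDerivAt_id s).const_mul 4).inv (by simp; positivity)).const_mul (-(‖x‖ ^ 2))
    refine (this.exp).congr_deriv ?_
    simp only [id, Pi.inv_apply, ← div_eq_mul_inv]
    field_simp
  have h3 := ((h1.mul h2).div (((hasDerivAt_id s).const_mul 2).pow m)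
    (by simp only [Pi.pow_apply, id]; positivity))
  refine h3.congr_deriv ?_
  simp only [heatMoment, heatKernel, id, Pi.mul_apply, Pi.pow_apply]
  rcases m with _ | m
  · simp
    field_simp
    ring
  · simp only [Nat.add_sub_cancel]
    push_cast
    field_simp
    ring

lemma tendsto_heatMoment (m : ℕ) (x : E3) :
    Tendsto (fun s ↦ heatMoment m s x) atTop (𝓝 0) := by
  have h := (tendsto_inv_pnorm_pow (2 + 2 * m) x).const_mul (Real.exp ((3 + 2 * m : ℕ) ^ 2))
  rw [mul_zero] at h
  refine squeeze_zero' ?_ ?_ h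
  · filter_upwards [eventually_gt_atTop 0] with s hs using heatMoment_nonneg m hs x
  · filter_upwards [eventually_gt_atTop 0] with s hs
    rw [← div_eq_mul_inv, show 2 + 2 * m + 1 = 3 + 2 * m by ring]
    exact heatMoment_le m hs x

/-- Integrate the time derivative of the moment from t to infinity, where the moment vanishes. The
heat kernel thereby becomes a combination of tails, like the Leray kernel. -/
lemma heatMoment_eq_heatTail (m : ℕ) {t : ℝ} (ht : 0 < t) (x : E3) :
    heatMoment m t x = (3 + 2 * m) * heatTail (m + 1) t x - ‖x‖ ^ 2 * heatTail (m + 2) t x := by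
  have i2 := (integrableOn_heatMoment (m + 2) ht x).const_mul (‖x‖ ^ 2)
  have i1 := (integrableOn_heatMoment (m + 1) ht x).const_mul (3 + 2 * (m : ℝ))
  have := integral_Ioi_of_hasDerivAt_of_tendsto'
    (fun s (hs : s ∈ Ici t) ↦ hasDerivAt_heatMoment m (ht.trans_le hs) x)
    (i2.sub i1) (tendsto_heatMoment m x)
  rw [integral_sub i2 i1, integral_const_mul, integral_const_mul] at this
  simp only [heatTail]
  linarith

lemma hasFDerivAt_heatMoment (m : ℕ) {s : ℝ} (hs : 0 < s) (x : E3) :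
    HasFDerivAt (heatMoment m s) (-(heatMoment (m + 1) s x) • innerSL ℝ x) x := by
  have h1 : HasFDerivAt (fun x : E3 ↦ -(‖x‖ ^ 2) / (4 * s)) (-(1 / (2 * s)) • innerSL ℝ x) x := by
    have := ((hasStrictFDerivAt_norm_sq x).hasFDerivAt.const_mul (-(1 / (4 * s))))
    refine (this.congr_fderiv ?_).congr_of_eventuallyEq ?_
    · ext v
      simp
      field_simp
      ring
    · exact Eventually.of_forall fun y ↦ by simp; field_simp
  have h2 := (h1.exp.const_mul ((4 * Real.pi * s) ^ (-(3 / 2) : ℝ))).const_mul ((2 * s) ^ m)⁻¹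
  refine (h2.congr_fderiv ?_).congr_of_eventuallyEq ?_
  · ext v
    simp [heatMoment, heatKernel]
    field_simp
    ring
  · exact Eventually.of_forall fun y ↦ by simp [heatMoment, heatKernel]; field_simp

/-- Differentiation under the integral: the factor -x/(2s) of a Gaussian derivative raises the
moment index by one, so the family of tails is closed under gradients. -/
lemma hasFDerivAt_heatTail (m : ℕ) {t : ℝ} (ht : 0 < t) (x : E3) :
    HasFDerivAt (heatTail m t) (-(heatTail (m + 1) t x) • innerSL ℝ x) x := by
  have key := hasFDerivAt_integral_of_dominated_of_fderiv_le (𝕜 := ℝ) (μ := volume.restrict (Ioi t))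
    (F := fun x s ↦ heatMoment m s x)
    (F' := fun x s ↦ -(heatMoment (m + 1) s x) • innerSL ℝ x) (x₀ := x) (s := Metric.ball x 1)
    -- The parabolic norm at the origin, √s, bounds the one at y from below, which makes the bound
    -- uniform over the unit ball around x.
    (bound := fun s ↦ (Real.exp ((3 + 2 * (m + 1) : ℕ) ^ 2) * (‖x‖ + 1)) *
      (pnorm s 0 ^ (2 * (m + 1) + 3))⁻¹)
    (Metric.ball_mem_nhds x one_pos)
    (Eventually.of_forall fun y ↦ (measurable_heatMoment_left m y).aestronglyMeasurable)
    (integrableOn_heatMoment m ht x)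
    ((measurable_heatMoment_left (m + 1) x).neg.aestronglyMeasurable.smul_const _)
    ?_ ((integrableOn_inv_pnorm_pow _ ht 0).const_mul _) ?_
  · refine key.congr_fderiv ?_
    rw [integral_smul_const, integral_neg]
    rfl
  · filter_upwards [ae_restrict_mem measurableSet_Ioi] with s hs y hy
    have h0 : 0 < s := ht.trans hs
    have hN := pnorm_pos h0 y
    have hN0 := pnorm_pos h0 0
    rw [norm_smul, innerSL_apply_norm, norm_neg, Real.norm_of_nonneg (heatMoment_nonneg _ h0 y)]
    have h1 : heatMoment (m + 1) s y ≤
        Real.exp ((3 + 2 * (m + 1) : ℕ) ^ 2) * (pnorm s 0 ^ (2 * (m + 1) + 3))⁻¹ := by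
      refine (heatMoment_le (m + 1) h0 y).trans ?_
      rw [add_comm (2 * (m + 1)), ← div_eq_mul_inv]
      gcongr
      simp [pnorm]
    have h2 : ‖y‖ ≤ ‖x‖ + 1 := by
      have := norm_sub_norm_le y x
      rw [mem_ball_iff_norm] at hy
      linarith
    calc heatMoment (m + 1) s y * ‖y‖ ≤ (Real.exp ((3 + 2 * (m + 1) : ℕ) ^ 2) *
          (pnorm s 0 ^ (2 * (m + 1) + 3))⁻¹) * (‖x‖ + 1) := by gcongr
      _ = _ := by ring
  · filter_upwards [ae_restrict_mem measurableSet_Ioi] with s hs y _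
    exact hasFDerivAt_heatMoment m (ht.trans hs) y

/-! ### Kernels of a given parabolic order, and their algebra. -/

/-- Kernels of parabolic order `a`: jointly measurable, bounded by `C (√τ + |z|)^{-a}`, and with time
increments bounded accordingly. -/
structure ParabolicKernel (a : ℕ) (k : ℝ → E3 → ℝ) : Prop where
  measurable : Measurable (fun p : ℝ × E3 ↦ k p.1 p.2)
  bound : ∃ C : ℝ, 0 ≤ C ∧ ∀ τ : ℝ, 0 < τ → ∀ z : E3, |k τ z| ≤ C / pnorm τ z ^ a ∧
    ∀ h : ℝ, 0 ≤ h → |k (τ + h) z - k τ z| ≤ C * h / pnorm τ z ^ (a + 2)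

lemma parabolicKernel_heatTail (m : ℕ) : ParabolicKernel (1 + 2 * m) (heatTail m) where
  measurable := measurable_heatTail m
  bound := by
    refine ⟨2 * Real.exp ((3 + 2 * m : ℕ) ^ 2), by positivity, fun τ hτ z ↦ ⟨?_, fun h hh ↦ ?_⟩⟩
    · rw [abs_of_nonneg (heatTail_nonneg m hτ z)]
      exact heatTail_le m hτ z
    · refine (heatTail_sub_le m hτ hh z).trans ?_
      have hN := pnorm_pos hτ z
      rw [show 1 + 2 * m + 2 = 3 + 2 * m by ring]
      have := Real.exp_nonneg (((3 + 2 * m : ℕ) : ℝ) ^ 2)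
      gcongr
      linarith

lemma ParabolicKernel.add {a : ℕ} {k₁ k₂ : ℝ → E3 → ℝ} (h₁ : ParabolicKernel a k₁)
    (h₂ : ParabolicKernel a k₂) : ParabolicKernel a (fun τ z ↦ k₁ τ z + k₂ τ z) where
  measurable := h₁.measurable.add h₂.measurable
  bound := by
    obtain ⟨C₁, hC₁, H₁⟩ := h₁.bound
    obtain ⟨C₂, hC₂, H₂⟩ := h₂.bound
    refine ⟨C₁ + C₂, by positivity, fun τ hτ z ↦ ⟨?_, fun h hh ↦ ?_⟩⟩
    · rw [add_div]
      exact (abs_add_le _ _).trans (add_le_add (H₁ τ hτ z).1 (H₂ τ hτ z).1)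
    · rw [add_mul, add_div, add_sub_add_comm]
      exact (abs_add_le _ _).trans (add_le_add ((H₁ τ hτ z).2 h hh) ((H₂ τ hτ z).2 h hh))

lemma ParabolicKernel.const_mul {a : ℕ} {k : ℝ → E3 → ℝ} (c : ℝ) (hk : ParabolicKernel a k) :
    ParabolicKernel a (fun τ z ↦ c * k τ z) where
  measurable := hk.measurable.const_mul c
  bound := by
    obtain ⟨C, hC, H⟩ := hk.bound
    refine ⟨|c| * C, by positivity, fun τ hτ z ↦ ⟨?_, fun h hh ↦ ?_⟩⟩
    · rw [abs_mul, mul_div_assoc]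
      exact mul_le_mul_of_nonneg_left (H τ hτ z).1 (abs_nonneg c)
    · rw [← mul_sub, abs_mul, mul_assoc, mul_div_assoc]
      exact mul_le_mul_of_nonneg_left ((H τ hτ z).2 h hh) (abs_nonneg c)

lemma abs_coord_le_norm (z : E3) (l : Fin 3) : |z l| ≤ ‖z‖ := by
  simpa using PiLp.norm_apply_le z l

/-- A coordinate is at most √τ + |z|, so it costs exactly one order. With `parabolicKernel_heatTail`
this gives the order of any polynomial combination of tails by counting degrees. -/
lemma ParabolicKernel.coord_mul {a : ℕ} {k : ℝ → E3 → ℝ} (l : Fin 3)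
    (hk : ParabolicKernel (a + 1) k) : ParabolicKernel a (fun τ z ↦ z l * k τ z) where
  measurable := Measurable.mul (by fun_prop) hk.measurable
  bound := by
    obtain ⟨C, hC, H⟩ := hk.bound
    refine ⟨C, hC, fun τ hτ z ↦ ?_⟩
    have hN := pnorm_pos hτ z
    have hz : |z l| ≤ pnorm τ z := (abs_coord_le_norm z l).trans (norm_le_pnorm τ z)
    refine ⟨?_, fun h hh ↦ ?_⟩
    · rw [abs_mul]
      refine (mul_le_mul hz (H τ hτ z).1 (abs_nonneg _) hN.le).trans_eq ?_
      rw [pow_succ]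
      field_simp
    · rw [← mul_sub, abs_mul]
      refine (mul_le_mul hz ((H τ hτ z).2 h hh) (abs_nonneg _) hN.le).trans_eq ?_
      rw [show a + 1 + 2 = (a + 2) + 1 by ring, pow_succ _ (a + 2)]
      field_simp

lemma norm_sq_eq_sum (z : E3) : ‖z‖ ^ 2 = z 0 * z 0 + z 1 * z 1 + z 2 * z 2 := by
  rw [EuclideanSpace.norm_sq_eq, Fin.sum_univ_three]
  simp [sq]

lemma ParabolicKernel.normSq_mul {a : ℕ} {k : ℝ → E3 → ℝ}
    (hk : ParabolicKernel (a + 2) k) : ParabolicKernel a (fun τ z ↦ ‖z‖ ^ 2 * k τ z) := by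
  have h : ∀ l : Fin 3, ParabolicKernel a (fun τ z ↦ z l * (z l * k τ z)) := fun l ↦
    ParabolicKernel.coord_mul l (ParabolicKernel.coord_mul (a := a + 1) l hk)
  convert ((h 0).add (h 1)).add (h 2) using 3 with τ z
  rw [norm_sq_eq_sum]
  ring

/-- The kernel of `e^{tΔ} ℙ` in terms of `heatTail`. -/
def lerayKernel (k j : Fin 3) (t : ℝ) (x : E3) : ℝ :=
  -- The coefficient 2 is 3 - 1: the heat kernel is 3 T₁ - |x|² T₂ in terms of the tails T_m, and
  -- the kernel of e^{tΔ}(1-ℙ), which is subtracted, is δ_{kj} T₁ - x_k x_j T₂.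
  (if k = j then 1 else 0) * (2 * heatTail 1 t x + -1 * (‖x‖ ^ 2 * heatTail 2 t x)) +
    x k * (x j * heatTail 2 t x)

/-- The derivative in the direction `l` of `lerayKernel k j`. -/
def gradLerayKernel (l k j : Fin 3) (t : ℝ) (x : E3) : ℝ :=
  (if k = j then 1 else 0) * (-4 * (x l * heatTail 2 t x) + ‖x‖ ^ 2 * (x l * heatTail 3 t x)) +
    ((if l = k then 1 else 0) * (x j * heatTail 2 t x) +
      (if l = j then 1 else 0) * (x k * heatTail 2 t x) +
      -1 * (x k * (x j * (x l * heatTail 3 t x))))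

/-- The derivative in the direction `l` of the heat kernel. -/
def gradHeatKernel (l : Fin 3) (t : ℝ) (x : E3) : ℝ := -1 * (x l * heatMoment 1 t x)

lemma parabolicKernel_leray (k j : Fin 3) : ParabolicKernel 3 (lerayKernel k j) := by
  have h1 := parabolicKernel_heatTail 1
  have h2 := parabolicKernel_heatTail 2
  exact (((h1.const_mul 2).add ((h2.normSq_mul (a := 3)).const_mul (-1))).const_mul _).add
    (ParabolicKernel.coord_mul k (h2.coord_mul j (a := 4)))

lemma parabolicKernel_gradLeray (l k j : Fin 3) : ParabolicKernel 4 (gradLerayKernel l k j) := by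
  have h2 := parabolicKernel_heatTail 2
  have h3 := parabolicKernel_heatTail 3
  refine ParabolicKernel.add (ParabolicKernel.const_mul _ (.add (.const_mul _ (h2.coord_mul l (a := 4)))
    (.normSq_mul (h3.coord_mul l (a := 6))))) (.add (.add (.const_mul _ (h2.coord_mul j (a := 4)))
      (.const_mul _ (h2.coord_mul k (a := 4)))) (.const_mul _ ?_))
  exact .coord_mul k (.coord_mul j (h3.coord_mul l (a := 6)))

lemma parabolicKernel_congr {a : ℕ} {k k' : ℝ → E3 → ℝ} (hk : ParabolicKernel a k)
    (hm : Measurable (fun p : ℝ × E3 ↦ k' p.1 p.2)) (h : ∀ τ, 0 < τ → ∀ z, k' τ z = k τ z) :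
    ParabolicKernel a k' where
  measurable := hm
  bound := by
    obtain ⟨C, hC, H⟩ := hk.bound
    refine ⟨C, hC, fun τ hτ z ↦ ⟨?_, fun r hr ↦ ?_⟩⟩
    · rw [h τ hτ]; exact (H τ hτ z).1
    · rw [h τ hτ, h (τ + r) (by linarith)]; exact (H τ hτ z).2 r hr

/-- Written as 5 T₂ - |x|² T₃, the moment inherits both its size and its time increments from the
tails. -/
lemma parabolicKernel_heatMoment_one : ParabolicKernel 5 (heatMoment 1) := by
  have h2 := parabolicKernel_heatTail 2
  have h3 := parabolicKernel_heatTail 3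
  refine parabolicKernel_congr ((h2.const_mul 5).add ((h3.normSq_mul (a := 5)).const_mul (-1)))
    (measurable_heatMoment 1) fun τ hτ z ↦ ?_
  rw [heatMoment_eq_heatTail 1 hτ]
  norm_num
  ring

lemma parabolicKernel_gradHeat (l : Fin 3) : ParabolicKernel 4 (gradHeatKernel l) :=
  (parabolicKernel_heatMoment_one.coord_mul l (a := 4)).const_mul _

lemma heatKernel_eq_mul_heatMoment {t : ℝ} (ht : 0 < t) (x : E3) :
    heatKernel t x = 2 * t * heatMoment 1 t x := by
  rw [heatMoment, pow_one]
  field_simp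

/-- The heat kernel and its time increments are bounded by multiples of `√t (√t + |x|)^{-4}`. -/
lemma exists_heatKernel_bound : ∃ C : ℝ, 0 ≤ C ∧ ∀ t : ℝ, 0 < t → ∀ x : E3,
    heatKernel t x ≤ C * √t / pnorm t x ^ 4 ∧
    ∀ h : ℝ, 0 ≤ h → |heatKernel (t + h) x - heatKernel t x| ≤
      C * (h / t) * √t / pnorm t x ^ 4 := by
  obtain ⟨C, hC, H⟩ := parabolicKernel_heatMoment_one.bound
  refine ⟨4 * C, by positivity, fun t ht x ↦ ?_⟩
  have hN := pnorm_pos ht x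
  have hq := Real.sqrt_pos.2 ht
  have hqN := sqrt_le_pnorm t x
  have hqt : √t * √t = t := Real.mul_self_sqrt ht.le
  have key : t / pnorm t x ^ 5 ≤ √t / pnorm t x ^ 4 := by
    rw [div_le_div_iff₀ (by positivity) (by positivity), pow_succ _ 4]
    calc t * pnorm t x ^ 4 = √t * (pnorm t x ^ 4 * √t) := by nth_rw 1 [← hqt]; ring
      _ ≤ _ := by gcongr
  refine ⟨?_, fun h hh ↦ ?_⟩
  · rw [heatKernel_eq_mul_heatMoment ht]
    have h1 := (le_abs_self _).trans (H t ht x).1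
    calc 2 * t * heatMoment 1 t x ≤ 2 * t * (C / pnorm t x ^ 5) := by gcongr
      _ = 2 * C * (t / pnorm t x ^ 5) := by ring
      _ ≤ 2 * C * (√t / pnorm t x ^ 4) := by gcongr
      _ ≤ _ := by
        have : 0 ≤ C * (√t / pnorm t x ^ 4) := by positivity
        rw [mul_div_assoc]; linarith
  · have ht' : 0 < t + h := by linarith
    rw [heatKernel_eq_mul_heatMoment ht, heatKernel_eq_mul_heatMoment ht']
    have h1 := (H (t + h) ht' x).1
    have h1' : C / pnorm (t + h) x ^ 5 ≤ C / pnorm t x ^ 5 := by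
      gcongr; exact pnorm_mono (by linarith) x
    have h2 := (H t ht x).2 h hh
    have h3 : t / pnorm t x ^ 7 ≤ 1 / pnorm t x ^ 5 := by
      rw [div_le_div_iff₀ (by positivity) (by positivity), show 7 = 5 + 2 from rfl, pow_add, one_mul,
        mul_comm]
      gcongr
      nlinarith
    -- The heat kernel is 2t times the first moment; the increment of the product splits into one
    -- increment for each factor.
    have e : 2 * (t + h) * heatMoment 1 (t + h) x - 2 * t * heatMoment 1 t x =
        2 * h * heatMoment 1 (t + h) x + 2 * t * (heatMoment 1 (t + h) x - heatMoment 1 t x) := by ring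
    rw [e]
    calc _ ≤ 2 * h * (C / pnorm t x ^ 5) + 2 * t * (C * h / pnorm t x ^ 7) := by
          refine (abs_add_le _ _).trans (add_le_add ?_ ?_)
          · rw [abs_mul, abs_of_nonneg (show 0 ≤ 2 * h by positivity)]
            gcongr; exact h1.trans h1'
          · rw [abs_mul, abs_of_nonneg (show 0 ≤ 2 * t by positivity)]
            gcongr
      _ = 2 * h * C * (1 / pnorm t x ^ 5) + 2 * h * C * (t / pnorm t x ^ 7) := by ring
      _ ≤ 2 * h * C * (1 / pnorm t x ^ 5) + 2 * h * C * (1 / pnorm t x ^ 5) := by gcongr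
      _ = 4 * C * (h / t) * (t / pnorm t x ^ 5) := by field_simp; ring
      _ ≤ 4 * C * (h / t) * (√t / pnorm t x ^ 4) := by gcongr
      _ = _ := by rw [mul_div_assoc]

/-! ### Spatial derivatives of the kernels. -/

lemma hasFDerivAt_coord (l : Fin 3) (x : E3) :
    HasFDerivAt (fun y : E3 ↦ y l) (EuclideanSpace.proj l : E3 →L[ℝ] ℝ) x :=
  (EuclideanSpace.proj l : E3 →L[ℝ] ℝ).hasFDerivAt

lemma inner_single_eq (l : Fin 3) (x : E3) : inner ℝ x (EuclideanSpace.single l (1 : ℝ)) = x l := by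
  simp [EuclideanSpace.inner_single_right]

lemma hasFDerivAt_heatKernel {t : ℝ} (ht : 0 < t) (x : E3) :
    HasFDerivAt (heatKernel t) (-(heatMoment 1 t x) • innerSL ℝ x) x := by
  have h := hasFDerivAt_heatMoment 0 ht x
  rwa [show heatMoment 0 t = heatKernel t from funext (heatMoment_zero t)] at h

lemma partialDeriv_heatKernel (l : Fin 3) {t : ℝ} (ht : 0 < t) (x : E3) :
    partialDeriv l (heatKernel t) x = gradHeatKernel l t x := by
  rw [partialDeriv, (hasFDerivAt_heatKernel ht x).fderiv]
  simp [gradHeatKernel, inner_single_eq]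
  ring

lemma differentiable_lerayKernel (k j : Fin 3) {t : ℝ} (ht : 0 < t) :
    Differentiable ℝ (lerayKernel k j t) := by
  have hE : ∀ m, Differentiable ℝ (heatTail m t) := fun m x ↦
    (hasFDerivAt_heatTail m ht x).differentiableAt
  have hc : ∀ l : Fin 3, Differentiable ℝ (fun y : E3 ↦ y l) := fun l x ↦
    (hasFDerivAt_coord l x).differentiableAt
  have hn : Differentiable ℝ (fun y : E3 ↦ ‖y‖ ^ 2) := fun x ↦
    (hasStrictFDerivAt_norm_sq x).hasFDerivAt.differentiableAt
  unfold lerayKernel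
  exact ((((hE 1).const_mul 2).add ((hn.mul (hE 2)).const_mul (-1))).const_mul _).add
    ((hc k).mul ((hc j).mul (hE 2)))

lemma partialDeriv_lerayKernel (l k j : Fin 3) {t : ℝ} (ht : 0 < t) (x : E3) :
    partialDeriv l (lerayKernel k j t) x = gradLerayKernel l k j t x := by
  have hE : ∀ m, HasFDerivAt (heatTail m t) (-(heatTail (m + 1) t x) • innerSL ℝ x) x := fun m ↦
    hasFDerivAt_heatTail m ht x
  have hn := (hasStrictFDerivAt_norm_sq x).hasFDerivAt
  have h := ((((hE 1).const_mul 2).add ((hn.mul (hE 2)).const_mul (-1))).const_mul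
    (if k = j then (1 : ℝ) else 0)).add
    ((hasFDerivAt_coord k x).mul ((hasFDerivAt_coord j x).mul (hE 2)))
  have h' : HasFDerivAt (lerayKernel k j t) _ x := h
  rw [partialDeriv, h'.fderiv]
  simp only [gradLerayKernel, add_apply, smul_apply, innerSL_apply_apply, inner_single_eq,
    smul_eq_mul]
  norm_num
  simp only [@eq_comm _ k l, @eq_comm _ j l]
  split_ifs <;> ring

/-- The columns of the kernel of `e^{tΔ} ℙ` are divergence-free. -/
lemma sum_gradLerayKernel (j : Fin 3) (t : ℝ) (x : E3) :
    ∑ k, gradLerayKernel k k j t x = 0 := by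
  have h := norm_sq_eq_sum x
  fin_cases j <;> simp [Fin.sum_univ_three, gradLerayKernel, h] <;> ring

/-! ### Fourier identification of the Leray kernel. -/

/-- The Fourier multiplier of `e^{sΔ}`. -/
def gaussSymbol (s : ℝ) (ξ : E3) : ℝ := Real.exp (-(4 * Real.pi ^ 2 * s * ‖ξ‖ ^ 2))

lemma gaussSymbol_pos (s : ℝ) (ξ : E3) : 0 < gaussSymbol s ξ := Real.exp_pos _

lemma continuous_gaussSymbol (s : ℝ) : Continuous (gaussSymbol s) := by
  unfold gaussSymbol; fun_prop

lemma integrable_gaussSymbol {s : ℝ} (hs : 0 < s) : Integrable (gaussSymbol s) := by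
  have h := (GaussianFourier.integrable_cexp_neg_mul_sq_norm_add (V := E3)
    (b := ((4 * Real.pi ^ 2 * s : ℝ) : ℂ)) (by rw [Complex.ofReal_re]; positivity) 0 0).re
  refine h.congr (Eventually.of_forall fun ξ ↦ ?_)
  simp only [zero_mul, add_zero, gaussSymbol]
  rw [show -((4 * Real.pi ^ 2 * s : ℝ) : ℂ) * (‖ξ‖ : ℂ) ^ 2 =
    ((-(4 * Real.pi ^ 2 * s * ‖ξ‖ ^ 2) : ℝ) : ℂ) by push_cast; ring, ← Complex.ofReal_exp]
  rfl

lemma integrable_normSq_mul_gaussSymbol {s : ℝ} (hs : 0 < s) :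
    Integrable (fun ξ ↦ ‖ξ‖ ^ 2 * gaussSymbol s ξ) := by
  refine ((integrable_gaussSymbol (half_pos hs)).const_mul (1 / (2 * Real.pi ^ 2 * s))).mono'
    ((continuous_norm.pow 2).mul (continuous_gaussSymbol s)).aestronglyMeasurable
    (Eventually.of_forall fun ξ ↦ ?_)
  rw [Real.norm_of_nonneg (mul_nonneg (by positivity) (gaussSymbol_pos s ξ).le)]
  have h1 := Real.add_one_le_exp (2 * Real.pi ^ 2 * s * ‖ξ‖ ^ 2)
  have h2 : gaussSymbol (s / 2) ξ = Real.exp (2 * Real.pi ^ 2 * s * ‖ξ‖ ^ 2) * gaussSymbol s ξ := by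
    rw [gaussSymbol, gaussSymbol, ← Real.exp_add]; congr 1; ring
  rw [h2, ← mul_assoc]
  refine mul_le_mul_of_nonneg_right ?_ (gaussSymbol_pos s ξ).le
  rw [one_div, inv_mul_eq_div, le_div_iff₀ (by positivity)]
  linarith

lemma integrable_norm_mul_gaussSymbol {s : ℝ} (hs : 0 < s) :
    Integrable (fun ξ ↦ ‖ξ‖ * gaussSymbol s ξ) := by
  refine ((integrable_gaussSymbol hs).add (integrable_normSq_mul_gaussSymbol hs)).mono'
    (continuous_norm.mul (continuous_gaussSymbol s)).aestronglyMeasurable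
    (Eventually.of_forall fun ξ ↦ ?_)
  have := gaussSymbol_pos s ξ
  rw [Real.norm_of_nonneg (by positivity)]
  simp only [Pi.add_apply]
  nlinarith [sq_nonneg (‖ξ‖ - 1), norm_nonneg ξ]

lemma fourier_gaussSymbol {s : ℝ} (hs : 0 < s) :
    𝓕 (fun ξ : E3 ↦ (gaussSymbol s ξ : ℂ)) = fun x ↦ (heatKernel s x : ℂ) := by
  ext x
  have hb : 0 < ((4 * Real.pi ^ 2 * s : ℝ) : ℂ).re := by rw [Complex.ofReal_re]; positivity
  have h := fourier_gaussian_innerProductSpace (V := E3) hb x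
  have e : (fun ξ : E3 ↦ (gaussSymbol s ξ : ℂ)) =
      fun v : E3 ↦ Complex.exp (-((4 * Real.pi ^ 2 * s : ℝ) : ℂ) * (‖v‖ : ℂ) ^ 2) := by
    ext ξ
    rw [gaussSymbol, Complex.ofReal_exp]
    congr 1
    push_cast; ring
  have hk : (heatKernel s x : ℂ) = (((4 * Real.pi * s) ^ (-(3 / 2) : ℝ) : ℝ) : ℂ) *
      Complex.exp ((-(‖x‖ ^ 2) / (4 * s) : ℝ) : ℂ) := by
    rw [heatKernel, Complex.ofReal_mul, Complex.ofReal_exp]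
  rw [e, h, hk]
  congr 1
  · rw [finrank_euclideanSpace_fin, ← Complex.ofReal_div,
      show ((3 : ℕ) / 2 : ℂ) = ((3 / 2 : ℝ) : ℂ) by push_cast; ring,
      ← Complex.ofReal_cpow (by positivity), Real.rpow_neg (by positivity),
      ← Real.inv_rpow (by positivity)]
    congr 2
    field_simp
  · congr 1
    push_cast
    have : (Real.pi : ℂ) ≠ 0 := by exact_mod_cast Real.pi_ne_zero
    have : (s : ℂ) ≠ 0 := by exact_mod_cast hs.ne'
    field_simp

/-- A coordinate on the frequency side is a derivative on the other side. The transform is assumed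
real-valued, so that the derivatives already computed for the real Gaussian moments can be inserted.
-/
lemma fourier_coord_mul {f : E3 → ℂ} (hf : Integrable f) (hvf : Integrable (fun v ↦ ‖v‖ * ‖f v‖))
    {F : E3 → ℝ} (hF : 𝓕 f = fun x ↦ (F x : ℂ)) {F' : E3 →L[ℝ] ℝ} {x : E3}
    (hF' : HasFDerivAt F F' x) (k : Fin 3) :
    𝓕 (fun v : E3 ↦ -(2 * Real.pi * Complex.I) * (v k * f v)) x =
      (F' (EuclideanSpace.single k 1) : ℂ) := by
  have h1 := Real.hasFDerivAt_fourier hf hvf x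
  rw [hF] at h1
  have h2 : HasFDerivAt (fun x ↦ (F x : ℂ)) (Complex.ofRealCLM.comp F') x :=
    Complex.ofRealCLM.hasFDerivAt.comp x hF'
  have h3 := congrArg (fun T : E3 →L[ℝ] ℂ ↦ T (EuclideanSpace.single k 1)) (h1.unique h2)
  simp only [ContinuousLinearMap.comp_apply, Complex.ofRealCLM_apply] at h3
  rw [← h3, Real.fourier_continuousLinearMap_apply]
  · refine congrFun (congrArg _ ?_) x
    funext v
    rw [VectorFourier.fourierSMulRight_apply, innerSL_apply_apply, inner_single_eq]
    simp
  · refine (hvf.const_mul (2 * Real.pi * ‖innerSL ℝ (E := E3)‖)).mono'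
      hf.1.fourierSMulRight (Eventually.of_forall fun v ↦ ?_)
    refine (VectorFourier.norm_fourierSMulRight_le _ f v).trans_eq ?_
    ring

/-- Two uses of `fourier_coord_mul` give the transform as -∂_k∂_j g_s; the factor 4π² is -(-2πi)².
-/
lemma fourier_coord_coord_gaussSymbol {s : ℝ} (hs : 0 < s) (k j : Fin 3) (x : E3) :
    𝓕 (fun ξ : E3 ↦ ((4 * Real.pi ^ 2 * (ξ k * ξ j) * gaussSymbol s ξ : ℝ) : ℂ)) x =
      (((if k = j then 1 else 0) * heatMoment 1 s x - x k * x j * heatMoment 2 s x : ℝ) : ℂ) := by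
  have i0 : Integrable (fun ξ : E3 ↦ (gaussSymbol s ξ : ℂ)) := (integrable_gaussSymbol hs).ofReal
  have i1 : Integrable (fun ξ : E3 ↦ ‖ξ‖ * ‖(gaussSymbol s ξ : ℂ)‖) := by
    refine (integrable_norm_mul_gaussSymbol hs).congr (Eventually.of_forall fun ξ ↦ ?_)
    simp [abs_of_pos (gaussSymbol_pos s ξ)]
  set f1 : E3 → ℂ := fun v ↦ -(2 * Real.pi * Complex.I) * (v k * (gaussSymbol s v : ℂ)) with hf1
  have hn1 : ∀ v, ‖f1 v‖ ≤ 2 * Real.pi * (‖v‖ * gaussSymbol s v) := fun v ↦ by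
    simp only [hf1, norm_mul, norm_neg, Complex.norm_real, Complex.norm_I, Complex.norm_two,
      Real.norm_eq_abs, abs_of_pos Real.pi_pos, abs_of_pos (gaussSymbol_pos s v), mul_one]
    have := abs_coord_le_norm v k
    have := gaussSymbol_pos s v
    gcongr
  have hc1 : Continuous f1 := by
    have := continuous_gaussSymbol s
    fun_prop
  have i2 : Integrable f1 := ((integrable_norm_mul_gaussSymbol hs).const_mul _).mono'
    hc1.aestronglyMeasurable (Eventually.of_forall hn1)
  have i3 : Integrable (fun ξ : E3 ↦ ‖ξ‖ * ‖f1 ξ‖) := by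
    refine ((integrable_normSq_mul_gaussSymbol hs).const_mul (2 * Real.pi)).mono'
      (continuous_norm.mul hc1.norm).aestronglyMeasurable (Eventually.of_forall fun ξ ↦ ?_)
    rw [norm_mul, norm_norm, norm_norm]
    calc _ ≤ ‖ξ‖ * (2 * Real.pi * (‖ξ‖ * gaussSymbol s ξ)) := by gcongr; exact hn1 ξ
      _ = _ := by ring
  have hF1 : 𝓕 f1 = fun x ↦ ((-(x k * heatMoment 1 s x) : ℝ) : ℂ) := by
    ext y
    rw [fourier_coord_mul i0 i1 (fourier_gaussSymbol hs) (hasFDerivAt_heatKernel hs y) k]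
    simp [inner_single_eq]
    ring
  have hd : HasFDerivAt (fun x : E3 ↦ -(x k * heatMoment 1 s x)) _ x :=
    ((hasFDerivAt_coord k x).mul (hasFDerivAt_heatMoment 1 hs x)).neg
  have key := fourier_coord_mul i2 i3 hF1 hd j
  have e : (fun v : E3 ↦ -(2 * Real.pi * Complex.I) * (v j * f1 v)) =
      -(fun ξ : E3 ↦ ((4 * Real.pi ^ 2 * (ξ k * ξ j) * gaussSymbol s ξ : ℝ) : ℂ)) := by
    ext v
    simp only [hf1, Pi.neg_apply]
    push_cast
    linear_combination (4 * Real.pi ^ 2 * (v k * v j) * gaussSymbol s v : ℂ) * Complex.I_sq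
  rw [e, Real.fourier_eq, ] at key
  rw [Real.fourier_eq]
  simp only [Pi.neg_apply, smul_neg, integral_neg] at key
  rw [neg_eq_iff_eq_neg] at key
  rw [key]
  norm_num [inner_single_eq]
  simp only [@eq_comm _ k j]
  split_ifs <;> push_cast <;> ring

lemma integral_gaussSymbol_Ioi {t : ℝ} {ξ : E3} (hξ : ξ ≠ 0) :
    IntegrableOn (fun s ↦ gaussSymbol s ξ) (Ioi t) ∧
    ∫ s in Ioi t, gaussSymbol s ξ = gaussSymbol t ξ / (4 * Real.pi ^ 2 * ‖ξ‖ ^ 2) := by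
  have ha : -(4 * Real.pi ^ 2 * ‖ξ‖ ^ 2) < 0 := by
    have := norm_pos_iff.2 hξ
    simp only [Left.neg_neg_iff]
    positivity
  have e : (fun s ↦ gaussSymbol s ξ) = fun s ↦ Real.exp (-(4 * Real.pi ^ 2 * ‖ξ‖ ^ 2) * s) := by
    ext s; rw [gaussSymbol]; congr 1; ring
  refine ⟨by rw [e]; exact integrableOn_exp_mul_Ioi ha t, ?_⟩
  rw [e, integral_exp_mul_Ioi ha, neg_div_neg_eq, gaussSymbol]
  congr 2
  ring

/-- The `(k, j)` entry of the multiplier of `e^{tΔ} (1 - ℙ)`. -/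
def gradSymbol (k j : Fin 3) (t : ℝ) (ξ : E3) : ℝ := gaussSymbol t ξ * (ξ k * ξ j / ‖ξ‖ ^ 2)

/-- Integrating the heat multiplier over all later times produces the factor 1/|ξ|². This replaces
the singular multiplier by a superposition of smooth ones. -/
lemma gradSymbol_eq_integral (k j : Fin 3) (t : ℝ) (ξ : E3) :
    gradSymbol k j t ξ = ∫ s in Ioi t, 4 * Real.pi ^ 2 * (ξ k * ξ j) * gaussSymbol s ξ := by
  -- At the origin the quotient is 0 by the convention on division, and the integrand vanishes as
  -- well.
  rcases eq_or_ne ξ 0 with rfl | hξ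
  · simp [gradSymbol]
  have := norm_pos_iff.2 hξ
  rw [integral_const_mul, (integral_gaussSymbol_Ioi hξ).2, gradSymbol]
  field_simp

lemma abs_coord_mul_coord_le (k j : Fin 3) (ξ : E3) : |ξ k * ξ j| ≤ ‖ξ‖ ^ 2 := by
  rw [abs_mul, sq]
  exact mul_le_mul (abs_coord_le_norm _ _) (abs_coord_le_norm _ _) (abs_nonneg _) (norm_nonneg _)

/-- Integrating the absolute value in s first leaves at most the heat multiplier at time t, because
|ξ_k ξ_j| ≤ |ξ|². This is what Fubini needs in `fourier_gradSymbol`. -/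
lemma integrable_prod_gaussSymbol (k j : Fin 3) {t : ℝ} (ht : 0 < t) :
    Integrable (fun p : E3 × ℝ ↦ 4 * Real.pi ^ 2 * (p.1 k * p.1 j) * gaussSymbol p.2 p.1)
      (volume.prod (volume.restrict (Ioi t))) := by
  have hc : Continuous (fun p : E3 × ℝ ↦ 4 * Real.pi ^ 2 * (p.1 k * p.1 j) * gaussSymbol p.2 p.1) := by
    unfold gaussSymbol; fun_prop
  have hnorm : ∀ (ξ : E3) (s : ℝ), ‖4 * Real.pi ^ 2 * (ξ k * ξ j) * gaussSymbol s ξ‖ =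
      4 * Real.pi ^ 2 * |ξ k * ξ j| * gaussSymbol s ξ := fun ξ s ↦ by
    rw [norm_mul, norm_mul, Real.norm_of_nonneg (gaussSymbol_pos s ξ).le,
      Real.norm_of_nonneg (by positivity), Real.norm_eq_abs]
  rw [integrable_prod_iff hc.aestronglyMeasurable]
  constructor
  · filter_upwards with ξ
    rcases eq_or_ne ξ 0 with rfl | hξ
    · simp
    exact (integral_gaussSymbol_Ioi hξ).1.const_mul _
  · refine (integrable_gaussSymbol ht).mono'
      hc.aestronglyMeasurable.norm.integral_prod_right' (Eventually.of_forall fun ξ ↦ ?_)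
    simp only [hnorm]
    rw [integral_const_mul, Real.norm_of_nonneg (mul_nonneg (by positivity)
      (integral_nonneg fun s ↦ (gaussSymbol_pos s ξ).le))]
    rcases eq_or_ne ξ 0 with rfl | hξ
    · simp [(gaussSymbol_pos t 0).le]
    have h0 := norm_pos_iff.2 hξ
    rw [(integral_gaussSymbol_Ioi hξ).2]
    have h1 := abs_coord_mul_coord_le k j ξ
    have h2 := gaussSymbol_pos t ξ
    calc 4 * Real.pi ^ 2 * |ξ k * ξ j| * (gaussSymbol t ξ / (4 * Real.pi ^ 2 * ‖ξ‖ ^ 2))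
        ≤ 4 * Real.pi ^ 2 * ‖ξ‖ ^ 2 * (gaussSymbol t ξ / (4 * Real.pi ^ 2 * ‖ξ‖ ^ 2)) := by gcongr
      _ = gaussSymbol t ξ := by field_simp

lemma fourier_gradSymbol (k j : Fin 3) {t : ℝ} (ht : 0 < t) (x : E3) :
    𝓕 (fun ξ : E3 ↦ (gradSymbol k j t ξ : ℂ)) x =
      (((if k = j then 1 else 0) * heatTail 1 t x - x k * x j * heatTail 2 t x : ℝ) : ℂ) := by
  have hI := integrable_prod_gaussSymbol k j ht
  have hI' : Integrable (fun p : E3 × ℝ ↦ Real.fourierChar (-inner ℝ p.1 x) •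
      ((4 * Real.pi ^ 2 * (p.1 k * p.1 j) * gaussSymbol p.2 p.1 : ℝ) : ℂ))
      (volume.prod (volume.restrict (Ioi t))) := by
    refine (hI.ofReal (𝕜 := ℂ)).mono ?_ (Eventually.of_forall fun p ↦ by simp)
    have hc : Continuous (fun p : E3 × ℝ ↦ Real.fourierChar (-inner ℝ p.1 x) •
      ((4 * Real.pi ^ 2 * (p.1 k * p.1 j) * gaussSymbol p.2 p.1 : ℝ) : ℂ)) := by
      unfold gaussSymbol
      fun_prop
    exact hc.aestronglyMeasurable
  rw [Real.fourier_eq]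
  calc ∫ ξ : E3, Real.fourierChar (-inner ℝ ξ x) • (gradSymbol k j t ξ : ℂ)
      = ∫ ξ : E3, ∫ s in Ioi t, Real.fourierChar (-inner ℝ ξ x) •
          ((4 * Real.pi ^ 2 * (ξ k * ξ j) * gaussSymbol s ξ : ℝ) : ℂ) := by
        refine integral_congr_ae (Eventually.of_forall fun ξ ↦ ?_)
        simp only [Circle.smul_def]
        rw [integral_smul, integral_complex_ofReal, gradSymbol_eq_integral]
    _ = ∫ s in Ioi t, ∫ ξ : E3, Real.fourierChar (-inner ℝ ξ x) •
          ((4 * Real.pi ^ 2 * (ξ k * ξ j) * gaussSymbol s ξ : ℝ) : ℂ) :=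
        integral_integral_swap hI'
    _ = ∫ s in Ioi t, (((if k = j then 1 else 0) * heatMoment 1 s x -
          x k * x j * heatMoment 2 s x : ℝ) : ℂ) := by
        refine setIntegral_congr_fun measurableSet_Ioi fun s hs ↦ ?_
        simp only
        rw [← fourier_coord_coord_gaussSymbol (ht.trans hs) k j x, Real.fourier_eq]
    _ = _ := by
        rw [integral_complex_ofReal, integral_sub ((integrableOn_heatMoment 1 ht x).const_mul _)
          ((integrableOn_heatMoment 2 ht x).const_mul _), integral_const_mul, integral_const_mul]
        rfl

/-- The multiplier is δ_{kj} times the heat multiplier minus `gradSymbol`. The inverse transform is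
the transform at -x, and the tails are even, so both known transforms apply directly. -/
lemma heatLerayKernel_eq (k j : Fin 3) {t : ℝ} (ht : 0 < t) (x : E3) :
    heatLerayKernel t k j x = lerayKernel k j t x := by
  have hg : Integrable (fun ξ : E3 ↦ (gaussSymbol t ξ : ℂ)) := (integrable_gaussSymbol ht).ofReal
  have hG : Integrable (fun ξ : E3 ↦ (gradSymbol k j t ξ : ℂ)) := by
    refine Integrable.ofReal ((integrable_gaussSymbol ht).mono' ?_ (Eventually.of_forall fun ξ ↦ ?_))
    · have := (continuous_gaussSymbol t).measurable
      have : Measurable (gradSymbol k j t) := by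
        unfold gradSymbol
        fun_prop
      exact this.aestronglyMeasurable
    · have h2 := gaussSymbol_pos t ξ
      change ‖gaussSymbol t ξ * (ξ k * ξ j / ‖ξ‖ ^ 2)‖ ≤ gaussSymbol t ξ
      rw [norm_mul, Real.norm_of_nonneg h2.le, norm_div, Real.norm_eq_abs,
        Real.norm_of_nonneg (by positivity)]
      have := div_le_one_of_le₀ (abs_coord_mul_coord_le k j ξ) (by positivity)
      nlinarith
  have e : (fun ξ : E3 ↦ ((heatLeraySymbol t k j ξ : ℝ) : ℂ)) =
      fun ξ ↦ (if k = j then 1 else 0 : ℂ) * (gaussSymbol t ξ : ℂ) - (gradSymbol k j t ξ : ℂ) := by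
    ext ξ
    rw [heatLeraySymbol, gradSymbol, gaussSymbol]
    split_ifs <;> push_cast <;> ring
  have hF : 𝓕 (fun ξ ↦ (if k = j then 1 else 0 : ℂ) * (gaussSymbol t ξ : ℂ) -
      (gradSymbol k j t ξ : ℂ)) (-x) = (if k = j then 1 else 0 : ℂ) *
      𝓕 (fun ξ : E3 ↦ (gaussSymbol t ξ : ℂ)) (-x) -
      𝓕 (fun ξ : E3 ↦ (gradSymbol k j t ξ : ℂ)) (-x) := by
    have hc : ∀ (a : Circle) (c z : ℂ), a • (c * z) = c * (a • z) := fun a c z ↦ by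
      simp only [Circle.smul_def, smul_eq_mul]; ring
    simp only [Real.fourier_eq, smul_sub, hc]
    rw [integral_sub, integral_const_mul]
    · exact ((Real.fourierIntegral_convergent_iff (-x)).2 hg).const_mul _
    · exact (Real.fourierIntegral_convergent_iff (-x)).2 hG
  rw [heatLerayKernel, e, Real.fourierInv_eq_fourier_neg, hF, fourier_gaussSymbol ht,
    fourier_gradSymbol k j ht, lerayKernel]
  have h0 := heatMoment_eq_heatTail 0 ht (-x)
  have hE : ∀ m, heatTail m t (-x) = heatTail m t x := fun m ↦ by
    simp [heatTail, heatMoment, heatKernel]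
  rw [heatMoment_zero, hE, hE, norm_neg] at h0
  simp only [h0, hE]
  simp only [PiLp.neg_apply]
  split_ifs
  · simp only [one_mul, ← Complex.ofReal_sub, Complex.ofReal_re]
    push_cast
    ring
  · simp only [zero_mul, zero_sub, ← Complex.ofReal_neg, Complex.ofReal_re]
    ring

lemma partialDeriv_heatLerayKernel (l k j : Fin 3) {t : ℝ} (ht : 0 < t) (x : E3) :
    partialDeriv l (heatLerayKernel t k j) x = gradLerayKernel l k j t x := by
  rw [show heatLerayKernel t k j = lerayKernel k j t from funext (heatLerayKernel_eq k j ht),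
    partialDeriv_lerayKernel l k j ht]

/-! ### Masses and spatial convolutions of parabolic weights. -/

lemma lintegral_comp_inv_smul {f : E3 → ℝ} (hf : Integrable f) (h0 : ∀ z, 0 ≤ f z) {ρ : ℝ}
    (hρ : 0 < ρ) :
    ∫⁻ z, ENNReal.ofReal (f (ρ⁻¹ • z)) = ENNReal.ofReal (ρ ^ 3 * ∫ z, f z) := by
  rw [← ofReal_integral_eq_lintegral_ofReal (hf.comp_smul (inv_ne_zero hρ.ne'))
    (Eventually.of_forall fun z ↦ h0 _), Measure.integral_comp_inv_smul_of_nonneg _ _ hρ.le,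
    finrank_euclideanSpace_fin, smul_eq_mul]

/-- The power 4 exceeds the dimension 3, so the mass is finite at ρ = 1; scaling contributes
ρ^{3-4}. -/
lemma exists_lintegral_decay : ∃ c : ℝ, 0 ≤ c ∧ ∀ ρ : ℝ, 0 < ρ →
    ∫⁻ z : E3, ENNReal.ofReal (((ρ + ‖z‖) ^ 4)⁻¹) ≤ ENNReal.ofReal (c / ρ) := by
  set f : E3 → ℝ := fun z ↦ ((1 + ‖z‖) ^ 4)⁻¹ with hf
  have hi : Integrable f := by
    have := integrable_one_add_norm (E := E3) (μ := volume) (r := 4)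
      (by rw [finrank_euclideanSpace_fin]; norm_num)
    refine this.congr (Eventually.of_forall fun z ↦ ?_)
    simp only [hf]
    rw [Real.rpow_neg (by positivity)]
    norm_cast
  have h0 : ∀ z, 0 ≤ f z := fun z ↦ by positivity
  refine ⟨∫ z, f z, integral_nonneg h0, fun ρ hρ ↦ ?_⟩
  have e : ∀ z : E3, ENNReal.ofReal (((ρ + ‖z‖) ^ 4)⁻¹) =
      ENNReal.ofReal ((ρ ^ 4)⁻¹) * ENNReal.ofReal (f (ρ⁻¹ • z)) := fun z ↦ by
    rw [← ENNReal.ofReal_mul (by positivity)]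
    congr 1
    simp only [hf]
    rw [norm_smul, norm_inv, Real.norm_of_nonneg hρ.le, ← mul_inv, ← mul_pow]
    congr 2
    field_simp
  simp only [e]
  rw [lintegral_const_mul' _ _ ENNReal.ofReal_ne_top, lintegral_comp_inv_smul hi h0 hρ,
    ← ENNReal.ofReal_mul (by positivity)]
  refine ENNReal.ofReal_le_ofReal (le_of_eq ?_)
  field_simp

lemma exists_lintegral_ball_inv_sq : ∃ c : ℝ, 0 ≤ c ∧ ∀ R : ℝ, 0 < R →
    ∫⁻ z in Metric.ball (0 : E3) R, ENNReal.ofReal ((‖z‖ ^ 2)⁻¹) ≤ ENNReal.ofReal (c * R) := by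
  have hb : IntegrableOn (fun z : E3 ↦ (‖z‖ ^ 2)⁻¹) (Metric.ball 0 1) := by
    -- In polar coordinates the Jacobian r² cancels the singularity.
    rw [integrableOn_fun_norm_addHaar volume (f := fun r : ℝ ↦ (r ^ 2)⁻¹), finrank_euclideanSpace_fin]
    refine IntegrableOn.congr_fun (f := fun _ ↦ (1 : ℝ)) (by simp) (fun y hy ↦ ?_) measurableSet_Ioo
    have : y ≠ 0 := hy.1.ne'
    simp
    field_simp
  set f : E3 → ℝ := (Metric.ball 0 1).indicator fun z : E3 ↦ (‖z‖ ^ 2)⁻¹ with hf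
  have hi : Integrable f := (integrable_indicator_iff measurableSet_ball).2 hb
  have h0 : ∀ z, 0 ≤ f z := indicator_nonneg fun z _ ↦ by positivity
  refine ⟨∫ z, f z, integral_nonneg h0, fun R hR ↦ ?_⟩
  rw [← lintegral_indicator measurableSet_ball]
  have e : ∀ z : E3, (Metric.ball (0 : E3) R).indicator (fun z ↦ ENNReal.ofReal ((‖z‖ ^ 2)⁻¹)) z =
      ENNReal.ofReal ((R ^ 2)⁻¹) * ENNReal.ofReal (f (R⁻¹ • z)) := fun z ↦ by
    have hm : R⁻¹ • z ∈ Metric.ball (0 : E3) 1 ↔ z ∈ Metric.ball (0 : E3) R := by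
      simp only [mem_ball_zero_iff, norm_smul, norm_inv, Real.norm_of_nonneg hR.le]
      rw [inv_mul_lt_one₀ hR]
    by_cases hz : z ∈ Metric.ball (0 : E3) R
    · simp only [hf]
      rw [indicator_of_mem hz, indicator_of_mem (hm.2 hz), ← ENNReal.ofReal_mul (by positivity),
        norm_smul, norm_inv, Real.norm_of_nonneg hR.le, ← mul_inv, ← mul_pow, mul_inv_cancel_left₀ hR.ne']
    · simp only [hf]
      rw [indicator_of_notMem hz, indicator_of_notMem (fun h ↦ hz (hm.1 h))]
      simp
  simp only [e]
  rw [lintegral_const_mul' _ _ ENNReal.ofReal_ne_top, lintegral_comp_inv_smul hi h0 hR,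
    ← ENNReal.ofReal_mul (by positivity)]
  refine ENNReal.ofReal_le_ofReal (le_of_eq ?_)
  field_simp

/-- Mass of `(√τ + |z|)^{-a}` on balls. -/
lemma exists_lintegral_ball_pnorm {a : ℕ} (h2 : 2 ≤ a) (h4 : a ≤ 4) : ∃ c : ℝ, 0 ≤ c ∧
    ∀ τ : ℝ, 0 < τ → ∀ R : ℝ, 0 < R →
    ∫⁻ z in Metric.ball (0 : E3) R, ENNReal.ofReal ((pnorm τ z ^ a)⁻¹) ≤
      ENNReal.ofReal (c / √τ * (R ^ 4 / R ^ a)) := by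
  obtain ⟨c₁, hc₁, H₁⟩ := exists_lintegral_decay
  obtain ⟨c₂, hc₂, H₂⟩ := exists_lintegral_ball_inv_sq
  refine ⟨c₁ + c₂, by positivity, fun τ hτ R hR ↦ ?_⟩
  have hq := Real.sqrt_pos.2 hτ
  rcases Nat.lt_or_ge a 4 with h | h
  -- For a = 3 one factor of the norm is spent on √τ and two on |z|. For a = 2 one factor goes to
  -- each, and the missing |z| is supplied by |z| ≤ R. The case a = 4 is covered by the mass of the
  -- whole space.
  · have hpt : ∀ z ∈ Metric.ball (0 : E3) R, ENNReal.ofReal ((pnorm τ z ^ a)⁻¹) ≤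
        ENNReal.ofReal ((√τ)⁻¹ * (R ^ 3 / R ^ a)) * ENNReal.ofReal ((‖z‖ ^ 2)⁻¹) +
          ({0} : Set E3).indicator (fun _ ↦ ⊤) z := fun z hz ↦ by
      -- At the origin the inverse of zero is zero, so the bound by |z|^{-2} would be false; the
      -- infinite indicator of a null set repairs it.
      rcases eq_or_ne z 0 with rfl | hz0
      · simp
      have hn := norm_pos_iff.2 hz0
      have hN := pnorm_pos hτ z
      refine le_add_right ?_
      rw [← ENNReal.ofReal_mul (by positivity)]
      refine ENNReal.ofReal_le_ofReal ?_
      have hzR : ‖z‖ ≤ R := (mem_ball_zero_iff.1 hz).le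
      have h1 : √τ * ‖z‖ ^ 2 * R ^ a ≤ pnorm τ z ^ a * R ^ 3 := by
        have hz1 := norm_le_pnorm τ z
        have hz2 := sqrt_le_pnorm τ z
        interval_cases a
        · calc √τ * ‖z‖ ^ 2 * R ^ 2 = √τ * ‖z‖ * R ^ 2 * ‖z‖ := by ring
            _ ≤ pnorm τ z * pnorm τ z * R ^ 2 * R := by gcongr
            _ = _ := by ring
        · calc √τ * ‖z‖ ^ 2 * R ^ 3 ≤ pnorm τ z * pnorm τ z ^ 2 * R ^ 3 := by gcongr
            _ = _ := by ring
      rw [inv_eq_one_div, div_le_iff₀ (by positivity)]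
      rw [show (√τ)⁻¹ * (R ^ 3 / R ^ a) * (‖z‖ ^ 2)⁻¹ * pnorm τ z ^ a =
        (pnorm τ z ^ a * R ^ 3) / (√τ * ‖z‖ ^ 2 * R ^ a) by field_simp]
      exact (one_le_div (by positivity)).2 h1
    calc _ ≤ ∫⁻ z in Metric.ball (0 : E3) R, (ENNReal.ofReal ((√τ)⁻¹ * (R ^ 3 / R ^ a)) *
          ENNReal.ofReal ((‖z‖ ^ 2)⁻¹) + ({0} : Set E3).indicator (fun _ ↦ ⊤) z) :=
          setLIntegral_mono' measurableSet_ball hpt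
      _ ≤ ENNReal.ofReal ((√τ)⁻¹ * (R ^ 3 / R ^ a)) * ENNReal.ofReal (c₂ * R) := by
          rw [lintegral_add_left (by fun_prop), lintegral_const_mul' _ _ ENNReal.ofReal_ne_top]
          have : ∫⁻ z in Metric.ball (0 : E3) R, ({0} : Set E3).indicator (fun _ ↦ (⊤ : ℝ≥0∞)) z = 0 := by
            rw [lintegral_indicator (measurableSet_singleton 0)]
            simp
          rw [this, add_zero]
          gcongr
          exact H₂ R hR
      _ ≤ _ := by
          rw [← ENNReal.ofReal_mul (by positivity)]
          refine ENNReal.ofReal_le_ofReal ?_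
          rw [show (√τ)⁻¹ * (R ^ 3 / R ^ a) * (c₂ * R) = c₂ / √τ * (R ^ 4 / R ^ a) by field_simp]
          gcongr
          linarith
  · obtain rfl : a = 4 := le_antisymm h4 h
    refine (setLIntegral_le_lintegral _ _).trans ((H₁ _ hq).trans (ENNReal.ofReal_le_ofReal ?_))
    rw [div_self (by positivity), mul_one]
    gcongr
    linarith

lemma pnorm_add_le {τ s : ℝ} (hτ : 0 ≤ τ) (hs : 0 ≤ s) (x y : E3) :
    pnorm (τ + s) x ≤ pnorm τ (x - y) + pnorm s y := by
  have h1 : √(τ + s) ≤ √τ + √s := by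
    rw [Real.sqrt_le_left (by positivity)]
    have := mul_nonneg (Real.sqrt_nonneg τ) (Real.sqrt_nonneg s)
    nlinarith [Real.sq_sqrt hτ, Real.sq_sqrt hs]
  have h2 : ‖x‖ ≤ ‖x - y‖ + ‖y‖ := by simpa using norm_add_le (x - y) y
  unfold pnorm
  linarith

/-- Put R = √(τ+s) + |x|. By the triangle inequality the norms at (τ, x-y) and (s, y) cannot both be
below R/2. Where the first is, f is at most M(2/R)^b and the kernel has controlled mass on the ball.
Where the second is, the kernel is at most (2/R)^a and f has mass at most B. Where neither is, the
product has m + 4 powers of decay: four are integrated and m are kept as R^{-m}. The mass B is a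
separate hypothesis and s = 0 is allowed, so that data of size |y|^{-3} are covered; their mass near
the origin does not follow from the pointwise bound. -/
lemma exists_lintegral_conv_le {a b m : ℕ} (ha2 : 2 ≤ a) (ha4 : a ≤ 4) (hab : a + b = m + 4) :
    ∃ C : ℝ, 0 ≤ C ∧ ∀ τ : ℝ, 0 < τ → ∀ s : ℝ, 0 ≤ s → ∀ (x : E3) (f : E3 → ℝ≥0∞) (M B : ℝ),
      0 ≤ M → 0 ≤ B → (∀ᵐ y, f y ≤ ENNReal.ofReal (M / pnorm s y ^ b)) →
      ∫⁻ y in Metric.ball 0 (pnorm (τ + s) x), f y ≤ ENNReal.ofReal B →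
      ∫⁻ y, ENNReal.ofReal ((pnorm τ (x - y) ^ a)⁻¹) * f y ≤
        ENNReal.ofReal (C * (M / √τ / pnorm (τ + s) x ^ m + B / pnorm (τ + s) x ^ a)) := by
  obtain ⟨c₁, hc₁, H₁⟩ := exists_lintegral_decay
  obtain ⟨c₂, hc₂, H₂⟩ := exists_lintegral_ball_pnorm ha2 ha4
  refine ⟨2 ^ b * c₂ + 2 ^ a + 2 * 4 ^ (a + b) * c₁, by positivity,
    fun τ hτ s hs x f M B hM hB hf hfB ↦ ?_⟩
  have hq := Real.sqrt_pos.2 hτ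
  have hR : 0 < pnorm (τ + s) x := pnorm_pos (by linarith) x
  have hqR : √τ ≤ pnorm (τ + s) x :=
    (Real.sqrt_le_sqrt (by linarith)).trans (sqrt_le_pnorm _ x)
  have htri := pnorm_add_le hτ.le hs x
  set R := pnorm (τ + s) x with hRdef
  set D : E3 → ℝ≥0∞ := fun z ↦ ENNReal.ofReal (((R + ‖z‖) ^ 4)⁻¹) with hD
  set P : E3 → ℝ≥0∞ := (Metric.ball (0 : E3) R).indicator
    fun z ↦ ENNReal.ofReal ((pnorm τ z ^ a)⁻¹) with hP
  have hDm : Measurable D := by fun_prop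
  have hPm : Measurable P := by
    refine Measurable.indicator ?_ measurableSet_ball
    unfold pnorm
    fun_prop
  set K₁ := ENNReal.ofReal (M * (2 / R) ^ b)
  set K₂ := ENNReal.ofReal ((2 / R) ^ a)
  set K₃ := ENNReal.ofReal (M * 4 ^ (a + b) / R ^ m)
  have hpt : ∀ᵐ y, ENNReal.ofReal ((pnorm τ (x - y) ^ a)⁻¹) * f y ≤
      K₁ * P (x - y) + K₃ * (D (x - y) + D y) + K₂ * (Metric.ball (0 : E3) R).indicator f y := by
    filter_upwards [hf] with y hy
    have hn := pnorm_pos hτ (x - y)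
    have hn' := pnorm_nonneg s y
    have ht := htri y
    rcases lt_or_ge (pnorm τ (x - y)) (R / 2) with h1 | h1
    · have h2 : R / 2 ≤ pnorm s y := by linarith
      refine le_add_right (le_add_right ?_)
      have hmem : x - y ∈ Metric.ball (0 : E3) R := by
        rw [mem_ball_zero_iff]
        linarith [norm_le_pnorm τ (x - y)]
      rw [hP, indicator_of_mem hmem, mul_comm]
      gcongr
      refine hy.trans (ENNReal.ofReal_le_ofReal ?_)
      rw [div_eq_mul_inv, ← inv_div R 2, inv_pow]
      gcongr
    rcases lt_or_ge (pnorm s y) (R / 2) with h2 | h2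
    · refine le_add_left ?_
      have hmem : y ∈ Metric.ball (0 : E3) R := by
        rw [mem_ball_zero_iff]
        linarith [norm_le_pnorm s y]
      rw [indicator_of_mem hmem]
      refine mul_le_mul' (ENNReal.ofReal_le_ofReal ?_) le_rfl
      rw [← inv_div R 2, inv_pow]
      gcongr
    · refine le_add_right (le_add_left ?_)
      -- Both R/2 and |x-y| are lower bounds, so their average is one too.
      have e1 : (R + ‖x - y‖) / 4 ≤ pnorm τ (x - y) := by
        linarith [norm_le_pnorm τ (x - y)]
      have e2 : (R + ‖y‖) / 4 ≤ pnorm s y := by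
        linarith [norm_le_pnorm s y]
      have p1 : 0 < R + ‖x - y‖ := by positivity
      have p2 : 0 < R + ‖y‖ := by positivity
      have hdec : ∀ z : E3, ((R + ‖z‖) ^ (a + b))⁻¹ ≤ (R ^ m)⁻¹ * ((R + ‖z‖) ^ 4)⁻¹ := fun z ↦ by
        rw [hab, pow_add, mul_inv]
        gcongr
        linarith [norm_nonneg z]
      -- The larger base is replaced by the smaller one, which decouples the two variables.
      have hmin : ((R + ‖x - y‖) ^ a)⁻¹ * ((R + ‖y‖) ^ b)⁻¹ ≤
          ((R + ‖x - y‖) ^ (a + b))⁻¹ + ((R + ‖y‖) ^ (a + b))⁻¹ := by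
        rcases le_total (R + ‖x - y‖) (R + ‖y‖) with h | h
        · refine le_add_of_le_of_nonneg ?_ (by positivity)
          rw [pow_add, mul_inv]
          gcongr
        · refine le_add_of_nonneg_of_le (by positivity) ?_
          rw [pow_add _ a b, mul_inv]
          gcongr
      calc ENNReal.ofReal ((pnorm τ (x - y) ^ a)⁻¹) * f y
          ≤ ENNReal.ofReal ((((R + ‖x - y‖) / 4) ^ a)⁻¹) *
              ENNReal.ofReal (M * (((R + ‖y‖) / 4) ^ b)⁻¹) := by
            gcongr
            refine hy.trans (ENNReal.ofReal_le_ofReal ?_)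
            rw [div_eq_mul_inv]
            gcongr
        _ = ENNReal.ofReal (M * 4 ^ (a + b) *
              (((R + ‖x - y‖) ^ a)⁻¹ * ((R + ‖y‖) ^ b)⁻¹)) := by
            rw [← ENNReal.ofReal_mul (by positivity)]
            congr 1
            field_simp
            rw [div_pow, div_pow, pow_add]
            field_simp
        _ ≤ ENNReal.ofReal (M * 4 ^ (a + b) *
              ((R ^ m)⁻¹ * ((R + ‖x - y‖) ^ 4)⁻¹ + (R ^ m)⁻¹ * ((R + ‖y‖) ^ 4)⁻¹)) := by
            refine ENNReal.ofReal_le_ofReal (mul_le_mul_of_nonneg_left (hmin.trans ?_) (by positivity))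
            exact add_le_add (hdec _) (hdec _)
        _ = K₃ * (D (x - y) + D y) := by
            rw [hD, ← ENNReal.ofReal_add (by positivity) (by positivity),
              ← ENNReal.ofReal_mul (by positivity)]
            congr 1
            ring
  calc _ ≤ ∫⁻ y, (K₁ * P (x - y) + K₃ * (D (x - y) + D y) +
        K₂ * (Metric.ball (0 : E3) R).indicator f y) := lintegral_mono_ae hpt
    _ = K₁ * (∫⁻ z, P z) + K₃ * ((∫⁻ z, D z) + ∫⁻ z, D z) +
        K₂ * ∫⁻ y in Metric.ball (0 : E3) R, f y := by
        have hPx : Measurable fun y ↦ P (x - y) := hPm.comp (measurable_const.sub measurable_id)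
        have hDx : Measurable fun y ↦ D (x - y) := hDm.comp (measurable_const.sub measurable_id)
        have hsum : Measurable fun y ↦ K₁ * P (x - y) + K₃ * (D (x - y) + D y) :=
          (hPx.const_mul _).add ((hDx.add hDm).const_mul _)
        rw [lintegral_add_left hsum,
          lintegral_add_left (hPx.const_mul _), lintegral_const_mul' _ _ ENNReal.ofReal_ne_top,
          lintegral_const_mul' _ _ ENNReal.ofReal_ne_top,
          lintegral_const_mul' _ _ ENNReal.ofReal_ne_top, lintegral_add_left hDx,
          lintegral_sub_left_eq_self P x, lintegral_sub_left_eq_self D x,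
          lintegral_indicator measurableSet_ball f]
    _ ≤ K₁ * ENNReal.ofReal (c₂ / √τ * (R ^ 4 / R ^ a)) +
          K₃ * (ENNReal.ofReal (c₁ / R) + ENNReal.ofReal (c₁ / R)) + K₂ * ENNReal.ofReal B := by
        gcongr
        · rw [hP, lintegral_indicator measurableSet_ball]
          exact H₂ τ hτ R hR
        · exact H₁ R hR
        · exact H₁ R hR
    _ = ENNReal.ofReal (M * (2 / R) ^ b * (c₂ / √τ * (R ^ 4 / R ^ a)) +
          M * 4 ^ (a + b) / R ^ m * (c₁ / R + c₁ / R) + (2 / R) ^ a * B) := by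
        rw [← ENNReal.ofReal_add (by positivity) (by positivity),
          ← ENNReal.ofReal_mul (by positivity), ← ENNReal.ofReal_mul (by positivity),
          ← ENNReal.ofReal_mul (by positivity), ← ENNReal.ofReal_add (by positivity) (by positivity),
          ← ENNReal.ofReal_add (by positivity) (by positivity)]
    _ ≤ _ := by
        refine ENNReal.ofReal_le_ofReal ?_
        have e1 : M * (2 / R) ^ b * (c₂ / √τ * (R ^ 4 / R ^ a)) =
            2 ^ b * c₂ * (M / √τ / R ^ m) := by
          have : R ^ a * R ^ b = R ^ m * R ^ 4 := by rw [← pow_add, ← pow_add, hab]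
          rw [div_pow, show M * (2 ^ b / R ^ b) * (c₂ / √τ * (R ^ 4 / R ^ a)) =
            2 ^ b * c₂ * M / √τ * (R ^ 4 / (R ^ a * R ^ b)) by field_simp, this]
          field_simp
        have e2 : M * 4 ^ (a + b) / R ^ m * (c₁ / R + c₁ / R) ≤
            2 * 4 ^ (a + b) * c₁ * (M / √τ / R ^ m) := by
          calc _ = 2 * 4 ^ (a + b) * c₁ * (M / R / R ^ m) := by field_simp; ring
            _ ≤ _ := by gcongr
        have e3 : (2 / R) ^ a * B = 2 ^ a * (B / R ^ a) := by rw [div_pow]; field_simp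
        rw [e1, e3]
        have n1 : 0 ≤ M / √τ / R ^ m := by positivity
        have n2 : 0 ≤ B / R ^ a := by positivity
        have n3 : 0 ≤ (2 : ℝ) ^ b * c₂ * (B / R ^ a) := by positivity
        have n4 : 0 ≤ (2 : ℝ) ^ a * (M / √τ / R ^ m) := by positivity
        have n5 : 0 ≤ 2 * (4 : ℝ) ^ (a + b) * c₁ * (B / R ^ a) := by positivity
        nlinarith

/-- Convolution of two powers of the parabolic norm, at a fixed time. -/
lemma exists_lintegral_conv_pnorm_le {a b m : ℕ} (ha2 : 2 ≤ a) (ha4 : a ≤ 4) (hb2 : 2 ≤ b)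
    (hb4 : b ≤ 4) (hab : a + b = m + 4) :
    ∃ C : ℝ, 0 ≤ C ∧ ∀ τ : ℝ, 0 < τ → ∀ s : ℝ, 0 < s → ∀ x : E3,
      ∫⁻ y, ENNReal.ofReal ((pnorm τ (x - y) ^ a)⁻¹ * (pnorm s y ^ b)⁻¹) ≤
        ENNReal.ofReal (C * ((√τ)⁻¹ + (√s)⁻¹) / pnorm (τ + s) x ^ m) := by
  obtain ⟨C, hC, H⟩ := exists_lintegral_conv_le ha2 ha4 hab
  obtain ⟨c, hc, Hc⟩ := exists_lintegral_ball_pnorm hb2 hb4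
  refine ⟨C * (1 + c), by positivity, fun τ hτ s hs x ↦ ?_⟩
  have hR : 0 < pnorm (τ + s) x := pnorm_pos (by linarith) x
  have hq := Real.sqrt_pos.2 hτ
  have hqs := Real.sqrt_pos.2 hs
  have h := H τ hτ s hs.le x (fun y ↦ ENNReal.ofReal ((pnorm s y ^ b)⁻¹)) 1 _ zero_le_one
    (by positivity) (Eventually.of_forall fun y ↦ by rw [one_div]) (Hc s hs _ hR)
  set R := pnorm (τ + s) x
  calc _ = ∫⁻ y, ENNReal.ofReal ((pnorm τ (x - y) ^ a)⁻¹) * ENNReal.ofReal ((pnorm s y ^ b)⁻¹) := by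
        refine lintegral_congr fun y ↦ ENNReal.ofReal_mul ?_
        have := pnorm_nonneg τ (x - y)
        positivity
    _ ≤ _ := h
    _ ≤ _ := by
        refine ENNReal.ofReal_le_ofReal ?_
        have e1 : c / √s * (R ^ 4 / R ^ b) / R ^ a = c * ((√s)⁻¹ / R ^ m) := by
          have : R ^ a * R ^ b = R ^ m * R ^ 4 := by rw [← pow_add, ← pow_add, hab]
          rw [show c / √s * (R ^ 4 / R ^ b) / R ^ a = c / √s * (R ^ 4 / (R ^ a * R ^ b)) by
            field_simp, this]
          field_simp
        rw [e1, one_div, mul_assoc, mul_div_assoc]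
        refine mul_le_mul_of_nonneg_left ?_ hC
        rw [mul_div_assoc, add_div]
        have n1 : 0 ≤ (√τ)⁻¹ / R ^ m := by positivity
        have n2 : 0 ≤ (√s)⁻¹ / R ^ m := by positivity
        nlinarith

/-! ### Time integrals -/

lemma lintegral_Ioo_rpow {r : ℝ} (hr : -1 < r) {t : ℝ} (ht : 0 ≤ t) :
    ∫⁻ s in Ioo 0 t, ENNReal.ofReal (s ^ r) = ENNReal.ofReal (t ^ (r + 1) / (r + 1)) := by
  have hi : IntegrableOn (fun s : ℝ ↦ s ^ r) (Ioo 0 t) :=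
    ((intervalIntegrable_iff_integrableOn_Ioc_of_le ht).1
      (intervalIntegral.intervalIntegrable_rpow' hr)).mono_set Ioo_subset_Ioc_self
  rw [← ofReal_integral_eq_lintegral_ofReal hi, ← integral_Ioc_eq_integral_Ioo,
    ← intervalIntegral.integral_of_le ht, integral_rpow (Or.inl hr),
    Real.zero_rpow (by linarith), sub_zero]
  filter_upwards [ae_restrict_mem measurableSet_Ioo] with s hs
  exact Real.rpow_nonneg hs.1.le _

lemma lintegral_Ioo_comp_sub (F : ℝ → ℝ≥0∞) (a t : ℝ) :
    ∫⁻ s in Ioo a t, F (t - s) = ∫⁻ s in Ioo 0 (t - a), F s := by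
  rw [← lintegral_indicator measurableSet_Ioo, ← lintegral_indicator measurableSet_Ioo,
    ← lintegral_sub_left_eq_self ((Ioo 0 (t - a)).indicator F) t]
  refine lintegral_congr fun s ↦ ?_
  by_cases hs : s ∈ Ioo a t
  · rw [indicator_of_mem hs, indicator_of_mem (by constructor <;> linarith [hs.1, hs.2])]
  · rw [indicator_of_notMem hs, indicator_of_notMem fun h ↦ hs
      (by constructor <;> linarith [h.1, h.2])]

/-- The time weight `τ^{-1/2} + s^{-1/2}`. -/
def timeWeight (τ s : ℝ) : ℝ := τ ^ (-(1 / 2) : ℝ) + s ^ (-(1 / 2) : ℝ)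

/-- A modulus of continuity in time. -/
def timeModulus (t h : ℝ) : ℝ :=
  12 * (h ^ (1 / 4 : ℝ) * t ^ (1 / 4 : ℝ)) + 4 * h ^ (1 / 2 : ℝ)

lemma timeWeight_nonneg {τ s : ℝ} (hτ : 0 ≤ τ) (hs : 0 ≤ s) : 0 ≤ timeWeight τ s :=
  add_nonneg (Real.rpow_nonneg hτ _) (Real.rpow_nonneg hs _)

lemma timeModulus_nonneg {t h : ℝ} (ht : 0 ≤ t) (hh : 0 ≤ h) : 0 ≤ timeModulus t h := by
  unfold timeModulus; positivity

lemma inv_sqrt_eq_rpow {s : ℝ} (hs : 0 ≤ s) : (√s)⁻¹ = s ^ (-(1 / 2) : ℝ) := by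
  rw [Real.sqrt_eq_rpow, Real.rpow_neg hs]

lemma lintegral_timeWeight {t : ℝ} (ht : 0 ≤ t) :
    ∫⁻ s in Ioo 0 t, ENNReal.ofReal (timeWeight (t - s) s) ≤ ENNReal.ofReal (4 * √t) := by
  have e := lintegral_Ioo_rpow (r := -(1 / 2)) (by norm_num) ht
  have e' := lintegral_Ioo_comp_sub (fun s ↦ ENNReal.ofReal (s ^ (-(1 / 2) : ℝ))) 0 t
  rw [sub_zero, e] at e'
  calc _ ≤ ∫⁻ s in Ioo 0 t, (ENNReal.ofReal ((t - s) ^ (-(1 / 2) : ℝ)) +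
        ENNReal.ofReal (s ^ (-(1 / 2) : ℝ))) := lintegral_mono fun s ↦ ENNReal.ofReal_add_le
    _ = ENNReal.ofReal (t ^ (-(1 / 2) + 1 : ℝ) / (-(1 / 2) + 1)) +
        ENNReal.ofReal (t ^ (-(1 / 2) + 1 : ℝ) / (-(1 / 2) + 1)) := by
        rw [lintegral_add_left (by fun_prop), e, e']
    _ ≤ _ := by
        rw [← ENNReal.ofReal_add (by positivity) (by positivity), Real.sqrt_eq_rpow]
        refine ENNReal.ofReal_le_ofReal (le_of_eq ?_)
        norm_num
        ring

/-- Here min(1, r) ≤ r^{1/4}. The exponent 1/4 yields a modulus in h and only worsens the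
singularities from -1/2 to -3/4, still integrable; the cross term is charged to the smaller of τ and
s. -/
lemma min_mul_timeWeight_le {h τ s : ℝ} (hh : 0 ≤ h) (hτ : 0 < τ) (hs : 0 < s) :
    min 1 (h / τ) * timeWeight τ s ≤
      h ^ (1 / 4 : ℝ) * (2 * τ ^ (-(3 / 4) : ℝ) + s ^ (-(3 / 4) : ℝ)) := by
  have h1 : min 1 (h / τ) ≤ h ^ (1 / 4 : ℝ) * τ ^ (-(1 / 4) : ℝ) := by
    rw [Real.rpow_neg hτ.le, ← div_eq_mul_inv, ← Real.div_rpow hh hτ.le]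
    rcases le_total (h / τ) 1 with h1 | h1
    · rw [min_eq_right h1]
      simpa using Real.rpow_le_rpow_of_exponent_ge' (x := h / τ) (by positivity) h1
        (by norm_num : (0 : ℝ) ≤ 1 / 4) (by norm_num : (1 / 4 : ℝ) ≤ 1)
    · rw [min_eq_left h1]
      exact Real.one_le_rpow h1 (by norm_num)
  have h2 : τ ^ (-(1 / 4) : ℝ) * timeWeight τ s ≤
      2 * τ ^ (-(3 / 4) : ℝ) + s ^ (-(3 / 4) : ℝ) := by
    have e : ∀ x : ℝ, 0 < x → x ^ (-(1 / 4) : ℝ) * x ^ (-(1 / 2) : ℝ) = x ^ (-(3 / 4) : ℝ) :=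
      fun x hx ↦ by rw [← Real.rpow_add hx]; norm_num
    rw [timeWeight, mul_add, e τ hτ]
    have p1 : 0 < τ ^ (-(3 / 4) : ℝ) := Real.rpow_pos_of_pos hτ _
    have p2 : 0 < s ^ (-(3 / 4) : ℝ) := Real.rpow_pos_of_pos hs _
    rcases le_total τ s with h | h
    · have : τ ^ (-(1 / 4) : ℝ) * s ^ (-(1 / 2) : ℝ) ≤ τ ^ (-(3 / 4) : ℝ) := by
        rw [← e τ hτ]
        exact mul_le_mul_of_nonneg_left (Real.rpow_le_rpow_of_nonpos hτ h (by norm_num))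
          (Real.rpow_nonneg hτ.le _)
      linarith
    · have : τ ^ (-(1 / 4) : ℝ) * s ^ (-(1 / 2) : ℝ) ≤ s ^ (-(3 / 4) : ℝ) := by
        rw [← e s hs]
        exact mul_le_mul_of_nonneg_right (Real.rpow_le_rpow_of_nonpos hs h (by norm_num))
          (Real.rpow_nonneg hs.le _)
      linarith
  calc _ ≤ h ^ (1 / 4 : ℝ) * τ ^ (-(1 / 4) : ℝ) * timeWeight τ s :=
        mul_le_mul_of_nonneg_right h1 (timeWeight_nonneg hτ.le hs.le)
    _ = h ^ (1 / 4 : ℝ) * (τ ^ (-(1 / 4) : ℝ) * timeWeight τ s) := by ring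
    _ ≤ _ := mul_le_mul_of_nonneg_left h2 (Real.rpow_nonneg hh _)

lemma lintegral_min_timeWeight {t h : ℝ} (ht : 0 ≤ t) (hh : 0 ≤ h) :
    ∫⁻ s in Ioo 0 t, ENNReal.ofReal (min 1 (h / (t - s)) * timeWeight (t - s) s) ≤
      ENNReal.ofReal (12 * (h ^ (1 / 4 : ℝ) * t ^ (1 / 4 : ℝ))) := by
  have e := lintegral_Ioo_rpow (r := -(3 / 4)) (by norm_num) ht
  have e' := lintegral_Ioo_comp_sub (fun s ↦ ENNReal.ofReal (s ^ (-(3 / 4) : ℝ))) 0 t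
  rw [sub_zero, e] at e'
  have hh' := Real.rpow_nonneg hh (1 / 4)
  calc _ ≤ ∫⁻ s in Ioo 0 t, (ENNReal.ofReal (2 * h ^ (1 / 4 : ℝ)) *
          ENNReal.ofReal ((t - s) ^ (-(3 / 4) : ℝ)) +
        ENNReal.ofReal (h ^ (1 / 4 : ℝ)) * ENNReal.ofReal (s ^ (-(3 / 4) : ℝ))) := by
        refine setLIntegral_mono' measurableSet_Ioo fun s hs ↦ ?_
        have h1 : 0 < t - s := by linarith [hs.2]
        rw [← ENNReal.ofReal_mul (by positivity), ← ENNReal.ofReal_mul hh',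
          ← ENNReal.ofReal_add (mul_nonneg (by positivity) (Real.rpow_nonneg h1.le _))
          (mul_nonneg hh' (Real.rpow_nonneg hs.1.le _))]
        refine ENNReal.ofReal_le_ofReal ((min_mul_timeWeight_le hh h1 hs.1).trans_eq ?_)
        ring
    _ = ENNReal.ofReal (2 * h ^ (1 / 4 : ℝ)) *
          ENNReal.ofReal (t ^ (-(3 / 4) + 1 : ℝ) / (-(3 / 4) + 1)) +
        ENNReal.ofReal (h ^ (1 / 4 : ℝ)) *
          ENNReal.ofReal (t ^ (-(3 / 4) + 1 : ℝ) / (-(3 / 4) + 1)) := by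
        rw [lintegral_add_left (by fun_prop), lintegral_const_mul' _ _ ENNReal.ofReal_ne_top,
          lintegral_const_mul' _ _ ENNReal.ofReal_ne_top, e, e']
    _ ≤ _ := by
        have := Real.rpow_nonneg ht (-(3 / 4) + 1)
        rw [← ENNReal.ofReal_mul (by positivity), ← ENNReal.ofReal_mul (by positivity),
          ← ENNReal.ofReal_add (by positivity) (by positivity)]
        refine ENNReal.ofReal_le_ofReal (le_of_eq ?_)
        norm_num
        ring

lemma lintegral_timeWeight_Ico {t h : ℝ} (ht : 0 < t) (hh : 0 ≤ h) :
    ∫⁻ s in Ico t (t + h), ENNReal.ofReal (timeWeight (t + h - s) s) ≤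
      ENNReal.ofReal (4 * h ^ (1 / 2 : ℝ)) := by
  have e := lintegral_Ioo_rpow (r := -(1 / 2)) (by norm_num) hh
  have e' := lintegral_Ioo_comp_sub (fun s ↦ ENNReal.ofReal (s ^ (-(1 / 2) : ℝ))) t (t + h)
  rw [add_sub_cancel_left, e] at e'
  have e'' : ∫⁻ s in Ioo t (t + h), ENNReal.ofReal ((s - t) ^ (-(1 / 2) : ℝ)) =
      ∫⁻ s in Ioo 0 h, ENNReal.ofReal (s ^ (-(1 / 2) : ℝ)) := by
    rw [← lintegral_indicator measurableSet_Ioo, ← lintegral_indicator measurableSet_Ioo,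
      ← lintegral_sub_right_eq_self ((Ioo 0 h).indicator _) t]
    refine lintegral_congr fun s ↦ ?_
    by_cases hs : s ∈ Ioo t (t + h)
    · rw [indicator_of_mem hs, indicator_of_mem (by constructor <;> linarith [hs.1, hs.2])]
    · rw [indicator_of_notMem hs, indicator_of_notMem fun h ↦ hs
        (by constructor <;> linarith [h.1, h.2])]
  rw [e] at e''
  rw [setLIntegral_congr Ioo_ae_eq_Ico.symm]
  calc _ ≤ ∫⁻ s in Ioo t (t + h), (ENNReal.ofReal ((t + h - s) ^ (-(1 / 2) : ℝ)) +
        ENNReal.ofReal ((s - t) ^ (-(1 / 2) : ℝ))) := by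
        -- Bounding s^{-1/2} by (s-t)^{-1/2} makes the result independent of t.
        refine setLIntegral_mono' measurableSet_Ioo fun s hs ↦ ENNReal.ofReal_add_le.trans ?_
        have := Real.rpow_le_rpow_of_nonpos (z := -(1 / 2)) (sub_pos.2 hs.1)
          (show s - t ≤ s by linarith) (by norm_num)
        gcongr
    _ = ENNReal.ofReal (h ^ (-(1 / 2) + 1 : ℝ) / (-(1 / 2) + 1)) +
        ENNReal.ofReal (h ^ (-(1 / 2) + 1 : ℝ) / (-(1 / 2) + 1)) := by
        rw [lintegral_add_left (by fun_prop), e', e'']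
    _ ≤ _ := by
        rw [← ENNReal.ofReal_add (by positivity) (by positivity)]
        refine ENNReal.ofReal_le_ofReal (le_of_eq ?_)
        norm_num
        ring

lemma lintegral_le_of_le_timeWeight {F : ℝ → ℝ → ℝ≥0∞} {A t : ℝ} (hA : 0 ≤ A) (ht : 0 < t)
    (hF : ∀ s ∈ Ioo 0 t, F (t - s) s ≤ ENNReal.ofReal (A * timeWeight (t - s) s)) :
    ∫⁻ s in Ioo 0 t, F (t - s) s ≤ ENNReal.ofReal (A * (4 * √t)) := by
  calc _ ≤ ∫⁻ s in Ioo 0 t, ENNReal.ofReal A * ENNReal.ofReal (timeWeight (t - s) s) := by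
        refine setLIntegral_mono' measurableSet_Ioo fun s hs ↦ (hF s hs).trans_eq ?_
        rw [ENNReal.ofReal_mul hA]
    _ ≤ _ := by
        rw [lintegral_const_mul' _ _ ENNReal.ofReal_ne_top, ENNReal.ofReal_mul hA]
        gcongr
        exact lintegral_timeWeight ht.le

/-- The time increment functional that bounds the increments of Duhamel integrals. -/
def timeIncrement (F : ℝ → ℝ → ℝ≥0∞) (t h : ℝ) : ℝ≥0∞ :=
  (∫⁻ s in Ioo 0 t, ENNReal.ofReal (min 1 (h / (t - s))) * F (t - s) s) +
    ∫⁻ s in Ico t (t + h), F (t + h - s) s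

/-- In the two integrals τ + s equals t or t + h. A constant A valid whenever τ + s ≥ t thus serves
both, and the decay can be evaluated at the earlier time. -/
lemma timeIncrement_le {F : ℝ → ℝ → ℝ≥0∞} {A t h : ℝ} (hA : 0 ≤ A) (ht : 0 < t) (hh : 0 ≤ h)
    (hF : ∀ τ s, 0 < τ → 0 < s → t ≤ τ + s → F τ s ≤ ENNReal.ofReal (A * timeWeight τ s)) :
    timeIncrement F t h ≤ ENNReal.ofReal (A * timeModulus t h) := by
  have h1 : ∫⁻ s in Ioo 0 t, ENNReal.ofReal (min 1 (h / (t - s))) * F (t - s) s ≤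
      ENNReal.ofReal A * ENNReal.ofReal (12 * (h ^ (1 / 4 : ℝ) * t ^ (1 / 4 : ℝ))) := by
    refine le_trans ?_ (mul_le_mul_right (lintegral_min_timeWeight ht.le hh) _)
    rw [← lintegral_const_mul' _ _ ENNReal.ofReal_ne_top]
    refine setLIntegral_mono' measurableSet_Ioo fun s hs ↦ ?_
    have hts : 0 < t - s := by linarith [hs.2]
    calc _ ≤ ENNReal.ofReal (min 1 (h / (t - s))) * ENNReal.ofReal (A * timeWeight (t - s) s) := by
          gcongr
          exact hF _ _ hts hs.1 (by linarith)
      _ = _ := by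
          rw [← ENNReal.ofReal_mul (by positivity), ← ENNReal.ofReal_mul hA]
          congr 1
          ring
  have h2 : ∫⁻ s in Ico t (t + h), F (t + h - s) s ≤
      ENNReal.ofReal A * ENNReal.ofReal (4 * h ^ (1 / 2 : ℝ)) := by
    refine le_trans ?_ (mul_le_mul_right (lintegral_timeWeight_Ico ht hh) _)
    rw [← lintegral_const_mul' _ _ ENNReal.ofReal_ne_top]
    refine setLIntegral_mono' measurableSet_Ico fun s hs ↦ ?_
    rw [← ENNReal.ofReal_mul hA]
    exact hF _ _ (by linarith [hs.2]) (ht.trans_le hs.1) (by linarith)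
  refine (add_le_add h1 h2).trans_eq ?_
  rw [← mul_add, ← ENNReal.ofReal_add (by positivity) (by positivity), ← ENNReal.ofReal_mul hA]
  rfl

/-! ### Duhamel integrals -/

/-- `∫₀ᵗ ∫ k(t - s, x - y) f(s, y) dy ds`. -/
def duhamel (k f : ℝ → E3 → ℝ) (t : ℝ) (x : E3) : ℝ :=
  ∫ p, k (t - p.1) (x - p.2) * f p.1 p.2 ∂(slab t)

/-- `f` is measurable on `(0, ∞) × ℝ³` and bounded there by `M (√s + |y|)^{-b}`. -/
structure ForceBound {F : Type*} [NormedAddCommGroup F] (b : ℕ) (M : ℝ) (f : ℝ → E3 → F) : Prop where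
  measurable : AEStronglyMeasurable (fun p : ℝ × E3 ↦ f p.1 p.2) halfSpaceTime
  bound : ∀ᵐ p ∂halfSpaceTime, ‖f p.1 p.2‖ ≤ M / pnorm p.1 p.2 ^ b

lemma slab_le (t : ℝ) : slab t ≤ halfSpaceTime :=
  Measure.restrict_mono (Set.prod_mono Ioo_subset_Ioi_self le_rfl) le_rfl

lemma slab_eq_prod (t : ℝ) : slab t = (volume.restrict (Ioo 0 t)).prod (volume : Measure E3) := by
  rw [slab, Measure.volume_eq_prod, ← Measure.prod_restrict, Measure.restrict_univ]

lemma halfSpaceTime_eq_prod :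
    halfSpaceTime = (volume.restrict (Ioi 0)).prod (volume : Measure E3) := by
  rw [halfSpaceTime, Measure.volume_eq_prod, ← Measure.prod_restrict, Measure.restrict_univ]

lemma lintegral_slab {F : ℝ × E3 → ℝ≥0∞} (hF : Measurable F) (t : ℝ) :
    ∫⁻ p, F p ∂(slab t) = ∫⁻ s in Ioo 0 t, ∫⁻ y, F (s, y) := by
  rw [slab_eq_prod, lintegral_prod _ hF.aemeasurable]

instance (t : ℝ) : SFinite (slab t) := by rw [slab]; infer_instance

instance : SFinite halfSpaceTime := by rw [halfSpaceTime]; infer_instance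

lemma ae_slab_mem (t : ℝ) : ∀ᵐ p ∂(slab t), 0 < p.1 ∧ p.1 < t := by
  filter_upwards [ae_restrict_mem (measurableSet_Ioo.prod MeasurableSet.univ)] with p hp
  exact hp.1

/-- `∫ (√τ + |x - y|)^{-a} (√s + |y|)^{-b} dy`. -/
def convMass (a b : ℕ) (x : E3) (τ s : ℝ) : ℝ≥0∞ :=
  ∫⁻ y, ENNReal.ofReal ((pnorm τ (x - y) ^ a)⁻¹ * (pnorm s y ^ b)⁻¹)

lemma exists_convMass_le {a b m : ℕ} (ha2 : 2 ≤ a) (ha4 : a ≤ 4) (hb2 : 2 ≤ b)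
    (hb4 : b ≤ 4) (hab : a + b = m + 4) :
    ∃ A : ℝ, 0 ≤ A ∧ ∀ τ : ℝ, 0 < τ → ∀ s : ℝ, 0 < s → ∀ x : E3,
      convMass a b x τ s ≤ ENNReal.ofReal (A / pnorm (τ + s) x ^ m * timeWeight τ s) := by
  obtain ⟨C, hC, H⟩ := exists_lintegral_conv_pnorm_le ha2 ha4 hb2 hb4 hab
  refine ⟨C, hC, fun τ hτ s hs x ↦ (H τ hτ s hs x).trans_eq ?_⟩
  rw [timeWeight, inv_sqrt_eq_rpow hτ.le, inv_sqrt_eq_rpow hs.le]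
  congr 1
  ring

section Duhamel

variable {a b : ℕ} {k f : ℝ → E3 → ℝ} {C M : ℝ}

lemma measurable_duhamel_kernel (hk : Measurable (fun p : ℝ × E3 ↦ k p.1 p.2)) (t : ℝ) (x : E3) :
    Measurable (fun p : ℝ × E3 ↦ k (t - p.1) (x - p.2)) :=
  hk.comp ((measurable_const.sub measurable_fst).prodMk (measurable_const.sub measurable_snd))

lemma aestronglyMeasurable_duhamel (hk : Measurable (fun p : ℝ × E3 ↦ k p.1 p.2))
    (hf : ForceBound b M f) (t T : ℝ) (x : E3) :
    AEStronglyMeasurable (fun p : ℝ × E3 ↦ k (t - p.1) (x - p.2) * f p.1 p.2) (slab T) :=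
  (measurable_duhamel_kernel hk t x).aestronglyMeasurable.mul (hf.measurable.mono_measure (slab_le T))

lemma measurable_convMass_integrand (t : ℝ) (x : E3) : Measurable (fun p : ℝ × E3 ↦
    ENNReal.ofReal ((pnorm (t - p.1) (x - p.2) ^ a)⁻¹ * (pnorm p.1 p.2 ^ b)⁻¹)) := by
  unfold pnorm
  fun_prop

lemma lintegral_duhamel_le (hC : 0 ≤ C) (hM : 0 ≤ M)
    (hk : ∀ τ : ℝ, 0 < τ → ∀ z, |k τ z| ≤ C / pnorm τ z ^ a) (hf : ForceBound b M f) (t : ℝ) (x : E3) :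
    ∫⁻ p, ‖k (t - p.1) (x - p.2) * f p.1 p.2‖ₑ ∂(slab t) ≤
      ENNReal.ofReal (C * M) * ∫⁻ s in Ioo 0 t, convMass a b x (t - s) s := by
  have hmeas := measurable_convMass_integrand (a := a) (b := b) t x
  calc _ ≤ ∫⁻ p, ENNReal.ofReal (C * M) * ENNReal.ofReal
          ((pnorm (t - p.1) (x - p.2) ^ a)⁻¹ * (pnorm p.1 p.2 ^ b)⁻¹) ∂(slab t) := by
        refine lintegral_mono_ae ?_
        filter_upwards [ae_mono (slab_le t) hf.bound, ae_slab_mem t] with p hp hpt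
        have h1 := pnorm_pos (sub_pos.2 hpt.2) (x - p.2)
        have h2 := pnorm_pos hpt.1 p.2
        rw [← ENNReal.ofReal_mul (by positivity), ← ofReal_norm, norm_mul]
        refine ENNReal.ofReal_le_ofReal ?_
        calc _ ≤ (C / pnorm (t - p.1) (x - p.2) ^ a) * (M / pnorm p.1 p.2 ^ b) := by
              gcongr
              exact hk _ (sub_pos.2 hpt.2) _
          _ = _ := by field_simp
    _ = _ := by
        rw [lintegral_const_mul' _ _ ENNReal.ofReal_ne_top, lintegral_slab hmeas]
        rfl

/-- Cut the later slab at time t. Before t the two kernels nearly cancel; after t there is only the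
later kernel, over a time interval of length h. -/
lemma duhamel_sub_le (hC : 0 ≤ C) (hM : 0 ≤ M)
    (hk : ∀ τ : ℝ, 0 < τ → ∀ z, |k τ z| ≤ C / pnorm τ z ^ a ∧
      ∀ h : ℝ, 0 ≤ h → |k (τ + h) z - k τ z| ≤ C * h / pnorm τ z ^ (a + 2))
    (hf : ForceBound b M f) {t h : ℝ} (ht : 0 < t) (hh : 0 ≤ h) (x : E3)
    (hi : Integrable (fun p : ℝ × E3 ↦ k (t - p.1) (x - p.2) * f p.1 p.2) (slab t))
    (hi' : Integrable (fun p : ℝ × E3 ↦ k (t + h - p.1) (x - p.2) * f p.1 p.2) (slab (t + h))) :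
    ‖duhamel k f (t + h) x - duhamel k f t x‖ₑ ≤
      ENNReal.ofReal (2 * C * M) * timeIncrement (convMass a b x) t h := by
  have hsub : Ioo 0 t ×ˢ (univ : Set E3) ⊆ Ioo 0 (t + h) ×ˢ univ :=
    prod_mono (Ioo_subset_Ioo le_rfl (by linarith)) le_rfl
  have hmS : MeasurableSet (Ioo 0 t ×ˢ (univ : Set E3)) := measurableSet_Ioo.prod MeasurableSet.univ
  have hslab : slab t = (slab (t + h)).restrict (Ioo 0 t ×ˢ univ) := by
    rw [slab, slab, Measure.restrict_restrict hmS, inter_eq_left.2 hsub]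
  have hslab2 : (slab (t + h)).restrict (Ioo 0 t ×ˢ univ)ᶜ =
      (volume.restrict (Ico t (t + h))).prod (volume : Measure E3) := by
    rw [slab, Measure.restrict_restrict hmS.compl, ← Measure.restrict_univ (μ := (volume : Measure E3)),
      Measure.prod_restrict, ← Measure.volume_eq_prod]
    congr 1
    ext p
    simp only [mem_inter_iff, mem_compl_iff, mem_prod, mem_Ioo, mem_univ, and_true, mem_Ico]
    constructor
    · rintro ⟨h1, h2⟩
      exact ⟨not_lt.1 fun h3 ↦ h1 ⟨h2.1, h3⟩, h2.2⟩
    · rintro ⟨h1, h2⟩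
      exact ⟨fun h3 ↦ absurd h3.2 (not_lt.2 h1), ht.trans_le h1, h2⟩
  have hi1 : Integrable (fun p : ℝ × E3 ↦ k (t + h - p.1) (x - p.2) * f p.1 p.2) (slab t) := by
    rw [hslab]; exact hi'.restrict
  have hsplit : duhamel k f (t + h) x - duhamel k f t x =
      (∫ p, (k (t + h - p.1) (x - p.2) * f p.1 p.2 - k (t - p.1) (x - p.2) * f p.1 p.2) ∂(slab t)) +
      ∫ p, k (t + h - p.1) (x - p.2) * f p.1 p.2
        ∂((volume.restrict (Ico t (t + h))).prod (volume : Measure E3)) := by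
    rw [integral_sub hi1 hi, duhamel, duhamel, ← hslab2,
      ← integral_add_compl hmS hi', ← hslab]
    ring
  have hmeas1 := measurable_convMass_integrand (a := a) (b := b) t x
  have hmeas2 := measurable_convMass_integrand (a := a) (b := b) (t + h) x
  have hb1 : ∫⁻ p, ‖k (t + h - p.1) (x - p.2) * f p.1 p.2 - k (t - p.1) (x - p.2) * f p.1 p.2‖ₑ
      ∂(slab t) ≤ ENNReal.ofReal (2 * C * M) *
      ∫⁻ s in Ioo 0 t, ENNReal.ofReal (min 1 (h / (t - s))) * convMass a b x (t - s) s := by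
    calc _ ≤ ∫⁻ p, ENNReal.ofReal (2 * C * M) * (ENNReal.ofReal (min 1 (h / (t - p.1))) *
            ENNReal.ofReal ((pnorm (t - p.1) (x - p.2) ^ a)⁻¹ * (pnorm p.1 p.2 ^ b)⁻¹)) ∂(slab t) := by
          refine lintegral_mono_ae ?_
          filter_upwards [ae_mono (slab_le t) hf.bound, ae_slab_mem t] with p hp hpt
          have hτ : 0 < t - p.1 := sub_pos.2 hpt.2
          have h1 := pnorm_pos hτ (x - p.2)
          have h2 := pnorm_pos hpt.1 p.2
          have hmin : 0 ≤ min 1 (h / (t - p.1)) := by positivity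
          rw [← ENNReal.ofReal_mul hmin, ← ENNReal.ofReal_mul (by positivity),
            ← ofReal_norm, ← sub_mul, norm_mul]
          refine ENNReal.ofReal_le_ofReal ?_
          -- For h ≥ τ the two sizes are added. Otherwise the increment bound is used, with its two
          -- extra orders converted into 1/τ by τ ≤ (√τ + |z|)².
          have hdiff : |k (t + h - p.1) (x - p.2) - k (t - p.1) (x - p.2)| ≤
              2 * C * min 1 (h / (t - p.1)) / pnorm (t - p.1) (x - p.2) ^ a := by
            obtain ⟨k1, k2⟩ := hk _ hτ (x - p.2)
            have k3 := (hk (t - p.1 + h) (by linarith) (x - p.2)).1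
            have k4 := k2 h hh
            rw [show t + h - p.1 = t - p.1 + h by ring]
            rcases le_total 1 (h / (t - p.1)) with hc | hc
            · rw [min_eq_left hc]
              have k5 : C / pnorm (t - p.1 + h) (x - p.2) ^ a ≤ C / pnorm (t - p.1) (x - p.2) ^ a := by
                gcongr
                exact pnorm_mono (by linarith) _
              calc _ ≤ _ := abs_sub _ _
                _ ≤ C / pnorm (t - p.1) (x - p.2) ^ a + C / pnorm (t - p.1) (x - p.2) ^ a :=
                  add_le_add (k3.trans k5) k1
                _ = _ := by ring
            · rw [min_eq_right hc]
              have k5 : C * h / pnorm (t - p.1) (x - p.2) ^ (a + 2) ≤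
                  C * (h / (t - p.1)) / pnorm (t - p.1) (x - p.2) ^ a := by
                have k6 : t - p.1 ≤ pnorm (t - p.1) (x - p.2) ^ 2 := by
                  have := pow_le_pow_left₀ (Real.sqrt_nonneg _) (sqrt_le_pnorm (t - p.1) (x - p.2)) 2
                  rwa [Real.sq_sqrt hτ.le] at this
                rw [pow_add, mul_div_assoc, mul_div_assoc, div_div]
                refine mul_le_mul_of_nonneg_left ?_ hC
                refine div_le_div_of_nonneg_left hh (by positivity) ?_
                rw [mul_comm]
                gcongr
              refine (k4.trans k5).trans ?_
              gcongr
              linarith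
          calc _ ≤ (2 * C * min 1 (h / (t - p.1)) / pnorm (t - p.1) (x - p.2) ^ a) *
                (M / pnorm p.1 p.2 ^ b) := by
                gcongr
                exact hdiff
            _ = _ := by field_simp
      _ = _ := by
          rw [lintegral_const_mul' _ _ ENNReal.ofReal_ne_top, lintegral_slab]
          · congr 1
            refine lintegral_congr fun s ↦ ?_
            dsimp only
            rw [lintegral_const_mul' _ _ ENNReal.ofReal_ne_top]
            rfl
          · exact Measurable.mul (by fun_prop) hmeas1
  have hb2 : ∫⁻ p, ‖k (t + h - p.1) (x - p.2) * f p.1 p.2‖ₑ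
      ∂((volume.restrict (Ico t (t + h))).prod (volume : Measure E3)) ≤ ENNReal.ofReal (2 * C * M) *
      ∫⁻ s in Ico t (t + h), convMass a b x (t + h - s) s := by
    have hae : ∀ᵐ p ∂((volume.restrict (Ico t (t + h))).prod (volume : Measure E3)),
        ‖k (t + h - p.1) (x - p.2) * f p.1 p.2‖ₑ ≤ ENNReal.ofReal (2 * C * M) *
          ENNReal.ofReal ((pnorm (t + h - p.1) (x - p.2) ^ a)⁻¹ * (pnorm p.1 p.2 ^ b)⁻¹) := by
      rw [← hslab2]
      refine ae_restrict_of_ae ?_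
      filter_upwards [ae_mono (slab_le (t + h)) hf.bound, ae_slab_mem (t + h)] with p hp hpt
      have hτ : 0 < t + h - p.1 := sub_pos.2 hpt.2
      have h1 := pnorm_pos hτ (x - p.2)
      have h2 := pnorm_pos hpt.1 p.2
      rw [← ENNReal.ofReal_mul (by positivity), ← ofReal_norm, norm_mul]
      refine ENNReal.ofReal_le_ofReal ?_
      calc _ ≤ (C / pnorm (t + h - p.1) (x - p.2) ^ a) * (M / pnorm p.1 p.2 ^ b) := by
            gcongr
            exact (hk _ hτ _).1
        _ = C * M * ((pnorm (t + h - p.1) (x - p.2) ^ a)⁻¹ * (pnorm p.1 p.2 ^ b)⁻¹) := by field_simp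
        _ ≤ _ := by
          gcongr
          linarith
    refine (lintegral_mono_ae hae).trans_eq ?_
    rw [lintegral_const_mul' _ _ ENNReal.ofReal_ne_top, lintegral_prod _ hmeas2.aemeasurable]
    rfl
  rw [hsplit, timeIncrement, mul_add]
  refine (enorm_add_le _ _).trans (add_le_add ?_ ?_)
  · exact (enorm_integral_le_lintegral_enorm _).trans hb1
  · exact (enorm_integral_le_lintegral_enorm _).trans hb2

end Duhamel

lemma abs_le_of_enorm_le {r B : ℝ} (hB : 0 ≤ B) (h : ‖r‖ₑ ≤ ENNReal.ofReal B) : |r| ≤ B := by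
  rw [← ofReal_norm, Real.norm_eq_abs] at h
  exact (ENNReal.ofReal_le_ofReal_iff hB).1 h

section Duhamel

variable {a b m : ℕ} {k : ℝ → E3 → ℝ}

/-- At each time s the spatial convolution carries the weight (t-s)^{-1/2} + s^{-1/2}, whose
integral over (0, t) is at most 4√t. Every later estimate is this one with (a, b, m) equal to
(4,2,2), (3,3,2) or (4,4,4). -/
lemma exists_duhamel_bound (hk : ParabolicKernel a k) (ha2 : 2 ≤ a) (ha4 : a ≤ 4) (hb2 : 2 ≤ b)
    (hb4 : b ≤ 4) (hab : a + b = m + 4) :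
    ∃ A : ℝ, 0 ≤ A ∧ ∀ (M : ℝ) (f : ℝ → E3 → ℝ), 0 ≤ M → ForceBound b M f → ∀ (t : ℝ), 0 < t → ∀ x : E3,
      (∫⁻ p, ‖k (t - p.1) (x - p.2) * f p.1 p.2‖ₑ ∂(slab t) ≤
        ENNReal.ofReal (A * M * √t / pnorm t x ^ m)) ∧
      Integrable (fun p : ℝ × E3 ↦ k (t - p.1) (x - p.2) * f p.1 p.2) (slab t) ∧
      |duhamel k f t x| ≤ A * M * √t / pnorm t x ^ m ∧
      ∀ h : ℝ, 0 ≤ h → |duhamel k f (t + h) x - duhamel k f t x| ≤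
        A * M * timeModulus t h / pnorm t x ^ m := by
  obtain ⟨C, hC, HC⟩ := hk.bound
  obtain ⟨B, hB, HB⟩ := exists_convMass_le ha2 ha4 hb2 hb4 hab
  have key : ∀ (M : ℝ) (f : ℝ → E3 → ℝ), 0 ≤ M → ForceBound b M f → ∀ (t : ℝ), 0 < t → ∀ x : E3,
      ∫⁻ p, ‖k (t - p.1) (x - p.2) * f p.1 p.2‖ₑ ∂(slab t) ≤
        ENNReal.ofReal (4 * C * B * M * √t / pnorm t x ^ m) := fun M f hM hf t ht x ↦ by
    have hN := pnorm_pos ht x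
    have h1 : ∫⁻ s in Ioo 0 t, convMass a b x (t - s) s ≤
        ENNReal.ofReal (B / pnorm t x ^ m * (4 * √t)) :=
      lintegral_le_of_le_timeWeight (F := convMass a b x) (A := B / pnorm t x ^ m)
      (by positivity) ht fun s hs ↦ by
        have := HB (t - s) (by linarith [hs.2]) s hs.1 x
        rwa [sub_add_cancel] at this
    refine (lintegral_duhamel_le hC hM (fun τ hτ z ↦ (HC τ hτ z).1) hf t x).trans ?_
    refine (mul_le_mul_right h1 _).trans_eq ?_
    rw [← ENNReal.ofReal_mul (by positivity)]
    congr 1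
    ring
  have hint : ∀ (M : ℝ) (f : ℝ → E3 → ℝ), 0 ≤ M → ForceBound b M f → ∀ (t : ℝ), 0 < t → ∀ x : E3,
      Integrable (fun p : ℝ × E3 ↦ k (t - p.1) (x - p.2) * f p.1 p.2) (slab t) :=
    fun M f hM hf t ht x ↦ ⟨aestronglyMeasurable_duhamel hk.measurable hf t t x,
      (key M f hM hf t ht x).trans_lt ENNReal.ofReal_lt_top⟩
  refine ⟨4 * C * B, by positivity, fun M f hM hf t ht x ↦
    ⟨key M f hM hf t ht x, hint M f hM hf t ht x, ?_, fun h hh ↦ ?_⟩⟩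
  · have hN := pnorm_pos ht x
    exact abs_le_of_enorm_le (by positivity)
      ((enorm_integral_le_lintegral_enorm _).trans (key M f hM hf t ht x))
  · have hN := pnorm_pos ht x
    have hmod := timeModulus_nonneg ht.le hh
    refine abs_le_of_enorm_le (by positivity) ((duhamel_sub_le hC hM HC hf ht hh x
      (hint M f hM hf t ht x) (hint M f hM hf _ (by linarith) x)).trans ?_)
    have h1 := timeIncrement_le (F := convMass a b x) (A := B / pnorm t x ^ m) (by positivity) ht hh
      fun τ s hτ hs hts ↦ (HB τ hτ s hs x).trans (ENNReal.ofReal_le_ofReal (by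
        have := timeWeight_nonneg hτ.le hs.le
        gcongr
        exact pnorm_mono hts x))
    refine (mul_le_mul_right h1 _).trans ?_
    rw [← ENNReal.ofReal_mul (by positivity)]
    refine ENNReal.ofReal_le_ofReal ?_
    rw [show 2 * C * M * (B / pnorm t x ^ m * timeModulus t h) =
      2 * C * B * M * timeModulus t h / pnorm t x ^ m by ring]
    gcongr
    linarith

lemma measurable_convMass (t : ℝ) :
    Measurable (fun q : E3 × ℝ ↦ convMass a b q.1 (t - q.2) q.2) := by
  unfold convMass
  refine Measurable.lintegral_prod_right' (f := fun q : (E3 × ℝ) × E3 ↦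
    ENNReal.ofReal ((pnorm (t - q.1.2) (q.1.1 - q.2) ^ a)⁻¹ * (pnorm q.1.2 q.2 ^ b)⁻¹)) ?_
  unfold pnorm
  fun_prop

/-- By Tonelli the mass of a convolution is the product of the masses c/√τ and c/√s, finite because
both orders exceed 3. Since √t ≤ √τ + √s, this product is at most c²/√t times the time weight. -/
lemma exists_lintegral_convMass_le : ∃ c : ℝ, 0 ≤ c ∧ ∀ t τ s : ℝ, 0 < t → 0 < τ → 0 < s → t ≤ τ + s →
    ∫⁻ x, convMass 4 4 x τ s ≤ ENNReal.ofReal (c / √t * timeWeight τ s) := by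
  obtain ⟨c, hc, H⟩ := exists_lintegral_decay
  refine ⟨c * c, by positivity, fun t τ s ht hτ hs hts ↦ ?_⟩
  have h1 : ∀ ρ > 0, ∫⁻ y : E3, ENNReal.ofReal ((pnorm ρ y ^ 4)⁻¹) ≤ ENNReal.ofReal (c / √ρ) :=
    fun ρ hρ ↦ H _ (Real.sqrt_pos.2 hρ)
  have hm : ∀ ρ, Measurable fun y : E3 ↦ ENNReal.ofReal ((pnorm ρ y ^ 4)⁻¹) := fun ρ ↦ by
    unfold pnorm; fun_prop
  have hqτ := Real.sqrt_pos.2 hτ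
  have hqs := Real.sqrt_pos.2 hs
  have hqt := Real.sqrt_pos.2 ht
  calc ∫⁻ x, convMass 4 4 x τ s = ∫⁻ x, ∫⁻ y, ENNReal.ofReal ((pnorm τ (x - y) ^ 4)⁻¹) *
          ENNReal.ofReal ((pnorm s y ^ 4)⁻¹) := by
        refine lintegral_congr fun x ↦ lintegral_congr fun y ↦ ENNReal.ofReal_mul ?_
        have := pnorm_pos hτ (x - y)
        positivity
    _ = ∫⁻ y, ∫⁻ x, ENNReal.ofReal ((pnorm τ (x - y) ^ 4)⁻¹) *
          ENNReal.ofReal ((pnorm s y ^ 4)⁻¹) := by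
        refine lintegral_lintegral_swap (Measurable.aemeasurable ?_)
        unfold pnorm
        fun_prop
    _ = (∫⁻ x : E3, ENNReal.ofReal ((pnorm τ x ^ 4)⁻¹)) *
          ∫⁻ y : E3, ENNReal.ofReal ((pnorm s y ^ 4)⁻¹) := by
        rw [← lintegral_const_mul _ (hm s)]
        refine lintegral_congr fun y ↦ ?_
        rw [lintegral_mul_const' _ _ ENNReal.ofReal_ne_top,
          lintegral_sub_right_eq_self (fun z ↦ ENNReal.ofReal ((pnorm τ z ^ 4)⁻¹)) y]
    _ ≤ ENNReal.ofReal (c / √τ) * ENNReal.ofReal (c / √s) := mul_le_mul' (h1 τ hτ) (h1 s hs)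
    _ ≤ _ := by
        rw [← ENNReal.ofReal_mul (by positivity)]
        refine ENNReal.ofReal_le_ofReal ?_
        rw [timeWeight, ← inv_sqrt_eq_rpow hτ.le, ← inv_sqrt_eq_rpow hs.le]
        have h2 : √t ≤ √τ + √s := by
          have h3 := pnorm_add_le hτ.le hs.le 0 0
          simp only [pnorm, sub_zero, norm_zero, add_zero] at h3
          exact (Real.sqrt_le_sqrt hts).trans h3
        rw [show c / √τ * (c / √s) = c * c / (√τ * √s) by field_simp,
          show c * c / √t * ((√τ)⁻¹ + (√s)⁻¹) = c * c * ((√τ + √s) / √t) / (√τ * √s) by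
            field_simp; ring]
        refine div_le_div_of_nonneg_right ?_ (by positivity)
        exact le_mul_of_one_le_right (by positivity) ((one_le_div hqt).2 h2)

lemma lintegral_timeIncrement_convMass (t h : ℝ) :
    ∫⁻ x, timeIncrement (convMass a b x) t h =
      timeIncrement (fun τ s ↦ ∫⁻ x, convMass a b x τ s) t h := by
  have m1 : Measurable (fun q : E3 × ℝ ↦
      ENNReal.ofReal (min 1 (h / (t - q.2))) * convMass a b q.1 (t - q.2) q.2) :=
    Measurable.mul (by fun_prop) (measurable_convMass t)
  have m2 := measurable_convMass (a := a) (b := b) (t + h)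
  have s1 := lintegral_lintegral_swap (μ := (volume : Measure E3)) (ν := volume.restrict (Ioo 0 t))
    (f := fun x s ↦ ENNReal.ofReal (min 1 (h / (t - s))) * convMass a b x (t - s) s) m1.aemeasurable
  have s2 := lintegral_lintegral_swap (μ := (volume : Measure E3))
    (ν := volume.restrict (Ico t (t + h))) (f := fun x s ↦ convMass a b x (t + h - s) s)
    m2.aemeasurable
  unfold timeIncrement
  rw [lintegral_add_left m1.lintegral_prod_right', s1, s2]
  congr 1
  refine lintegral_congr fun s ↦ ?_
  rw [lintegral_const_mul' _ _ ENNReal.ofReal_ne_top]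

/-- Duhamel integrals with kernels of order `4` and forces of order `4` are bounded and continuous
in time with values in `L¹`. -/
lemma exists_duhamel_L1_bound (hk : ParabolicKernel 4 k) :
    ∃ A : ℝ, 0 ≤ A ∧ ∀ (M : ℝ) (f : ℝ → E3 → ℝ), 0 ≤ M → ForceBound 4 M f → ∀ (t : ℝ), 0 < t →
      ∫⁻ x, ‖duhamel k f t x‖ₑ ≤ ENNReal.ofReal (A * M) ∧
      ∀ h : ℝ, 0 ≤ h → ∫⁻ x, ‖duhamel k f (t + h) x - duhamel k f t x‖ₑ ≤
        ENNReal.ofReal (A * M * timeModulus t h / √t) := by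
  obtain ⟨C, hC, HC⟩ := hk.bound
  obtain ⟨c, hc, Hc⟩ := exists_lintegral_convMass_le
  obtain ⟨_, _, HA⟩ := exists_duhamel_bound (m := 4) (b := 4) hk (by norm_num) le_rfl (by norm_num)
    le_rfl rfl
  refine ⟨4 * C * c, by positivity, fun M f hM hf t ht ↦ ⟨?_, fun h hh ↦ ?_⟩⟩
  · have hq := Real.sqrt_pos.2 ht
    calc _ ≤ ∫⁻ x, ENNReal.ofReal (C * M) * ∫⁻ s in Ioo 0 t, convMass 4 4 x (t - s) s :=
          lintegral_mono fun x ↦ (enorm_integral_le_lintegral_enorm _).trans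
            (lintegral_duhamel_le hC hM (fun τ hτ z ↦ (HC τ hτ z).1) hf t x)
      _ = ENNReal.ofReal (C * M) * ∫⁻ s in Ioo 0 t, ∫⁻ x, convMass 4 4 x (t - s) s := by
          rw [lintegral_const_mul' _ _ ENNReal.ofReal_ne_top,
            lintegral_lintegral_swap (measurable_convMass t).aemeasurable]
      _ ≤ ENNReal.ofReal (C * M) * ENNReal.ofReal (c / √t * (4 * √t)) := by
          gcongr
          exact lintegral_le_of_le_timeWeight (F := fun τ s ↦ ∫⁻ x, convMass 4 4 x τ s)
            (by positivity) ht fun s hs ↦ Hc t _ _ ht (by linarith [hs.2]) hs.1 (by linarith)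
      _ = _ := by
          rw [← ENNReal.ofReal_mul (by positivity)]
          congr 1
          field_simp
  · have hq := Real.sqrt_pos.2 ht
    have hmod := timeModulus_nonneg ht.le hh
    calc _ ≤ ∫⁻ x, ENNReal.ofReal (2 * C * M) * timeIncrement (convMass 4 4 x) t h :=
          lintegral_mono fun x ↦ duhamel_sub_le hC hM HC hf ht hh x (HA M f hM hf t ht x).2.1
            (HA M f hM hf _ (by linarith) x).2.1
      _ = ENNReal.ofReal (2 * C * M) * timeIncrement (fun τ s ↦ ∫⁻ x, convMass 4 4 x τ s) t h := by
          rw [lintegral_const_mul' _ _ ENNReal.ofReal_ne_top, lintegral_timeIncrement_convMass]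
      _ ≤ ENNReal.ofReal (2 * C * M) * ENNReal.ofReal (c / √t * timeModulus t h) := by
          gcongr
          exact timeIncrement_le (by positivity) ht hh fun τ s hτ hs hts ↦ Hc t τ s ht hτ hs hts
      _ ≤ _ := by
          rw [← ENNReal.ofReal_mul (by positivity)]
          refine ENNReal.ofReal_le_ofReal ?_
          rw [show 2 * C * M * (c / √t * timeModulus t h) = 2 * C * c * M * timeModulus t h / √t by ring]
          gcongr
          linarith

/-- Forces matter only up to space-time null sets. This allows measurable representatives below, and
it later carries uniqueness from almost every point of space-time to every time. -/
lemma duhamel_congr {f g : ℝ → E3 → ℝ} (h : ∀ᵐ p ∂halfSpaceTime, f p.1 p.2 = g p.1 p.2) (t : ℝ) (x : E3) :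
    duhamel k f t x = duhamel k g t x :=
  integral_congr_ae <| by
    filter_upwards [ae_mono (slab_le t) h] with p hp
    rw [hp]

lemma slab_eq_restrict (t : ℝ) : slab t = halfSpaceTime.restrict {p | p.1 < t} := by
  rw [slab, halfSpaceTime, Measure.restrict_restrict (measurableSet_lt measurable_fst measurable_const)]
  congr 1
  ext p
  simp [and_comm]

/-- The time-dependent slab is moved into the integrand as a condition, and the force is replaced by
a measurable representative, so that a parametric integral over a fixed measure remains. -/
lemma stronglyMeasurable_duhamel (hk : Measurable (fun p : ℝ × E3 ↦ k p.1 p.2)) {f : ℝ → E3 → ℝ}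
    (hf : AEStronglyMeasurable (fun p : ℝ × E3 ↦ f p.1 p.2) halfSpaceTime) :
    StronglyMeasurable (fun q : ℝ × E3 ↦ duhamel k f q.1 q.2) := by
  have e : (fun q : ℝ × E3 ↦ duhamel k f q.1 q.2) = fun q ↦ ∫ p,
      (if p.1 < q.1 then k (q.1 - p.1) (q.2 - p.2) * hf.mk _ p else 0) ∂halfSpaceTime := by
    ext q
    rw [duhamel_congr (g := fun s y ↦ hf.mk _ (s, y)) hf.ae_eq_mk, duhamel, slab_eq_restrict,
      ← integral_indicator (measurableSet_lt measurable_fst measurable_const)]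
    rfl
  rw [e]
  refine StronglyMeasurable.integral_prod_right' (f := fun r : (ℝ × E3) × (ℝ × E3) ↦
    if r.2.1 < r.1.1 then k (r.1.1 - r.2.1) (r.1.2 - r.2.2) * hf.mk _ r.2 else 0) ?_
  have h1 : Measurable (hf.mk _) := hf.stronglyMeasurable_mk.measurable
  have h2 : Measurable (fun r : (ℝ × E3) × (ℝ × E3) ↦ k (r.1.1 - r.2.1) (r.1.2 - r.2.2)) :=
    hk.comp (g := fun p : ℝ × E3 ↦ k p.1 p.2)
      (f := fun r : (ℝ × E3) × (ℝ × E3) ↦ (r.1.1 - r.2.1, r.1.2 - r.2.2)) (by fun_prop)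
  exact (Measurable.ite (measurableSet_lt (by fun_prop) (by fun_prop))
    (h2.mul (h1.comp measurable_snd)) measurable_const).stronglyMeasurable

end Duhamel

/-! ### The heat semigroup on decaying data -/

/-- Data bounded by `M |y|^{-b}`, with the corresponding mass on balls. -/
structure DecayingDatum (b : ℕ) (M : ℝ) (f : E3 → ℝ) : Prop where
  measurable : AEStronglyMeasurable f volume
  bound : ∀ᵐ y, |f y| ≤ M / ‖y‖ ^ b
  mass : ∀ R : ℝ, 0 < R → ∫⁻ y in Metric.ball 0 R, ‖f y‖ₑ ≤ ENNReal.ofReal (M * (R ^ 3 / R ^ b))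

/-- The convolution estimate at s = 0: the mass of the datum on a ball of radius R = √t + |x|,
divided by R⁴, is at most M R^{-b}/√t. -/
lemma exists_heat_conv_bound (b : ℕ) : ∃ A : ℝ, 0 ≤ A ∧ ∀ (M : ℝ) (f : E3 → ℝ), 0 ≤ M →
    DecayingDatum b M f → ∀ t : ℝ, 0 < t → ∀ x : E3,
    ∫⁻ y, ENNReal.ofReal ((pnorm t (x - y) ^ 4)⁻¹) * ‖f y‖ₑ ≤
      ENNReal.ofReal (A * M / √t / pnorm t x ^ b) := by
  obtain ⟨C, hC, H⟩ := exists_lintegral_conv_le (a := 4) (b := b) (m := b) (by norm_num) le_rfl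
    (add_comm _ _)
  refine ⟨2 * C, by positivity, fun M f hM hf t ht x ↦ ?_⟩
  have hN := pnorm_pos ht x
  have hq := Real.sqrt_pos.2 ht
  have hqN := sqrt_le_pnorm t x
  have h := H t ht 0 le_rfl x (fun y ↦ ‖f y‖ₑ) M (M * (pnorm t x ^ 3 / pnorm t x ^ b)) hM
    (by positivity) (by
      filter_upwards [hf.bound] with y hy
      rw [← ofReal_norm, Real.norm_eq_abs]
      refine ENNReal.ofReal_le_ofReal ?_
      simpa [pnorm] using hy) (by
      rw [add_zero]
      exact hf.mass _ hN)
  rw [add_zero] at h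
  refine h.trans (ENNReal.ofReal_le_ofReal ?_)
  have e : M * (pnorm t x ^ 3 / pnorm t x ^ b) / pnorm t x ^ 4 ≤ M / √t / pnorm t x ^ b := by
    rw [show M * (pnorm t x ^ 3 / pnorm t x ^ b) / pnorm t x ^ 4 =
      M / pnorm t x / pnorm t x ^ b by field_simp]
    gcongr
  calc _ ≤ C * (M / √t / pnorm t x ^ b + M / √t / pnorm t x ^ b) := by gcongr
    _ = _ := by ring

lemma measurable_heatKernel_left (t : ℝ) : Measurable (heatKernel t) :=
  measurable_heatKernel.comp (measurable_const.prodMk measurable_id)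

lemma aestronglyMeasurable_heat_integrand {f : E3 → ℝ} (hf : AEStronglyMeasurable f volume) (t : ℝ)
    (x : E3) : AEStronglyMeasurable (fun y ↦ heatKernel t (x - y) * f y) volume :=
  ((measurable_heatKernel_left t).comp (measurable_const.sub measurable_id)).aestronglyMeasurable.mul hf

lemma exists_heat_enorm_bound : ∃ C : ℝ, 0 ≤ C ∧ ∀ (f : E3 → ℝ) (t : ℝ), 0 < t → ∀ x : E3,
    (∫⁻ y, ‖heatKernel t (x - y) * f y‖ₑ ≤
      ENNReal.ofReal (C * √t) * ∫⁻ y, ENNReal.ofReal ((pnorm t (x - y) ^ 4)⁻¹) * ‖f y‖ₑ) ∧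
    ∀ h : ℝ, 0 ≤ h →
      ∫⁻ y, ‖heatKernel (t + h) (x - y) * f y - heatKernel t (x - y) * f y‖ₑ ≤
      ENNReal.ofReal (C * (h / t) * √t) * ∫⁻ y, ENNReal.ofReal ((pnorm t (x - y) ^ 4)⁻¹) * ‖f y‖ₑ := by
  obtain ⟨C, hC, H⟩ := exists_heatKernel_bound
  refine ⟨C, hC, fun f t ht x ↦ ⟨?_, fun h hh ↦ ?_⟩⟩
  · rw [← lintegral_const_mul' _ _ ENNReal.ofReal_ne_top]
    refine lintegral_mono fun y ↦ ?_
    rw [enorm_mul, ← mul_assoc, ← ENNReal.ofReal_mul (by positivity), ← ofReal_norm (heatKernel _ _)]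
    gcongr
    rw [Real.norm_of_nonneg (heatKernel_nonneg ht _), ← div_eq_mul_inv]
    exact (H t ht _).1
  · rw [← lintegral_const_mul' _ _ ENNReal.ofReal_ne_top]
    refine lintegral_mono fun y ↦ ?_
    rw [← sub_mul, enorm_mul, ← mul_assoc, ← ENNReal.ofReal_mul (by positivity),
      ← ofReal_norm (heatKernel _ _ - _)]
    gcongr
    rw [Real.norm_eq_abs, ← div_eq_mul_inv]
    exact (H t ht _).2 h hh

/-- Pointwise bounds of the heat semigroup on decaying data. -/
lemma exists_heatSemigroup_bound (b : ℕ) : ∃ A : ℝ, 0 ≤ A ∧ ∀ (M : ℝ) (f : E3 → ℝ), 0 ≤ M →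
    DecayingDatum b M f → ∀ t : ℝ, 0 < t → ∀ x : E3,
    (∫⁻ y, ‖heatKernel t (x - y) * f y‖ₑ ≤ ENNReal.ofReal (A * M / pnorm t x ^ b)) ∧
    |heatSemigroup t f x| ≤ A * M / pnorm t x ^ b ∧
    ∀ h : ℝ, 0 ≤ h →
      |heatSemigroup (t + h) f x - heatSemigroup t f x| ≤ A * M * (h / t) / pnorm t x ^ b := by
  obtain ⟨A, hA, HA⟩ := exists_heat_conv_bound b
  obtain ⟨C, hC, HC⟩ := exists_heat_enorm_bound
  have key : ∀ (M : ℝ) (f : E3 → ℝ), 0 ≤ M → DecayingDatum b M f → ∀ t : ℝ, 0 < t → ∀ x : E3,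
      ∫⁻ y, ‖heatKernel t (x - y) * f y‖ₑ ≤ ENNReal.ofReal (C * A * M / pnorm t x ^ b) :=
    fun M f hM hf t ht x ↦ by
      have hN := pnorm_pos ht x
      have hq := Real.sqrt_pos.2 ht
      refine ((HC f t ht x).1.trans (mul_le_mul_right (HA M f hM hf t ht x) _)).trans_eq ?_
      rw [← ENNReal.ofReal_mul (by positivity)]
      congr 1
      field_simp
  have hint : ∀ (M : ℝ) (f : E3 → ℝ), 0 ≤ M → DecayingDatum b M f → ∀ t : ℝ, 0 < t → ∀ x : E3,
      Integrable fun y ↦ heatKernel t (x - y) * f y := fun M f hM hf t ht x ↦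
    ⟨aestronglyMeasurable_heat_integrand hf.measurable t x,
      (key M f hM hf t ht x).trans_lt ENNReal.ofReal_lt_top⟩
  refine ⟨C * A, by positivity, fun M f hM hf t ht x ↦ ⟨key M f hM hf t ht x, ?_, fun h hh ↦ ?_⟩⟩
  · have hN := pnorm_pos ht x
    exact abs_le_of_enorm_le (by positivity)
      ((enorm_integral_le_lintegral_enorm _).trans (key M f hM hf t ht x))
  · have hN := pnorm_pos ht x
    have hq := Real.sqrt_pos.2 ht
    refine abs_le_of_enorm_le (by positivity) ?_
    rw [heatSemigroup, heatSemigroup, ← integral_sub (hint M f hM hf _ (by linarith) x)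
      (hint M f hM hf t ht x)]
    refine (enorm_integral_le_lintegral_enorm _).trans (((HC f t ht x).2 h hh).trans
      ((mul_le_mul_right (HA M f hM hf t ht x) _).trans_eq ?_))
    rw [← ENNReal.ofReal_mul (by positivity)]
    congr 1
    field_simp

/-- The factor √t in the heat kernel bound cancels the mass c/√t of the order 4 weight. The decay of
the datum only makes the integrals converge at each point, so that they can be subtracted. -/
lemma exists_heatSemigroup_L1_bound (b : ℕ) : ∃ A : ℝ, 0 ≤ A ∧ ∀ (M : ℝ) (f : E3 → ℝ), 0 ≤ M →
    DecayingDatum b M f → ∀ t : ℝ, 0 < t →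
    ∫⁻ x, ‖heatSemigroup t f x‖ₑ ≤ ENNReal.ofReal A * ∫⁻ x, ‖f x‖ₑ ∧
    ∀ h : ℝ, 0 ≤ h →
      ∫⁻ x, ‖heatSemigroup (t + h) f x - heatSemigroup t f x‖ₑ ≤
        ENNReal.ofReal (A * (h / t)) * ∫⁻ x, ‖f x‖ₑ := by
  obtain ⟨c, hc, Hc⟩ := exists_lintegral_decay
  obtain ⟨C, hC, HC⟩ := exists_heat_enorm_bound
  obtain ⟨B, _, HB⟩ := exists_heatSemigroup_bound b
  have key : ∀ (f : E3 → ℝ), AEStronglyMeasurable f volume → ∀ t : ℝ, 0 < t →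
      ∫⁻ x, ∫⁻ y, ENNReal.ofReal ((pnorm t (x - y) ^ 4)⁻¹) * ‖f y‖ₑ ≤
        ENNReal.ofReal (c / √t) * ∫⁻ x, ‖f x‖ₑ := fun f hf t ht ↦ by
    have hm : AEMeasurable (fun q : E3 × E3 ↦ ENNReal.ofReal ((pnorm t (q.1 - q.2) ^ 4)⁻¹) * ‖f q.2‖ₑ)
        (volume.prod volume) := by
      refine AEMeasurable.mul ?_ hf.enorm.comp_snd
      unfold pnorm
      fun_prop
    rw [lintegral_lintegral_swap hm]
    calc _ = ∫⁻ y, (∫⁻ z : E3, ENNReal.ofReal ((pnorm t z ^ 4)⁻¹)) * ‖f y‖ₑ := by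
          refine lintegral_congr fun y ↦ ?_
          rw [lintegral_mul_const' _ _ enorm_ne_top,
            lintegral_sub_right_eq_self (fun z ↦ ENNReal.ofReal ((pnorm t z ^ 4)⁻¹)) y]
      _ ≤ ∫⁻ y, ENNReal.ofReal (c / √t) * ‖f y‖ₑ := by
          gcongr
          exact Hc _ (Real.sqrt_pos.2 ht)
      _ = _ := lintegral_const_mul' _ _ ENNReal.ofReal_ne_top
  refine ⟨C * c, by positivity, fun M f hM hf t ht ↦ ⟨?_, fun h hh ↦ ?_⟩⟩
  · have hq := Real.sqrt_pos.2 ht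
    calc _ ≤ ∫⁻ x, ENNReal.ofReal (C * √t) *
            ∫⁻ y, ENNReal.ofReal ((pnorm t (x - y) ^ 4)⁻¹) * ‖f y‖ₑ :=
          lintegral_mono fun x ↦ (enorm_integral_le_lintegral_enorm _).trans (HC f t ht x).1
      _ ≤ ENNReal.ofReal (C * √t) * (ENNReal.ofReal (c / √t) * ∫⁻ x, ‖f x‖ₑ) := by
          rw [lintegral_const_mul' _ _ ENNReal.ofReal_ne_top]
          gcongr
          exact key f hf.measurable t ht
      _ = _ := by
          rw [← mul_assoc, ← ENNReal.ofReal_mul (by positivity)]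
          congr 2
          field_simp
  · have hq := Real.sqrt_pos.2 ht
    have hint : ∀ t : ℝ, 0 < t → ∀ x : E3, Integrable fun y ↦ heatKernel t (x - y) * f y :=
      fun t ht x ↦ ⟨aestronglyMeasurable_heat_integrand hf.measurable t x,
        (HB M f hM hf t ht x).1.trans_lt ENNReal.ofReal_lt_top⟩
    calc _ ≤ ∫⁻ x, ENNReal.ofReal (C * (h / t) * √t) *
            ∫⁻ y, ENNReal.ofReal ((pnorm t (x - y) ^ 4)⁻¹) * ‖f y‖ₑ := by
          refine lintegral_mono fun x ↦ ?_
          rw [heatSemigroup, heatSemigroup, ← integral_sub (hint _ (by linarith) x) (hint t ht x)]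
          exact (enorm_integral_le_lintegral_enorm _).trans ((HC f t ht x).2 h hh)
      _ ≤ ENNReal.ofReal (C * (h / t) * √t) * (ENNReal.ofReal (c / √t) * ∫⁻ x, ‖f x‖ₑ) := by
          rw [lintegral_const_mul' _ _ ENNReal.ofReal_ne_top]
          gcongr
          exact key f hf.measurable t ht
      _ = _ := by
          rw [← mul_assoc, ← ENNReal.ofReal_mul (by positivity)]
          congr 2
          field_simp

lemma stronglyMeasurable_heatSemigroup {f : E3 → ℝ} (hf : AEStronglyMeasurable f volume) :
    StronglyMeasurable (fun q : ℝ × E3 ↦ heatSemigroup q.1 f q.2) := by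
  have e : (fun q : ℝ × E3 ↦ heatSemigroup q.1 f q.2) = fun q ↦ ∫ y,
      heatKernel q.1 (q.2 - y) * hf.mk _ y := by
    ext q
    refine integral_congr_ae ?_
    filter_upwards [hf.ae_eq_mk] with y hy
    rw [hy]
  rw [e]
  refine StronglyMeasurable.integral_prod_right' (f := fun r : (ℝ × E3) × E3 ↦
    heatKernel r.1.1 (r.1.2 - r.2) * hf.mk _ r.2) (Measurable.stronglyMeasurable ?_)
  have h2 : Measurable (fun r : (ℝ × E3) × E3 ↦ heatKernel r.1.1 (r.1.2 - r.2)) :=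
    measurable_heatKernel.comp (g := fun p : ℝ × E3 ↦ heatKernel p.1 p.2)
      (f := fun r : (ℝ × E3) × E3 ↦ (r.1.1, r.1.2 - r.2)) (by fun_prop)
  exact h2.mul (hf.stronglyMeasurable_mk.measurable.comp measurable_snd)

/-! ### Testing against compactly supported functions -/

lemma integrable_test_prod {Y : Type*} [MeasurableSpace Y] {ν : Measure Y} [SFinite ν]
    {κ : E3 → Y → ℝ} {φ : E3 → ℝ} (hφ : Continuous φ) (hc : HasCompactSupport φ)
    (hκ : AEStronglyMeasurable (fun q : E3 × Y ↦ κ q.1 q.2) (volume.prod ν)) {B : ℝ}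
    (hB : ∀ x, ∫⁻ p, ‖κ x p‖ₑ ∂ν ≤ ENNReal.ofReal B) :
    Integrable (fun q : E3 × Y ↦ φ q.1 * κ q.1 q.2) (volume.prod ν) := by
  have hm : AEStronglyMeasurable (fun q : E3 × Y ↦ φ q.1 * κ q.1 q.2) (volume.prod ν) :=
    hφ.aestronglyMeasurable.comp_fst.mul hκ
  refine ⟨hm, ?_⟩
  rw [hasFiniteIntegral_iff_enorm, lintegral_prod _ hm.enorm]
  calc _ ≤ ∫⁻ x, ‖φ x‖ₑ * ENNReal.ofReal B := by
        refine lintegral_mono fun x ↦ ?_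
        simp only [enorm_mul]
        rw [lintegral_const_mul' _ _ enorm_ne_top]
        gcongr
        exact hB x
    _ = (∫⁻ x, ‖φ x‖ₑ) * ENNReal.ofReal B := lintegral_mul_const' _ _ ENNReal.ofReal_ne_top
    _ < ⊤ := ENNReal.mul_lt_top (hφ.integrable_of_hasCompactSupport hc).2 ENNReal.ofReal_lt_top

lemma integral_test_swap {Y : Type*} [MeasurableSpace Y] {ν : Measure Y} [SFinite ν]
    {κ : E3 → Y → ℝ} {φ : E3 → ℝ} (hφ : Continuous φ) (hc : HasCompactSupport φ)
    (hκ : AEStronglyMeasurable (fun q : E3 × Y ↦ κ q.1 q.2) (volume.prod ν)) {B : ℝ}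
    (hB : ∀ x, ∫⁻ p, ‖κ x p‖ₑ ∂ν ≤ ENNReal.ofReal B) :
    ∫ x, φ x * ∫ p, κ x p ∂ν = ∫ p, (∫ x, φ x * κ x p) ∂ν := by
  rw [← integral_integral_swap (integrable_test_prod hφ hc hκ hB)]
  refine integral_congr_ae (Eventually.of_forall fun x ↦ ?_)
  simp only
  rw [integral_const_mul]

lemma heatSemigroup_eq (t : ℝ) (f : E3 → ℝ) (x : E3) :
    heatSemigroup t f x = ∫ z, heatKernel t z * f (x - z) := by
  rw [heatSemigroup, ← integral_sub_left_eq_self _ volume x]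
  simp

/-- After a change of variables the translation falls on φ, and the semigroup becomes a Gaussian
average of pairings of f with translated test functions. Both the limit at time 0 and the divergence
condition pass through this formula. -/
lemma integral_test_heatSemigroup {b : ℕ} {M : ℝ} {f : E3 → ℝ} (hM : 0 ≤ M)
    (hf : DecayingDatum b M f) {φ : E3 → ℝ} (hφ : Continuous φ) (hc : HasCompactSupport φ) {t : ℝ}
    (ht : 0 < t) :
    ∫ x, φ x * heatSemigroup t f x = ∫ z, heatKernel t z * ∫ x, φ (x + z) * f x ∧
    Integrable (fun z ↦ heatKernel t z * ∫ x, φ (x + z) * f x) := by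
  obtain ⟨A, hA, HA⟩ := exists_heatSemigroup_bound b
  have hm : AEStronglyMeasurable (fun q : E3 × E3 ↦ heatKernel t q.2 * f (q.1 - q.2))
      (volume.prod volume) :=
    (measurable_heatKernel_left t).aestronglyMeasurable.comp_snd.mul
      (hf.measurable.comp_quasiMeasurePreserving (quasiMeasurePreserving_sub _ _))
  have hB : ∀ x, ∫⁻ z, ‖heatKernel t z * f (x - z)‖ₑ ≤ ENNReal.ofReal (A * M / √t ^ b) := fun x ↦ by
    have hq := Real.sqrt_pos.2 ht
    rw [← lintegral_sub_left_eq_self _ x]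
    simp only [sub_sub_cancel]
    refine (HA M f hM hf t ht x).1.trans (ENNReal.ofReal_le_ofReal ?_)
    gcongr
    exact sqrt_le_pnorm t x
  have e : ∀ z, ∫ x, φ x * (heatKernel t z * f (x - z)) = heatKernel t z * ∫ x, φ (x + z) * f x :=
    fun z ↦ by
      rw [← integral_add_right_eq_self _ z, ← integral_const_mul]
      refine integral_congr_ae (Eventually.of_forall fun x ↦ ?_)
      simp only [add_sub_cancel_right]
      ring
  have hI := integrable_test_prod hφ hc hm hB
  refine ⟨?_, ?_⟩
  · simp only [heatSemigroup_eq]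
    rw [integral_test_swap hφ hc hm hB]
    simp only [e]
  · exact hI.integral_prod_right.congr (Eventually.of_forall e)

lemma integral_heatKernel_one : ∫ z, heatKernel 1 z = 1 := by
  have h := GaussianFourier.integral_rexp_neg_mul_sq_norm (V := E3) (b := 1 / 4) (by norm_num)
  simp only [heatKernel]
  rw [integral_const_mul]
  have e : ∀ z : E3, Real.exp (-(‖z‖ ^ 2) / (4 * 1)) = Real.exp (-(1 / 4) * ‖z‖ ^ 2) := fun z ↦ by
    congr 1; ring
  simp only [e]
  rw [h, finrank_euclideanSpace_fin, Real.rpow_neg (by positivity),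
    show Real.pi / (1 / 4) = 4 * Real.pi * 1 by ring]
  push_cast
  exact inv_mul_cancel₀ (by positivity)

/-- A non-integrable function has integral 0 by convention, whereas this integral is 1. -/
lemma integrable_heatKernel_one : Integrable (heatKernel 1) := by
  by_contra h
  have := integral_undef h
  rw [integral_heatKernel_one] at this
  norm_num at this

lemma heatKernel_sqrt_smul {t : ℝ} (ht : 0 < t) (w : E3) :
    heatKernel t (√t • w) = (√t ^ 3)⁻¹ * heatKernel 1 w := by
  have hq := Real.sqrt_pos.2 ht
  have e : (4 * Real.pi * t) ^ (-(3 / 2) : ℝ) = (√t ^ 3)⁻¹ * (4 * Real.pi * 1) ^ (-(3 / 2) : ℝ) := by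
    rw [Real.mul_rpow (by positivity) ht.le, mul_one, mul_comm]
    congr 1
    nth_rw 1 [← Real.sq_sqrt ht.le]
    rw [← Real.rpow_natCast, ← Real.rpow_mul hq.le, ← Real.rpow_natCast, ← Real.rpow_neg hq.le]
    norm_num
  rw [heatKernel, heatKernel, e, norm_smul, Real.norm_of_nonneg hq.le, mul_pow, Real.sq_sqrt ht.le,
    mul_assoc]
  congr 3
  field_simp

lemma DecayingDatum.locallyIntegrable {b : ℕ} {M : ℝ} {f : E3 → ℝ} (hf : DecayingDatum b M f) :
    LocallyIntegrable f := by
  refine fun x ↦ ⟨Metric.ball 0 (‖x‖ + 1), Metric.isOpen_ball.mem_nhds (by simp),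
    hf.measurable.restrict, ?_⟩
  exact (hf.mass _ (by positivity)).trans_lt ENNReal.ofReal_lt_top

lemma DecayingDatum.continuous_translate {b : ℕ} {M : ℝ} {f : E3 → ℝ} (hf : DecayingDatum b M f)
    {φ : E3 → ℝ} (hφ : Continuous φ) (hc : HasCompactSupport φ) :
    Continuous (fun z ↦ ∫ x, φ (x + z) * f x) := by
  have h := HasCompactSupport.continuous_convolution_right (ContinuousLinearMap.mul ℝ ℝ) (μ := volume)
    (f := f) (g := fun v ↦ φ (-v)) (hc.comp_homeomorph (Homeomorph.neg E3)) hf.locallyIntegrable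
    (hφ.comp continuous_neg)
  have h2 := h.comp (continuous_neg (G := E3))
  convert h2 using 1
  ext z
  simp only [Function.comp_apply, MeasureTheory.convolution, ContinuousLinearMap.mul_apply']
  refine integral_congr_ae (Eventually.of_forall fun x ↦ ?_)
  simp only
  rw [mul_comm, show -(-z - x) = x + z by abel]

/-- Outside the unit ball the datum is at most M, so the L¹ norm of φ suffices; inside, φ is bounded
and the mass of the datum is used. -/
lemma DecayingDatum.translate_bounded {b : ℕ} {M : ℝ} {f : E3 → ℝ} (hM : 0 ≤ M)
    (hf : DecayingDatum b M f) {φ : E3 → ℝ} (hφ : Continuous φ) (hc : HasCompactSupport φ) :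
    ∃ K : ℝ, ∀ z, |∫ x, φ (x + z) * f x| ≤ K := by
  obtain ⟨K, hK⟩ := hc.exists_bound_of_continuous hφ
  have hK0 : 0 ≤ K := (norm_nonneg _).trans (hK 0)
  have hI : Integrable φ := hφ.integrable_of_hasCompactSupport hc
  refine ⟨K * M + M * ∫ x, ‖φ x‖, fun z ↦ ?_⟩
  have hpos : 0 ≤ ∫ x, ‖φ x‖ := integral_nonneg fun _ ↦ norm_nonneg _
  refine abs_le_of_enorm_le (by positivity) ((enorm_integral_le_lintegral_enorm _).trans ?_)
  have hmeas : Measurable fun x ↦ ENNReal.ofReal M * ‖φ (x + z)‖ₑ := by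
    have := hφ.measurable
    fun_prop
  have hpt : ∀ᵐ x, ‖φ (x + z) * f x‖ₑ ≤ ENNReal.ofReal M * ‖φ (x + z)‖ₑ + ENNReal.ofReal K *
      (Metric.ball (0 : E3) 1).indicator (fun x ↦ ‖f x‖ₑ) x := by
    filter_upwards [hf.bound] with x hx
    rw [enorm_mul]
    by_cases h1 : x ∈ Metric.ball (0 : E3) 1
    · rw [indicator_of_mem h1]
      refine le_add_left ?_
      gcongr
      rw [← ofReal_norm]
      exact ENNReal.ofReal_le_ofReal (hK _)
    · refine le_add_right ?_
      rw [mul_comm]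
      gcongr
      rw [← ofReal_norm, Real.norm_eq_abs]
      refine ENNReal.ofReal_le_ofReal (hx.trans ?_)
      rw [mem_ball_zero_iff, not_lt] at h1
      exact div_le_self hM (one_le_pow₀ h1)
  calc _ ≤ _ := lintegral_mono_ae hpt
    _ = ENNReal.ofReal M * (∫⁻ x, ‖φ x‖ₑ) +
        ENNReal.ofReal K * ∫⁻ x in Metric.ball (0 : E3) 1, ‖f x‖ₑ := by
        rw [lintegral_add_left hmeas, lintegral_const_mul' _ _ ENNReal.ofReal_ne_top,
          lintegral_const_mul' _ _ ENNReal.ofReal_ne_top,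
          lintegral_add_right_eq_self (fun x ↦ ‖φ x‖ₑ) z, lintegral_indicator measurableSet_ball]
    _ ≤ ENNReal.ofReal M * ENNReal.ofReal (∫ x, ‖φ x‖) + ENNReal.ofReal K * ENNReal.ofReal M := by
        gcongr
        · rw [ofReal_integral_norm_eq_lintegral_enorm hI]
        · have := hf.mass 1 one_pos
          simpa using this
    _ = _ := by
        rw [← ENNReal.ofReal_mul hM, ← ENNReal.ofReal_mul hK0,
          ← ENNReal.ofReal_add (by positivity) (by positivity)]
        congr 1
        ring

/-- `e^{tΔ} f → f` in the sense of distributions as `t → 0⁺`. -/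
lemma DecayingDatum.tendsto_heatSemigroup {b : ℕ} {M : ℝ} {f : E3 → ℝ} (hM : 0 ≤ M)
    (hf : DecayingDatum b M f) {φ : E3 → ℝ} (hφ : Continuous φ) (hc : HasCompactSupport φ) :
    Tendsto (fun t ↦ ∫ x, φ x * heatSemigroup t f x) (𝓝[>] 0) (𝓝 (∫ x, φ x * f x)) := by
  set H : E3 → ℝ := fun z ↦ ∫ x, φ (x + z) * f x with hH
  have hHc : Continuous H := hf.continuous_translate hφ hc
  obtain ⟨K, hK⟩ := hf.translate_bounded hM hφ hc
  have e : ∀ t : ℝ, 0 < t → ∫ x, φ x * heatSemigroup t f x = ∫ w, heatKernel 1 w * H (√t • w) := by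
    intro t ht
    have hq := Real.sqrt_pos.2 ht
    rw [(integral_test_heatSemigroup hM hf hφ hc ht).1]
    -- The substitution z = √t w fixes the Gaussian and leaves t only in the argument of H, so that
    -- dominated convergence applies.
    have h1 := Measure.integral_comp_smul_of_nonneg volume (fun z : E3 ↦ heatKernel t z * H z) (√t)
      (hR := hq.le)
    simp only [heatKernel_sqrt_smul ht, mul_assoc] at h1
    rw [integral_const_mul, finrank_euclideanSpace_fin, smul_eq_mul] at h1
    exact (mul_left_cancel₀ (by positivity) h1).symm
  have h0 : ∫ x, φ x * f x = ∫ w, heatKernel 1 w * H 0 := by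
    rw [integral_mul_const, integral_heatKernel_one, one_mul]
    simp [hH]
  rw [h0]
  refine Tendsto.congr' (f₁ := fun t ↦ ∫ w, heatKernel 1 w * H (√t • w)) ?_ ?_
  · filter_upwards [self_mem_nhdsWithin] with t ht using (e t ht).symm
  · refine tendsto_integral_filter_of_dominated_convergence (fun w ↦ heatKernel 1 w * K) ?_ ?_
      (integrable_heatKernel_one.mul_const K) ?_
    · refine Eventually.of_forall fun t ↦ ?_
      exact (measurable_heatKernel_left 1).aestronglyMeasurable.mul
        (hHc.comp (continuous_const_smul _)).aestronglyMeasurable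
    · refine Eventually.of_forall fun t ↦ Eventually.of_forall fun w ↦ ?_
      rw [norm_mul, Real.norm_of_nonneg (heatKernel_nonneg one_pos w)]
      exact mul_le_mul_of_nonneg_left (hK _) (heatKernel_nonneg one_pos w)
    · refine Eventually.of_forall fun w ↦ ?_
      have h2 : Tendsto (fun t : ℝ ↦ √t • w) (𝓝[>] 0) (𝓝 0) := by
        have : Continuous fun t : ℝ ↦ √t • w := by fun_prop
        simpa using (this.tendsto 0).mono_left nhdsWithin_le_nhds
      exact ((hHc.tendsto 0).comp h2).const_mul _

/-! ### Integration by parts against the kernels. -/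

lemma fderiv_apply_eq_sum (φ : E3 → ℝ) (x v : E3) :
    fderiv ℝ φ x v = ∑ k, partialDeriv k φ x * v k := by
  have hv : v = ∑ k, v k • EuclideanSpace.single k (1 : ℝ) := by
    ext i
    simp [Pi.single_apply]
  conv_lhs => rw [hv]
  rw [map_sum]
  refine Finset.sum_congr rfl fun k _ ↦ ?_
  rw [map_smul, smul_eq_mul, mul_comm, partialDeriv]

lemma contDiff_partialDeriv {φ : E3 → ℝ} (hφ : ContDiff ℝ ∞ φ) (k : Fin 3) :
    ContDiff ℝ ∞ (partialDeriv k φ) :=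
  (hφ.fderiv_right (m := ∞) (by norm_num)).clm_apply contDiff_const

lemma hasCompactSupport_partialDeriv {φ : E3 → ℝ} (hc : HasCompactSupport φ) (k : Fin 3) :
    HasCompactSupport (partialDeriv k φ) :=
  hc.fderiv_apply (𝕜 := ℝ) (EuclideanSpace.single k 1)

lemma partialDeriv_comm {φ : E3 → ℝ} (hφ : ContDiff ℝ ∞ φ) (k l : Fin 3) (x : E3) :
    partialDeriv k (partialDeriv l φ) x = partialDeriv l (partialDeriv k φ) x := by
  have hs : IsSymmSndFDerivAt ℝ φ x := (hφ.contDiffAt).isSymmSndFDerivAt (by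
    rw [minSmoothness_of_isRCLikeNormedField]; exact WithTop.coe_le_coe.2 le_top)
  have hd : DifferentiableAt ℝ (fderiv ℝ φ) x :=
    ((hφ.fderiv_right (m := ∞) (by norm_num)).differentiable (by norm_num)).differentiableAt
  have e : ∀ a b : Fin 3, partialDeriv a (partialDeriv b φ) x =
      fderiv ℝ (fderiv ℝ φ) x (EuclideanSpace.single a 1) (EuclideanSpace.single b 1) := fun a b ↦ by
    have : partialDeriv b φ = fun y ↦ fderiv ℝ φ y (EuclideanSpace.single b 1) := rfl
    rw [partialDeriv, this, fderiv_clm_apply hd (differentiableAt_const _)]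
    simp
  rw [e, e]
  exact hs _ _

lemma integral_mul_partialDeriv_shift {φ g : E3 → ℝ} (hφ : ContDiff ℝ ∞ φ) (hc : HasCompactSupport φ)
    (hg : Differentiable ℝ g) {l : Fin 3} (hg' : Continuous (partialDeriv l g)) (y : E3) :
    ∫ x, φ x * partialDeriv l g (x - y) = -∫ x, partialDeriv l φ x * g (x - y) := by
  have hd : ∀ x, partialDeriv l g (x - y) = fderiv ℝ (fun x ↦ g (x - y)) x (EuclideanSpace.single l 1) :=
    fun x ↦ by rw [fderiv_comp_sub]; rfl
  have hgy : Differentiable ℝ fun x ↦ g (x - y) := hg.comp (differentiable_id.sub_const y)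
  simp only [hd]
  refine integral_mul_fderiv_eq_neg_fderiv_mul_of_integrable (μ := volume) ?_ ?_ ?_
    (fun x _ ↦ hφ.differentiable (by norm_num) x) fun x _ ↦ hgy x
  · exact ((contDiff_partialDeriv hφ l).continuous.mul hgy.continuous).integrable_of_hasCompactSupport
      (hasCompactSupport_partialDeriv hc l).mul_right
  · simp only [← hd]
    exact (hφ.continuous.mul (hg'.comp (continuous_id.sub continuous_const))).integrable_of_hasCompactSupport
      hc.mul_right
  · exact (hφ.continuous.mul hgy.continuous).integrable_of_hasCompactSupport hc.mul_right

lemma continuous_heatTail (m : ℕ) {t : ℝ} (ht : 0 < t) : Continuous (heatTail m t) :=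
  continuous_iff_continuousAt.2 fun x ↦ (hasFDerivAt_heatTail m ht x).continuousAt

lemma continuous_gradLerayKernel (l k j : Fin 3) {t : ℝ} (ht : 0 < t) :
    Continuous (gradLerayKernel l k j t) := by
  have h2 := continuous_heatTail 2 ht
  have h3 := continuous_heatTail 3 ht
  unfold gradLerayKernel
  fun_prop

lemma continuous_gradHeatKernel (l : Fin 3) {t : ℝ} (ht : 0 < t) :
    Continuous (gradHeatKernel l t) := by
  have h : Continuous (heatMoment 1 t) :=
    continuous_iff_continuousAt.2 fun x ↦ (hasFDerivAt_heatMoment 1 ht x).continuousAt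
  unfold gradHeatKernel
  fun_prop

/-- Integration by parts moves the gradient of φ onto the kernel, where the divergence of a column
vanishes. -/
lemma sum_integral_partialDeriv_mul_lerayKernel {φ : E3 → ℝ} (hφ : ContDiff ℝ ∞ φ)
    (hc : HasCompactSupport φ) (j : Fin 3) {τ : ℝ} (hτ : 0 < τ) (y : E3) :
    ∑ k, ∫ x, partialDeriv k φ x * lerayKernel k j τ (x - y) = 0 := by
  have hp : ∀ k, partialDeriv k (lerayKernel k j τ) = gradLerayKernel k k j τ := fun k ↦
    funext fun x ↦ partialDeriv_lerayKernel k k j hτ x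
  have e : ∀ k, ∫ x, partialDeriv k φ x * lerayKernel k j τ (x - y) =
      -∫ x, φ x * gradLerayKernel k k j τ (x - y) := fun k ↦ by
    have := integral_mul_partialDeriv_shift hφ hc (differentiable_lerayKernel k j hτ) (l := k)
      (by rw [hp]; exact continuous_gradLerayKernel k k j hτ) y
    rw [hp] at this
    rw [this, neg_neg]
  simp only [e]
  rw [Finset.sum_neg_distrib, ← integral_finsetSum]
  · simp only [← Finset.mul_sum, sum_gradLerayKernel]
    simp
  · intro k _
    exact (hφ.continuous.mul ((continuous_gradLerayKernel k k j hτ).comp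
      (continuous_id.sub continuous_const))).integrable_of_hasCompactSupport hc.mul_right

/-- The derivative in the direction l is first moved onto φ, which reduces the claim to the previous
case for the test function ∂_l φ. -/
lemma sum_integral_partialDeriv_mul_gradLerayKernel {φ : E3 → ℝ} (hφ : ContDiff ℝ ∞ φ)
    (hc : HasCompactSupport φ) (l j : Fin 3) {τ : ℝ} (hτ : 0 < τ) (y : E3) :
    ∑ k, ∫ x, partialDeriv k φ x * gradLerayKernel l k j τ (x - y) = 0 := by
  have hp : ∀ k, partialDeriv l (lerayKernel k j τ) = gradLerayKernel l k j τ := fun k ↦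
    funext fun x ↦ partialDeriv_lerayKernel l k j hτ x
  have e : ∀ k, ∫ x, partialDeriv k φ x * gradLerayKernel l k j τ (x - y) =
      -∫ x, partialDeriv k (partialDeriv l φ) x * lerayKernel k j τ (x - y) := fun k ↦ by
    have := integral_mul_partialDeriv_shift (contDiff_partialDeriv hφ k)
      (hasCompactSupport_partialDeriv hc k) (differentiable_lerayKernel k j hτ) (l := l)
      (by rw [hp]; exact continuous_gradLerayKernel l k j hτ) y
    rw [hp] at this
    rw [this]
    simp only [partialDeriv_comm hφ l k]
  simp only [e]
  rw [Finset.sum_neg_distrib, sum_integral_partialDeriv_mul_lerayKernel (contDiff_partialDeriv hφ l)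
    (hasCompactSupport_partialDeriv hc l) j hτ, neg_zero]

/-- With the derivative on φ only the heat kernel remains, and its mass is bounded uniformly in τ;
no τ^{-1/2} is lost. -/
lemma exists_integral_mul_gradHeatKernel_le {φ : E3 → ℝ} (hφ : ContDiff ℝ ∞ φ)
    (hc : HasCompactSupport φ) (l : Fin 3) : ∃ K : ℝ, 0 ≤ K ∧ ∀ τ : ℝ, 0 < τ → ∀ y : E3,
    |∫ x, φ x * gradHeatKernel l τ (x - y)| ≤ K := by
  obtain ⟨K, hK⟩ := (hasCompactSupport_partialDeriv hc l).exists_bound_of_continuous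
    (contDiff_partialDeriv hφ l).continuous
  have hK0 : 0 ≤ K := (norm_nonneg _).trans (hK 0)
  obtain ⟨c, hc0, Hc⟩ := exists_lintegral_decay
  obtain ⟨C, hC, HC⟩ := exists_heatKernel_bound
  refine ⟨K * (C * c), by positivity, fun τ hτ y ↦ ?_⟩
  have hq := Real.sqrt_pos.2 hτ
  have hp : partialDeriv l (heatKernel τ) = gradHeatKernel l τ :=
    funext fun x ↦ partialDeriv_heatKernel l hτ x
  have h := integral_mul_partialDeriv_shift hφ hc
    (fun x ↦ (hasFDerivAt_heatKernel hτ x).differentiableAt) (l := l)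
    (by rw [hp]; exact continuous_gradHeatKernel l hτ) y
  rw [hp] at h
  rw [h, abs_neg]
  refine abs_le_of_enorm_le (by positivity) ((enorm_integral_le_lintegral_enorm _).trans ?_)
  calc _ ≤ ∫⁻ x, ENNReal.ofReal (K * (C * √τ)) * ENNReal.ofReal ((pnorm τ (x - y) ^ 4)⁻¹) := by
        refine lintegral_mono fun x ↦ ?_
        rw [← ENNReal.ofReal_mul (by positivity), ← ofReal_norm, norm_mul, mul_assoc]
        refine ENNReal.ofReal_le_ofReal (mul_le_mul (hK x) ?_ (norm_nonneg _) hK0)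
        rw [Real.norm_of_nonneg (heatKernel_nonneg hτ _), ← div_eq_mul_inv]
        exact (HC τ hτ _).1
    _ = ENNReal.ofReal (K * (C * √τ)) * ∫⁻ x : E3, ENNReal.ofReal ((pnorm τ x ^ 4)⁻¹) := by
        rw [lintegral_const_mul' _ _ ENNReal.ofReal_ne_top,
          lintegral_sub_right_eq_self (fun x ↦ ENNReal.ofReal ((pnorm τ x ^ 4)⁻¹)) y]
    _ ≤ ENNReal.ofReal (K * (C * √τ)) * ENNReal.ofReal (c / √τ) := by
        gcongr
        exact Hc _ hq
    _ = _ := by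
        rw [← ENNReal.ofReal_mul (by positivity)]
        congr 1
        field_simp

/-! ### Duhamel integrals paired with test functions. -/

section Duhamel

variable {a b m : ℕ} {k : ℝ → E3 → ℝ}

lemma integral_test_duhamel (hk : ParabolicKernel a k) (ha2 : 2 ≤ a) (ha4 : a ≤ 4) (hb2 : 2 ≤ b)
    (hb4 : b ≤ 4) (hab : a + b = m + 4) {M : ℝ} {f : ℝ → E3 → ℝ} (hM : 0 ≤ M) (hf : ForceBound b M f)
    {φ : E3 → ℝ} (hφ : Continuous φ) (hc : HasCompactSupport φ) {t : ℝ} (ht : 0 < t) :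
    ∫ x, φ x * duhamel k f t x =
      ∫ p, (∫ x, φ x * k (t - p.1) (x - p.2)) * f p.1 p.2 ∂(slab t) ∧
    Integrable (fun p : ℝ × E3 ↦ (∫ x, φ x * k (t - p.1) (x - p.2)) * f p.1 p.2) (slab t) := by
  obtain ⟨A, hA, HA⟩ := exists_duhamel_bound hk ha2 ha4 hb2 hb4 hab
  have hq := Real.sqrt_pos.2 ht
  have hm : AEStronglyMeasurable (fun q : E3 × (ℝ × E3) ↦ k (t - q.2.1) (q.1 - q.2.2) * f q.2.1 q.2.2)
      (volume.prod (slab t)) := by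
    have h1 : Measurable (fun q : E3 × (ℝ × E3) ↦ k (t - q.2.1) (q.1 - q.2.2)) :=
      hk.measurable.comp (g := fun p : ℝ × E3 ↦ k p.1 p.2)
        (f := fun q : E3 × (ℝ × E3) ↦ (t - q.2.1, q.1 - q.2.2)) (by fun_prop)
    exact h1.aestronglyMeasurable.mul (hf.measurable.mono_measure (slab_le t)).comp_snd
  have hB : ∀ x, ∫⁻ p, ‖k (t - p.1) (x - p.2) * f p.1 p.2‖ₑ ∂(slab t) ≤
      ENNReal.ofReal (A * M * √t / √t ^ m) := fun x ↦ by
    refine (HA M f hM hf t ht x).1.trans (ENNReal.ofReal_le_ofReal ?_)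
    gcongr
    exact sqrt_le_pnorm t x
  have e : ∀ p : ℝ × E3, ∫ x, φ x * (k (t - p.1) (x - p.2) * f p.1 p.2) =
      (∫ x, φ x * k (t - p.1) (x - p.2)) * f p.1 p.2 := fun p ↦ by
    rw [← integral_mul_const]
    simp only [mul_assoc]
  refine ⟨?_, ?_⟩
  · simp only [duhamel]
    rw [integral_test_swap (κ := fun (x : E3) (p : ℝ × E3) ↦ k (t - p.1) (x - p.2) * f p.1 p.2) hφ hc hm hB]
    simp only [e]
  · exact (integrable_test_prod (κ := fun (x : E3) (p : ℝ × E3) ↦ k (t - p.1) (x - p.2) * f p.1 p.2)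
      hφ hc hm hB).integral_prod_right.congr (Eventually.of_forall e)

/-- A family of Duhamel integrals whose kernels are, at each time, divergence-free in the sense of
distributions, is divergence-free in the sense of distributions. -/
lemma sum_integral_test_duhamel_eq_zero {k : Fin 3 → ℝ → E3 → ℝ} (hk : ∀ i, ParabolicKernel a (k i))
    (ha2 : 2 ≤ a) (ha4 : a ≤ 4) (hb2 : 2 ≤ b) (hb4 : b ≤ 4) (hab : a + b = m + 4)
    {M : ℝ} {f : ℝ → E3 → ℝ} (hM : 0 ≤ M) (hf : ForceBound b M f)
    {φ : Fin 3 → E3 → ℝ} (hφ : ∀ i, Continuous (φ i)) (hc : ∀ i, HasCompactSupport (φ i))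
    (h0 : ∀ τ : ℝ, 0 < τ → ∀ y : E3, ∑ i, ∫ x, φ i x * k i τ (x - y) = 0) {t : ℝ} (ht : 0 < t) :
    ∑ i, ∫ x, φ i x * duhamel (k i) f t x = 0 := by
  have h := fun i ↦ integral_test_duhamel (hk i) ha2 ha4 hb2 hb4 hab hM hf (hφ i) (hc i) ht
  simp only [fun i ↦ (h i).1]
  rw [← integral_finsetSum _ fun i _ ↦ (h i).2]
  refine integral_eq_zero_of_ae ?_
  filter_upwards [ae_slab_mem t] with p hp
  rw [← Finset.sum_mul, h0 _ (sub_pos.2 hp.2), zero_mul, Pi.zero_apply]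

lemma decayingDatum_inv_sq : ∃ M : ℝ, 0 ≤ M ∧ DecayingDatum 2 M (fun x : E3 ↦ (‖x‖ ^ 2)⁻¹) := by
  obtain ⟨c, hc, Hc⟩ := exists_lintegral_ball_inv_sq
  refine ⟨c + 1, by positivity, Measurable.aestronglyMeasurable (by fun_prop),
    Eventually.of_forall fun y ↦ ?_, fun R hR ↦ ?_⟩
  · rw [abs_of_nonneg (by positivity), ← one_div]
    gcongr
    linarith
  · have : ∀ y : E3, ‖(‖y‖ ^ 2)⁻¹‖ₑ = ENNReal.ofReal ((‖y‖ ^ 2)⁻¹) := fun y ↦ by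
      rw [← ofReal_norm, Real.norm_of_nonneg (by positivity)]
    simp only [this]
    refine (Hc R hR).trans (ENNReal.ofReal_le_ofReal ?_)
    rw [show R ^ 3 / R ^ 2 = R by field_simp]
    gcongr
    linarith

/-- Functions bounded by `C √t |x|^{-2}` tend to zero in the sense of distributions. -/
lemma tendsto_integral_test_of_le {F : ℝ → E3 → ℝ} {C : ℝ}
    (hF : ∀ t : ℝ, 0 < t → ∀ x, |F t x| ≤ C * √t / pnorm t x ^ 2)
    {φ : E3 → ℝ} (hφ : Continuous φ) (hc : HasCompactSupport φ) :
    Tendsto (fun t ↦ ∫ x, φ x * F t x) (𝓝[>] 0) (𝓝 0) := by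
  have hC : 0 ≤ C := by
    have := (abs_nonneg _).trans (hF 1 one_pos 0)
    simpa [pnorm] using this
  obtain ⟨M, hM, hD⟩ := decayingDatum_inv_sq
  have hI : Integrable (fun x ↦ ‖φ x‖ * (‖x‖ ^ 2)⁻¹) :=
    hD.locallyIntegrable.integrable_smul_left_of_hasCompactSupport (g := fun x ↦ ‖φ x‖) hφ.norm hc.norm
  set J := ∫ x, ‖φ x‖ * (‖x‖ ^ 2)⁻¹
  have hb : ∀ t : ℝ, 0 < t → ‖∫ x, φ x * F t x‖ ≤ C * √t * J := fun t ht ↦ by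
    rw [← integral_const_mul]
    refine norm_integral_le_of_norm_le (hI.const_mul _) ?_
    have h0 : ∀ᵐ x : E3, x ≠ 0 := by simp [ae_iff, measure_singleton]
    filter_upwards [h0] with x hx
    have hn := norm_pos_iff.2 hx
    rw [norm_mul]
    calc _ ≤ ‖φ x‖ * (C * √t / pnorm t x ^ 2) := by
          gcongr
          exact hF t ht x
      _ ≤ ‖φ x‖ * (C * √t / ‖x‖ ^ 2) := by
          gcongr
          exact norm_le_pnorm t x
      _ = _ := by ring
  refine squeeze_zero_norm' (a := fun t ↦ C * √t * J) ?_ ?_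
  · filter_upwards [self_mem_nhdsWithin] with t ht using hb t ht
  · have : Continuous fun t : ℝ ↦ C * √t * J := by fun_prop
    simpa using (this.tendsto 0).mono_left nhdsWithin_le_nhds

/-- The pointwise bound √t (√t + |x|)^{-4} is not enough, since |x|^{-4} is not locally integrable.
Instead the tested kernel is bounded uniformly and the force has mass c/√s, which gives O(√t). -/
lemma tendsto_integral_test_duhamel_gradHeatKernel {M : ℝ} {f : ℝ → E3 → ℝ} (hM : 0 ≤ M)
    (hf : ForceBound 4 M f) (l : Fin 3) {φ : E3 → ℝ} (hφ : ContDiff ℝ ∞ φ)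
    (hc : HasCompactSupport φ) :
    Tendsto (fun t ↦ ∫ x, φ x * duhamel (gradHeatKernel l) f t x) (𝓝[>] 0) (𝓝 0) := by
  obtain ⟨K, hK, HK⟩ := exists_integral_mul_gradHeatKernel_le hφ hc l
  obtain ⟨c, hc0, Hc⟩ := exists_lintegral_decay
  have hb : ∀ t : ℝ, 0 < t → ‖∫ x, φ x * duhamel (gradHeatKernel l) f t x‖ ≤
      K * M * c * (2 * √t) := fun t ht ↦ by
    rw [(integral_test_duhamel (parabolicKernel_gradHeat l) (by norm_num) le_rfl (by norm_num) le_rfl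
      (m := 4) rfl hM hf hφ.continuous hc ht).1]
    refine abs_le_of_enorm_le (by positivity) ((enorm_integral_le_lintegral_enorm _).trans ?_)
    have hmeas : Measurable fun p : ℝ × E3 ↦ ENNReal.ofReal ((pnorm p.1 p.2 ^ 4)⁻¹) := by
      have := measurable_pnorm
      fun_prop
    calc _ ≤ ∫⁻ p, ENNReal.ofReal (K * M) * ENNReal.ofReal ((pnorm p.1 p.2 ^ 4)⁻¹) ∂(slab t) := by
          refine lintegral_mono_ae ?_
          filter_upwards [ae_mono (slab_le t) hf.bound, ae_slab_mem t] with p hp hpt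
          have h1 := pnorm_pos hpt.1 p.2
          rw [← ENNReal.ofReal_mul (by positivity), ← ofReal_norm, norm_mul, mul_assoc,
            ← div_eq_mul_inv]
          exact ENNReal.ofReal_le_ofReal (mul_le_mul (HK _ (sub_pos.2 hpt.2) _) hp (norm_nonneg _) hK)
      _ = ENNReal.ofReal (K * M) * ∫⁻ s in Ioo 0 t, ∫⁻ y : E3, ENNReal.ofReal ((pnorm s y ^ 4)⁻¹) := by
          rw [lintegral_const_mul' _ _ ENNReal.ofReal_ne_top, lintegral_slab hmeas]
      _ ≤ ENNReal.ofReal (K * M) * ∫⁻ s in Ioo 0 t,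
            ENNReal.ofReal c * ENNReal.ofReal (s ^ (-(1 / 2) : ℝ)) := by
          gcongr 1
          refine setLIntegral_mono' measurableSet_Ioo fun s hs ↦ ?_
          rw [← ENNReal.ofReal_mul hc0, ← inv_sqrt_eq_rpow hs.1.le, ← div_eq_mul_inv]
          exact Hc _ (Real.sqrt_pos.2 hs.1)
      _ = _ := by
          rw [lintegral_const_mul' _ _ ENNReal.ofReal_ne_top, lintegral_Ioo_rpow (by norm_num) ht.le,
            ← ENNReal.ofReal_mul hc0, ← ENNReal.ofReal_mul (by positivity), Real.sqrt_eq_rpow]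
          congr 1
          norm_num
          ring
  refine squeeze_zero_norm' (a := fun t ↦ K * M * c * (2 * √t)) ?_ ?_
  · filter_upwards [self_mem_nhdsWithin] with t ht using hb t ht
  · have : Continuous fun t : ℝ ↦ K * M * c * (2 * √t) := by fun_prop
    simpa using (this.tendsto 0).mono_left nhdsWithin_le_nhds

end Duhamel

/-! ### The integral operators -/

lemma ForceBound.congr_bound {F : Type*} [NormedAddCommGroup F] {b : ℕ} {M M' : ℝ} {f : ℝ → E3 → F}
    (hf : ForceBound b M f) (h : M ≤ M') : ForceBound b M' f where
  measurable := hf.measurable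
  bound := by
    filter_upwards [hf.bound] with p hp
    refine hp.trans ?_
    have := pnorm_nonneg p.1 p.2
    gcongr

lemma ae_halfSpaceTime_pos : ∀ᵐ p ∂halfSpaceTime, 0 < p.1 := by
  filter_upwards [ae_restrict_mem (measurableSet_Ioi.prod MeasurableSet.univ)] with p hp
  exact hp.1

lemma ForceBound.mul {b₁ b₂ : ℕ} {M₁ M₂ : ℝ} {f g : ℝ → E3 → ℝ} (hf : ForceBound b₁ M₁ f)
    (hg : ForceBound b₂ M₂ g) : ForceBound (b₁ + b₂) (M₁ * M₂) (fun s y ↦ f s y * g s y) where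
  measurable := hf.measurable.mul hg.measurable
  bound := by
    filter_upwards [hf.bound, hg.bound] with p h1 h2
    rw [norm_mul, pow_add, mul_div_mul_comm]
    exact mul_le_mul h1 h2 (norm_nonneg _) ((norm_nonneg _).trans h1)

lemma ForceBound.add {b : ℕ} {M₁ M₂ : ℝ} {f g : ℝ → E3 → ℝ} (hf : ForceBound b M₁ f)
    (hg : ForceBound b M₂ g) : ForceBound b (M₁ + M₂) (fun s y ↦ f s y + g s y) where
  measurable := hf.measurable.add hg.measurable
  bound := by
    filter_upwards [hf.bound, hg.bound] with p h1 h2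
    rw [add_div]
    exact (norm_add_le _ _).trans (add_le_add h1 h2)

lemma ForceBound.sub {F : Type*} [NormedAddCommGroup F] {b : ℕ} {M₁ M₂ : ℝ} {f g : ℝ → E3 → F}
    (hf : ForceBound b M₁ f) (hg : ForceBound b M₂ g) :
    ForceBound b (M₁ + M₂) (fun s y ↦ f s y - g s y) where
  measurable := hf.measurable.sub hg.measurable
  bound := by
    filter_upwards [hf.bound, hg.bound] with p h1 h2
    rw [add_div]
    exact (norm_sub_le _ _).trans (add_le_add h1 h2)

lemma ForceBound.coord {b : ℕ} {M : ℝ} {u : ℝ → E3 → E3} (hu : ForceBound b M u) (l : Fin 3) :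
    ForceBound b M (fun s y ↦ u s y l) where
  measurable := (EuclideanSpace.proj l : E3 →L[ℝ] ℝ).continuous.comp_aestronglyMeasurable hu.measurable
  bound := by
    filter_upwards [hu.bound] with p hp
    exact (abs_coord_le_norm _ l).trans hp

lemma norm_le_of_forall_abs_le {v : E3} {c : ℝ} (h : ∀ k, |v k| ≤ c) : ‖v‖ ≤ 3 * c := by
  have hc : 0 ≤ c := (abs_nonneg _).trans (h 0)
  rw [← abs_of_nonneg (norm_nonneg v), ← abs_of_nonneg (show 0 ≤ 3 * c by positivity), ← sq_le_sq,
    norm_sq_eq_sum]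
  have h2 : ∀ k, v k * v k ≤ c * c := fun k ↦ by
    rw [← abs_mul_abs_self (v k)]
    exact mul_self_le_mul_self (abs_nonneg _) (h k)
  nlinarith [h2 0, h2 1, h2 2]

/-- `∑_{j,l} ∫₀ᵗ e^{(t-s)Δ} ℙ_{kj} ∂_l f_{lj}(s) ds`. -/
def lerayDiv (f : Fin 3 → Fin 3 → ℝ → E3 → ℝ) (k : Fin 3) (t : ℝ) (x : E3) : ℝ :=
  ∑ j, ∑ l, duhamel (gradLerayKernel l k j) (f l j) t x

/-- `∑_l ∫₀ᵗ e^{(t-s)Δ} ∂_l f_l(s) ds`. -/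
def heatDiv (f : Fin 3 → ℝ → E3 → ℝ) (t : ℝ) (x : E3) : ℝ :=
  ∑ l, duhamel (gradHeatKernel l) (f l) t x

lemma abs_sum_le_of_forall {ι : Type*} [Fintype ι] {F A : ι → ℝ} {c : ℝ}
    (h : ∀ i, |F i| ≤ A i * c) : |∑ i, F i| ≤ (∑ i, A i) * c := by
  rw [Finset.sum_mul]
  exact (Finset.abs_sum_le_sum_abs _ _).trans (Finset.sum_le_sum fun i _ ↦ h i)

lemma exists_lerayDiv_bound : ∃ A : ℝ, 0 ≤ A ∧ ∀ (M : ℝ) (f : Fin 3 → Fin 3 → ℝ → E3 → ℝ), 0 ≤ M →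
    (∀ l j, ForceBound 2 M (f l j)) → ∀ (k : Fin 3) (t : ℝ), 0 < t → ∀ x : E3,
      |lerayDiv f k t x| ≤ A * M * √t / pnorm t x ^ 2 ∧
      ∀ h : ℝ, 0 ≤ h → |lerayDiv f k (t + h) x - lerayDiv f k t x| ≤
        A * M * timeModulus t h / pnorm t x ^ 2 := by
  choose A hA HA using fun l k j ↦ exists_duhamel_bound (m := 2) (b := 2)
    (parabolicKernel_gradLeray l k j) (by norm_num) le_rfl le_rfl (by norm_num) rfl
  have hle : ∀ k, ∑ j, ∑ l, A l k j ≤ ∑ k, ∑ j, ∑ l, A l k j := fun k ↦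
    Finset.single_le_sum (f := fun k ↦ ∑ j, ∑ l, A l k j)
      (fun k _ ↦ Finset.sum_nonneg fun j _ ↦ Finset.sum_nonneg fun l _ ↦ hA l k j) (Finset.mem_univ k)
  have h0 : 0 ≤ ∑ k, ∑ j, ∑ l, A l k j :=
    Finset.sum_nonneg fun k _ ↦ Finset.sum_nonneg fun j _ ↦ Finset.sum_nonneg fun l _ ↦ hA l k j
  refine ⟨∑ k, ∑ j, ∑ l, A l k j, h0, fun M f hM hf k t ht x ↦ ⟨?_, fun h hh ↦ ?_⟩⟩
  · have hN := pnorm_pos ht x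
    have h1 : |lerayDiv f k t x| ≤ (∑ j, ∑ l, A l k j) * (M * √t / pnorm t x ^ 2) :=
      abs_sum_le_of_forall fun j ↦ abs_sum_le_of_forall fun l ↦
        ((HA l k j M _ hM (hf l j) t ht x).2.2.1).trans_eq (by ring)
    refine h1.trans ?_
    exact (mul_le_mul_of_nonneg_right (hle k) (by positivity)).trans_eq (by ring)
  · have hN := pnorm_pos ht x
    have hmod := timeModulus_nonneg ht.le hh
    have h1 : |lerayDiv f k (t + h) x - lerayDiv f k t x| ≤
        (∑ j, ∑ l, A l k j) * (M * timeModulus t h / pnorm t x ^ 2) := by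
      simp only [lerayDiv, ← Finset.sum_sub_distrib]
      exact abs_sum_le_of_forall fun j ↦ abs_sum_le_of_forall fun l ↦
        ((HA l k j M _ hM (hf l j) t ht x).2.2.2 h hh).trans_eq (by ring)
    refine h1.trans ?_
    exact (mul_le_mul_of_nonneg_right (hle k) (by positivity)).trans_eq (by ring)

lemma exists_heatDiv_bound : ∃ A : ℝ, 0 ≤ A ∧ ∀ (M : ℝ) (f : Fin 3 → ℝ → E3 → ℝ), 0 ≤ M →
    (∀ l, ForceBound 4 M (f l)) → ∀ (t : ℝ), 0 < t →
      (∀ x : E3, |heatDiv f t x| ≤ A * M * √t / pnorm t x ^ 4 ∧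
        ∀ h : ℝ, 0 ≤ h → |heatDiv f (t + h) x - heatDiv f t x| ≤
          A * M * timeModulus t h / pnorm t x ^ 4) ∧
      ∫⁻ x, ‖heatDiv f t x‖ₑ ≤ ENNReal.ofReal (A * M) ∧
      ∀ h : ℝ, 0 ≤ h → ∫⁻ x, ‖heatDiv f (t + h) x - heatDiv f t x‖ₑ ≤
        ENNReal.ofReal (A * M * timeModulus t h / √t) := by
  choose A hA HA using fun l ↦ exists_duhamel_bound (m := 4) (b := 4)
    (parabolicKernel_gradHeat l) (by norm_num) le_rfl (by norm_num) le_rfl rfl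
  choose B hB HB using fun l ↦ exists_duhamel_L1_bound (parabolicKernel_gradHeat l)
  have h0 : 0 ≤ ∑ l, A l := Finset.sum_nonneg fun l _ ↦ hA l
  have h0' : 0 ≤ ∑ l, B l := Finset.sum_nonneg fun l _ ↦ hB l
  have hmeas : ∀ (M : ℝ) (f : Fin 3 → ℝ → E3 → ℝ), (∀ l, ForceBound 4 M (f l)) → ∀ t l,
      Measurable fun x ↦ duhamel (gradHeatKernel l) (f l) t x := fun M f hf t l ↦
    (stronglyMeasurable_duhamel (parabolicKernel_gradHeat l).measurable
      (hf l).measurable).measurable.comp (measurable_const.prodMk measurable_id)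
  refine ⟨(∑ l, A l) + ∑ l, B l, by positivity, fun M f hM hf t ht ↦
    ⟨fun x ↦ ⟨?_, fun h hh ↦ ?_⟩, ?_, fun h hh ↦ ?_⟩⟩
  · have hN := pnorm_pos ht x
    have h1 : |heatDiv f t x| ≤ (∑ l, A l) * (M * √t / pnorm t x ^ 4) :=
      abs_sum_le_of_forall fun l ↦ ((HA l M _ hM (hf l) t ht x).2.2.1).trans_eq (by ring)
    refine h1.trans ?_
    exact (mul_le_mul_of_nonneg_right (le_add_of_nonneg_right h0') (by positivity)).trans_eq
      (by ring)
  · have hN := pnorm_pos ht x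
    have hmod := timeModulus_nonneg ht.le hh
    have h1 : |heatDiv f (t + h) x - heatDiv f t x| ≤
        (∑ l, A l) * (M * timeModulus t h / pnorm t x ^ 4) := by
      simp only [heatDiv, ← Finset.sum_sub_distrib]
      exact abs_sum_le_of_forall fun l ↦ ((HA l M _ hM (hf l) t ht x).2.2.2 h hh).trans_eq (by ring)
    refine h1.trans ?_
    exact (mul_le_mul_of_nonneg_right (le_add_of_nonneg_right h0') (by positivity)).trans_eq
      (by ring)
  · calc _ ≤ ∫⁻ x, ∑ l, ‖duhamel (gradHeatKernel l) (f l) t x‖ₑ :=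
          lintegral_mono fun x ↦ enorm_sum_le _ _
      _ = ∑ l, ∫⁻ x, ‖duhamel (gradHeatKernel l) (f l) t x‖ₑ :=
          lintegral_finsetSum _ fun l _ ↦ (hmeas M f hf t l).enorm
      _ ≤ ∑ l, ENNReal.ofReal (B l * M) := Finset.sum_le_sum fun l _ ↦ (HB l M _ hM (hf l) t ht).1
      _ ≤ _ := by
          rw [← ENNReal.ofReal_sum_of_nonneg fun l _ ↦ mul_nonneg (hB l) hM, ← Finset.sum_mul]
          refine ENNReal.ofReal_le_ofReal ?_
          gcongr
          linarith
  · have hmod := timeModulus_nonneg ht.le hh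
    calc _ ≤ ∫⁻ x, ∑ l, ‖duhamel (gradHeatKernel l) (f l) (t + h) x -
            duhamel (gradHeatKernel l) (f l) t x‖ₑ := by
          refine lintegral_mono fun x ↦ ?_
          simp only [heatDiv, ← Finset.sum_sub_distrib]
          exact enorm_sum_le _ _
      _ = ∑ l, ∫⁻ x, ‖duhamel (gradHeatKernel l) (f l) (t + h) x -
            duhamel (gradHeatKernel l) (f l) t x‖ₑ :=
          lintegral_finsetSum _ fun l _ ↦ ((hmeas M f hf _ l).sub (hmeas M f hf t l)).enorm
      _ ≤ ∑ l, ENNReal.ofReal (B l * (M * timeModulus t h / √t)) := by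
          refine Finset.sum_le_sum fun l _ ↦ ((HB l M _ hM (hf l) t ht).2 h hh).trans_eq ?_
          congr 1
          ring
      _ ≤ _ := by
          rw [← ENNReal.ofReal_sum_of_nonneg fun l _ ↦ mul_nonneg (hB l) (by positivity),
            ← Finset.sum_mul]
          exact ENNReal.ofReal_le_ofReal ((mul_le_mul_of_nonneg_right (le_add_of_nonneg_left h0)
            (by positivity)).trans_eq (by ring))

lemma duhamel_sub {a b m : ℕ} {k : ℝ → E3 → ℝ} (hk : ParabolicKernel a k) (ha2 : 2 ≤ a) (ha4 : a ≤ 4)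
    (hb2 : 2 ≤ b) (hb4 : b ≤ 4) (hab : a + b = m + 4) {M M' : ℝ} {f g : ℝ → E3 → ℝ} (hM : 0 ≤ M)
    (hM' : 0 ≤ M') (hf : ForceBound b M f) (hg : ForceBound b M' g) {t : ℝ} (ht : 0 < t) (x : E3) :
    duhamel k f t x - duhamel k g t x = duhamel k (fun s y ↦ f s y - g s y) t x := by
  obtain ⟨A, hA, HA⟩ := exists_duhamel_bound hk ha2 ha4 hb2 hb4 hab
  simp only [duhamel, mul_sub]
  rw [integral_sub (HA M f hM hf t ht x).2.1 (HA M' g hM' hg t ht x).2.1]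

/-! ### The mild formulation -/

/-- The right-hand side of the integral equation for the velocity. -/
def mildU (u₀ : E3 → E3) (u : ℝ → E3 → E3) (θ : ℝ → E3 → ℝ) (t : ℝ) (x : E3) : E3 :=
  WithLp.toLp 2 fun k ↦ heatSemigroup t (fun y ↦ u₀ y k) x -
    lerayDiv (fun l j s y ↦ u s y l * u s y j) k t x + duhamel (lerayKernel k 2) θ t x

/-- The right-hand side of the integral equation for the temperature. -/
def mildTheta (θ₀ : E3 → ℝ) (u : ℝ → E3 → E3) (θ : ℝ → E3 → ℝ) (t : ℝ) (x : E3) : ℝ :=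
  heatSemigroup t θ₀ x - heatDiv (fun l s y ↦ θ s y * u s y l) t x

lemma convectionTheta_eq {u : ℝ → E3 → E3} {θ : ℝ → E3 → ℝ} {M : ℝ} (hM : 0 ≤ M)
    (hu : ForceBound 1 M u) (hθ : ForceBound 3 M θ) {t : ℝ} (ht : 0 < t) (x : E3) :
    convectionTheta u θ t x = heatDiv (fun l s y ↦ θ s y * u s y l) t x := by
  simp only [heatDiv, duhamel]
  rw [← integral_finsetSum]
  · refine integral_congr_ae ?_
    filter_upwards [ae_slab_mem t] with p hp
    simp only [partialDeriv_heatKernel _ (sub_pos.2 hp.2)]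
  · intro l _
    obtain ⟨A, hA, HA⟩ := exists_duhamel_bound (m := 4) (b := 4) (parabolicKernel_gradHeat l)
      (by norm_num) le_rfl (by norm_num) le_rfl rfl
    exact (HA (M * M) _ (by positivity) (hθ.mul (hu.coord l)) t ht x).2.1

lemma convectionU_eq {u : ℝ → E3 → E3} {M : ℝ} (hM : 0 ≤ M)
    (hu : ForceBound 1 M u) {t : ℝ} (ht : 0 < t) (x : E3) (k : Fin 3) :
    convectionU u t x k = lerayDiv (fun l j s y ↦ u s y l * u s y j) k t x := by
  have hI : ∀ j l, Integrable (fun p : ℝ × E3 ↦ gradLerayKernel l k j (t - p.1) (x - p.2) *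
      (u p.1 p.2 l * u p.1 p.2 j)) (slab t) := fun j l ↦ by
    obtain ⟨A, hA, HA⟩ := exists_duhamel_bound (m := 2) (b := 2) (parabolicKernel_gradLeray l k j)
      (by norm_num) le_rfl le_rfl (by norm_num) rfl
    exact (HA (M * M) _ (by positivity) ((hu.coord l).mul (hu.coord j)) t ht x).2.1
  simp only [lerayDiv, duhamel]
  simp only [← integral_finsetSum _ fun l _ ↦ hI _ l]
  rw [← integral_finsetSum _ fun j _ ↦ integrable_finsetSum _ fun l _ ↦ hI j l]
  refine integral_congr_ae ?_
  filter_upwards [ae_slab_mem t] with p hp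
  simp only [partialDeriv_heatLerayKernel _ _ _ (sub_pos.2 hp.2)]

lemma buoyancy_eq (θ : ℝ → E3 → ℝ) (t : ℝ) (x : E3) (k : Fin 3) :
    buoyancy θ t x k = duhamel (lerayKernel k 2) θ t x := by
  refine integral_congr_ae ?_
  filter_upwards [ae_slab_mem t] with p hp
  simp only [heatLerayKernel_eq _ _ (sub_pos.2 hp.2)]

lemma exists_buoyancy_bound : ∃ A : ℝ, 0 ≤ A ∧ ∀ (M : ℝ) (f : ℝ → E3 → ℝ), 0 ≤ M →
    ForceBound 3 M f → ∀ (k : Fin 3) (t : ℝ), 0 < t → ∀ x : E3,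
      |duhamel (lerayKernel k 2) f t x| ≤ A * M * √t / pnorm t x ^ 2 ∧
      ∀ h : ℝ, 0 ≤ h → |duhamel (lerayKernel k 2) f (t + h) x - duhamel (lerayKernel k 2) f t x| ≤
        A * M * timeModulus t h / pnorm t x ^ 2 := by
  choose A hA HA using fun k ↦ exists_duhamel_bound (m := 2) (b := 3)
    (parabolicKernel_leray k 2) (by norm_num) (by norm_num) (by norm_num) (by norm_num) rfl
  have hle : ∀ k, A k ≤ ∑ k, A k := fun k ↦
    Finset.single_le_sum (fun k _ ↦ hA k) (Finset.mem_univ k)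
  refine ⟨∑ k, A k, Finset.sum_nonneg fun k _ ↦ hA k, fun M f hM hf k t ht x ↦ ⟨?_, fun h hh ↦ ?_⟩⟩
  · have hN := pnorm_pos ht x
    refine (HA k M f hM hf t ht x).2.2.1.trans ?_
    gcongr
    exact hle k
  · have hN := pnorm_pos ht x
    have hmod := timeModulus_nonneg ht.le hh
    refine ((HA k M f hM hf t ht x).2.2.2 h hh).trans ?_
    gcongr
    exact hle k

/-- The map defined by the right-hand sides of the integral equations is a contraction on small
balls. -/
theorem exists_contraction : ∃ lam : ℝ, 1 ≤ lam ∧ ∃ M₀ : ℝ, 0 < M₀ ∧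
    ∀ (M : ℝ), 0 ≤ M → M ≤ M₀ → ∀ (u u' : ℝ → E3 → E3) (θ θ' : ℝ → E3 → ℝ), ForceBound 1 M u →
      ForceBound 1 M u' → ForceBound 3 M θ → ForceBound 3 M θ' → ∀ ρ : ℝ, 0 ≤ ρ →
      ForceBound 1 ρ (fun s y ↦ u s y - u' s y) →
      ForceBound 3 (ρ / lam) (fun s y ↦ θ s y - θ' s y) →
      ∀ (u₀ : E3 → E3) (θ₀ : E3 → ℝ) (t : ℝ), 0 < t → ∀ x : E3,
      ‖mildU u₀ u θ t x - mildU u₀ u' θ' t x‖ ≤ ρ / 2 / pnorm t x ^ 1 ∧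
      ‖mildTheta θ₀ u θ t x - mildTheta θ₀ u' θ' t x‖ ≤ ρ / 2 / lam / pnorm t x ^ 3 := by
  obtain ⟨A₁, hA₁, H₁⟩ := exists_lerayDiv_bound
  obtain ⟨A₂, hA₂, H₂⟩ := exists_buoyancy_bound
  obtain ⟨A₃, hA₃, H₃⟩ := exists_heatDiv_bound
  -- The norm of a vector is bounded by three times its largest coordinate. This weight makes 3 A₂
  -- ρ/lam at most ρ/4, half of the allowed ρ/2.
  set lam : ℝ := 12 * A₂ + 1 with hlam
  have hlam1 : 1 ≤ lam := by linarith
  -- For M ≤ 1/D, the term 24 A₁ bounds the quadratic part 6 A₁ M ρ of the velocity by ρ/4, and 4 A₃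
  -- lam bounds the temperature part 2 A₃ M ρ by ρ/(2 lam).
  set D : ℝ := 24 * A₁ + 4 * A₃ * lam + 1 with hD
  have hD1 : 0 < D := by positivity
  refine ⟨lam, hlam1, 1 / D, by positivity, ?_⟩
  intro M hM hMM u u' θ θ' hu hu' hθ hθ' ρ hρ hdu hdθ u₀ θ₀ t ht x
  have hN := pnorm_pos ht x
  have hq := Real.sqrt_nonneg t
  have hqN := sqrt_le_pnorm t x
  have hlam0 : 0 < lam := by linarith
  have hDM : D * M ≤ 1 := by rwa [le_div_iff₀' hD1] at hMM
  have hρl : ρ / lam ≤ ρ := div_le_self hρ hlam1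
  have hρl0 : 0 ≤ ρ / lam := by positivity
  have hA₁M : A₁ * M ≤ 1 / 24 := by
    have : 24 * (A₁ * M) ≤ D * M := by
      rw [hD]; nlinarith [mul_nonneg (mul_nonneg hA₃ hlam0.le) hM]
    linarith
  have hA₃M : A₃ * lam * M ≤ 1 / 4 := by
    have : 4 * (A₃ * lam * M) ≤ D * M := by
      rw [hD]; nlinarith [mul_nonneg hA₁ hM]
    linarith
  constructor
  · have hdf : ∀ l j, ForceBound 2 (2 * M * ρ)
        (fun s y ↦ u s y l * u s y j - u' s y l * u' s y j) := fun l j ↦ by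
      -- The difference of products is expanded as u_l (u_j - u'_j) + (u_l - u'_l) u'_j.
      have h := ((hu.coord l).mul (hdu.coord j)).add ((hdu.coord l).mul (hu'.coord j))
      have e : M * ρ + ρ * M = 2 * M * ρ := by ring
      rw [e] at h
      convert h using 3 with s y
      simp only [PiLp.sub_apply]
      ring
    have hk : ∀ k, |(mildU u₀ u θ t x - mildU u₀ u' θ' t x) k| ≤
        (A₁ * (2 * M * ρ) + A₂ * (ρ / lam)) / pnorm t x := fun k ↦ by
      have e1 : lerayDiv (fun l j s y ↦ u s y l * u s y j) k t x -
          lerayDiv (fun l j s y ↦ u' s y l * u' s y j) k t x =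
          lerayDiv (fun l j s y ↦ u s y l * u s y j - u' s y l * u' s y j) k t x := by
        simp only [lerayDiv, ← Finset.sum_sub_distrib]
        refine Finset.sum_congr rfl fun j _ ↦ Finset.sum_congr rfl fun l _ ↦ ?_
        exact duhamel_sub (m := 2) (b := 2) (parabolicKernel_gradLeray l k j) (by norm_num) le_rfl
          le_rfl (by norm_num) rfl (by positivity) (by positivity) ((hu.coord l).mul (hu.coord j))
          ((hu'.coord l).mul (hu'.coord j)) ht x
      have e2 := duhamel_sub (m := 2) (b := 3) (parabolicKernel_leray k 2) (by norm_num) (by norm_num)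
        (by norm_num) (by norm_num) rfl hM hM hθ hθ' ht x
      have e : (mildU u₀ u θ t x - mildU u₀ u' θ' t x) k =
          duhamel (lerayKernel k 2) (fun s y ↦ θ s y - θ' s y) t x -
          lerayDiv (fun l j s y ↦ u s y l * u s y j - u' s y l * u' s y j) k t x := by
        rw [← e1, ← e2]
        simp only [mildU, PiLp.sub_apply]
        ring
      rw [e]
      have b1 := (H₁ (2 * M * ρ) _ (by positivity) hdf k t ht x).1
      have b2 := (H₂ (ρ / lam) _ hρl0 hdθ k t ht x).1
      -- The √t gained by integrating in time is spent on one order of decay, which returns exactly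
      -- to the weight of the velocity.
      have b3 : √t / pnorm t x ^ 2 ≤ 1 / pnorm t x := by
        rw [div_le_div_iff₀ (by positivity) hN, one_mul, sq]
        gcongr
      calc _ ≤ A₂ * (ρ / lam) * √t / pnorm t x ^ 2 + A₁ * (2 * M * ρ) * √t / pnorm t x ^ 2 :=
            (abs_sub _ _).trans (add_le_add b2 b1)
        _ = (A₁ * (2 * M * ρ) + A₂ * (ρ / lam)) * (√t / pnorm t x ^ 2) := by ring
        _ ≤ (A₁ * (2 * M * ρ) + A₂ * (ρ / lam)) * (1 / pnorm t x) := by gcongr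
        _ = _ := by ring
    refine (norm_le_of_forall_abs_le hk).trans ?_
    rw [pow_one, ← mul_div_assoc]
    gcongr
    have e1 : A₂ * (ρ / lam) ≤ ρ / 12 := by
      rw [mul_div_assoc', div_le_div_iff₀ hlam0 (by norm_num), hlam]
      nlinarith
    nlinarith
  · have hdf : ∀ l, ForceBound 4 (2 * M * ρ)
        (fun s y ↦ θ s y * u s y l - θ' s y * u' s y l) := fun l ↦ by
      have h := (hθ.mul (hdu.coord l)).add (hdθ.mul (hu'.coord l))
      have e : M * ρ + ρ / lam * M ≤ 2 * M * ρ := by nlinarith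
      have h' := h.congr_bound e
      convert h' using 3 with s y
      simp only [PiLp.sub_apply]
      ring
    have e1 : heatDiv (fun l s y ↦ θ s y * u s y l) t x - heatDiv (fun l s y ↦ θ' s y * u' s y l) t x =
        heatDiv (fun l s y ↦ θ s y * u s y l - θ' s y * u' s y l) t x := by
      simp only [heatDiv, ← Finset.sum_sub_distrib]
      refine Finset.sum_congr rfl fun l _ ↦ ?_
      exact duhamel_sub (m := 4) (b := 4) (parabolicKernel_gradHeat l) (by norm_num) le_rfl
        (by norm_num) le_rfl rfl (by positivity) (by positivity) (hθ.mul (hu.coord l))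
        (hθ'.mul (hu'.coord l)) ht x
    have e : mildTheta θ₀ u θ t x - mildTheta θ₀ u' θ' t x =
        -heatDiv (fun l s y ↦ θ s y * u s y l - θ' s y * u' s y l) t x := by
      rw [← e1, mildTheta, mildTheta]
      ring
    rw [e, norm_neg]
    have b1 := ((H₃ (2 * M * ρ) _ (by positivity) hdf t ht).1 x).1
    have b3 : √t / pnorm t x ^ 4 ≤ 1 / pnorm t x ^ 3 := by
      rw [div_le_div_iff₀ (by positivity) (by positivity), one_mul, pow_succ' _ 3]
      gcongr
    calc _ ≤ A₃ * (2 * M * ρ) * (√t / pnorm t x ^ 4) := by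
          rw [← mul_div_assoc]
          exact b1
      _ ≤ A₃ * (2 * M * ρ) * (1 / pnorm t x ^ 3) := by gcongr
      _ = A₃ * (2 * M * ρ) / pnorm t x ^ 3 := by ring
      _ ≤ _ := by
          gcongr
          rw [le_div_iff₀ hlam0]
          nlinarith

/-! ### The fixed point -/

/-- `|f(x, t)| ≤ M (√t + |x|)^{-b}` for all `x` and all `t > 0`. -/
def DecayBound {F : Type*} [NormedAddCommGroup F] (b : ℕ) (M : ℝ) (f : ℝ → E3 → F) : Prop :=
  ∀ t : ℝ, 0 < t → ∀ x, ‖f t x‖ ≤ M / pnorm t x ^ b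

lemma DecayBound.forceBound {F : Type*} [NormedAddCommGroup F] {b : ℕ} {M : ℝ} {f : ℝ → E3 → F}
    (h : DecayBound b M f)
    (hm : AEStronglyMeasurable (fun p : ℝ × E3 ↦ f p.1 p.2) halfSpaceTime) : ForceBound b M f where
  measurable := hm
  bound := by
    filter_upwards [ae_halfSpaceTime_pos] with p hp
    exact h p.1 hp p.2

lemma DecayBound.mono {F : Type*} [NormedAddCommGroup F] {b : ℕ} {M M' : ℝ} {f : ℝ → E3 → F}
    (h : DecayBound b M f) (hM : M ≤ M') : DecayBound b M' f := fun t ht x ↦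
  (h t ht x).trans (div_le_div_of_nonneg_right hM (pow_nonneg (pnorm_nonneg t x) b))

/-- The map defined by the right-hand sides of the integral equations halves distances on balls of
radius at most `M₀`, for the weight `lam` on the temperature. -/
def Contracts (lam M₀ : ℝ) : Prop :=
  ∀ (M : ℝ), 0 ≤ M → M ≤ M₀ → ∀ (u u' : ℝ → E3 → E3) (θ θ' : ℝ → E3 → ℝ), ForceBound 1 M u →
    ForceBound 1 M u' → ForceBound 3 M θ → ForceBound 3 M θ' → ∀ ρ : ℝ, 0 ≤ ρ →
    ForceBound 1 ρ (fun s y ↦ u s y - u' s y) →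
    ForceBound 3 (ρ / lam) (fun s y ↦ θ s y - θ' s y) →
    ∀ (u₀ : E3 → E3) (θ₀ : E3 → ℝ),
    DecayBound 1 (ρ / 2) (fun t x ↦ mildU u₀ u θ t x - mildU u₀ u' θ' t x) ∧
    DecayBound 3 (ρ / 2 / lam) (fun t x ↦ mildTheta θ₀ u θ t x - mildTheta θ₀ u' θ' t x)

theorem exists_contracts : ∃ lam : ℝ, 1 ≤ lam ∧ ∃ M₀ : ℝ, 0 < M₀ ∧ Contracts lam M₀ := by
  obtain ⟨lam, hlam, M₀, hM₀, H⟩ := exists_contraction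
  refine ⟨lam, hlam, M₀, hM₀, fun M hM hMM u u' θ θ' hu hu' hθ hθ' ρ hρ h1 h2 u₀ θ₀ ↦ ?_⟩
  have h := H M hM hMM u u' θ θ' hu hu' hθ hθ' ρ hρ h1 h2 u₀ θ₀
  exact ⟨fun t ht x ↦ (h t ht x).1, fun t ht x ↦ (h t ht x).2⟩

lemma stronglyMeasurable_lerayDiv {f : Fin 3 → Fin 3 → ℝ → E3 → ℝ}
    (hf : ∀ l j, AEStronglyMeasurable (fun p : ℝ × E3 ↦ f l j p.1 p.2) halfSpaceTime) (k : Fin 3) :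
    StronglyMeasurable (fun q : ℝ × E3 ↦ lerayDiv f k q.1 q.2) := by
  unfold lerayDiv
  exact Finset.stronglyMeasurable_fun_sum _ fun j _ ↦ Finset.stronglyMeasurable_fun_sum _ fun l _ ↦
    stronglyMeasurable_duhamel (parabolicKernel_gradLeray l k j).measurable (hf l j)

lemma stronglyMeasurable_heatDiv {f : Fin 3 → ℝ → E3 → ℝ}
    (hf : ∀ l, AEStronglyMeasurable (fun p : ℝ × E3 ↦ f l p.1 p.2) halfSpaceTime) :
    StronglyMeasurable (fun q : ℝ × E3 ↦ heatDiv f q.1 q.2) := by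
  unfold heatDiv
  exact Finset.stronglyMeasurable_fun_sum _ fun l _ ↦
    stronglyMeasurable_duhamel (parabolicKernel_gradHeat l).measurable (hf l)

lemma aestronglyMeasurable_coord {α : Type*} [MeasurableSpace α] {μ : Measure α} {f : α → E3}
    (hf : AEStronglyMeasurable f μ) (k : Fin 3) : AEStronglyMeasurable (fun a ↦ f a k) μ :=
  (EuclideanSpace.proj k : E3 →L[ℝ] ℝ).continuous.comp_aestronglyMeasurable hf

lemma stronglyMeasurable_mildU {u₀ : E3 → E3} {u : ℝ → E3 → E3} {θ : ℝ → E3 → ℝ}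
    (hu₀ : AEStronglyMeasurable u₀ volume)
    (hu : AEStronglyMeasurable (fun p : ℝ × E3 ↦ u p.1 p.2) halfSpaceTime)
    (hθ : AEStronglyMeasurable (fun p : ℝ × E3 ↦ θ p.1 p.2) halfSpaceTime) :
    StronglyMeasurable (fun q : ℝ × E3 ↦ mildU u₀ u θ q.1 q.2) := by
  refine (PiLp.continuous_toLp 2 fun _ : Fin 3 ↦ ℝ).comp_stronglyMeasurable
    (Measurable.stronglyMeasurable (measurable_pi_lambda _ fun k ↦ ?_))
  exact (((stronglyMeasurable_heatSemigroup (aestronglyMeasurable_coord hu₀ k)).sub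
    (stronglyMeasurable_lerayDiv (fun l j ↦ (aestronglyMeasurable_coord hu l).mul
      (aestronglyMeasurable_coord hu j)) k)).add
    (stronglyMeasurable_duhamel (parabolicKernel_leray k 2).measurable hθ)).measurable

lemma stronglyMeasurable_mildTheta {θ₀ : E3 → ℝ} {u : ℝ → E3 → E3} {θ : ℝ → E3 → ℝ}
    (hθ₀ : AEStronglyMeasurable θ₀ volume)
    (hu : AEStronglyMeasurable (fun p : ℝ × E3 ↦ u p.1 p.2) halfSpaceTime)
    (hθ : AEStronglyMeasurable (fun p : ℝ × E3 ↦ θ p.1 p.2) halfSpaceTime) :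
    StronglyMeasurable (fun q : ℝ × E3 ↦ mildTheta θ₀ u θ q.1 q.2) :=
  (stronglyMeasurable_heatSemigroup hθ₀).sub
    (stronglyMeasurable_heatDiv fun l ↦ hθ.mul (aestronglyMeasurable_coord hu l))

/-- The iterates are Cauchy at each point with t > 0. The limit is therefore taken pointwise, and
completeness of a weighted function space is never invoked. -/
lemma exists_limit_of_geometric {F : Type*} [NormedAddCommGroup F] [CompleteSpace F] {b : ℕ} {M : ℝ}
    {w : ℕ → ℝ → E3 → F} (hm : ∀ n, AEStronglyMeasurable (fun p : ℝ × E3 ↦ w n p.1 p.2) halfSpaceTime)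
    (hb : ∀ n, DecayBound b M (w n))
    (hd : ∀ n, DecayBound b (M / 2 / 2 ^ n) (fun t x ↦ w (n + 1) t x - w n t x)) :
    ∃ f : ℝ → E3 → F, AEStronglyMeasurable (fun p : ℝ × E3 ↦ f p.1 p.2) halfSpaceTime ∧
      DecayBound b M f ∧ (∀ n, DecayBound b (M / 2 ^ n) (fun t x ↦ w n t x - f t x)) ∧
      ∀ t : ℝ, 0 < t → ∀ x, Tendsto (fun n ↦ w n t x) atTop (𝓝 (f t x)) := by
  have hdist : ∀ t : ℝ, 0 < t → ∀ x n,
      dist (w n t x) (w (n + 1) t x) ≤ M / pnorm t x ^ b / 2 / 2 ^ n := fun t ht x n ↦ by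
    rw [dist_comm, dist_eq_norm]
    exact (hd n t ht x).trans_eq (by ring)
  have hex : ∀ t x, ∃ a, 0 < t → Tendsto (fun n ↦ w n t x) atTop (𝓝 a) := fun t x ↦ by
    by_cases ht : 0 < t
    · obtain ⟨a, ha⟩ := cauchySeq_tendsto_of_complete (cauchySeq_of_le_geometric_two (hdist t ht x))
      exact ⟨a, fun _ ↦ ha⟩
    · exact ⟨0, fun h ↦ absurd h ht⟩
  choose f hf using hex
  refine ⟨f, ?_, fun t ht x ↦ ?_, fun n t ht x ↦ ?_, fun t ht x ↦ hf t x ht⟩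
  · refine aestronglyMeasurable_of_tendsto_ae atTop hm ?_
    filter_upwards [ae_halfSpaceTime_pos] with p hp
    exact hf p.1 p.2 hp
  · exact le_of_tendsto (hf t x ht).norm (Eventually.of_forall fun n ↦ hb n t ht x)
  · have := dist_le_of_le_geometric_two_of_tendsto (hdist t ht x) (hf t x ht) n
    rw [dist_eq_norm] at this
    exact this.trans_eq (by ring)

/-- The iterates of the map defined by the right-hand sides of the integral equations. -/
def picard (u₀ : E3 → E3) (θ₀ : E3 → ℝ) : ℕ → (ℝ → E3 → E3) × (ℝ → E3 → ℝ)
  | 0 => (0, 0)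
  | n + 1 => (mildU u₀ (picard u₀ θ₀ n).1 (picard u₀ θ₀ n).2,
      mildTheta θ₀ (picard u₀ θ₀ n).1 (picard u₀ θ₀ n).2)

/-- The image of zero has half the radius of the ball, and contraction towards it contributes at
most the other half, so the ball of radii M and M/lam is preserved. -/
theorem Contracts.exists_fixedPoint {lam M₀ M : ℝ} (hc : Contracts lam M₀) (hlam : 1 ≤ lam)
    (hM : 0 ≤ M) (hMM₀ : M ≤ M₀) {u₀ : E3 → E3} {θ₀ : E3 → ℝ} (hu₀ : AEStronglyMeasurable u₀ volume)
    (hθ₀ : AEStronglyMeasurable θ₀ volume) (h1 : DecayBound 1 (M / 2) (mildU u₀ 0 0))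
    (h3 : DecayBound 3 (M / 2 / lam) (mildTheta θ₀ 0 0)) :
    ∃ (u : ℝ → E3 → E3) (θ : ℝ → E3 → ℝ), ForceBound 1 M u ∧ ForceBound 3 M θ ∧
      DecayBound 1 M u ∧ DecayBound 3 M θ ∧
      ∀ t : ℝ, 0 < t → ∀ x, u t x = mildU u₀ u θ t x ∧ θ t x = mildTheta θ₀ u θ t x := by
  have hlam0 : 0 < lam := by linarith
  have hMl : M / lam ≤ M := div_le_self hM hlam
  set w := picard u₀ θ₀ with hw
  have hwu : ∀ n, (w (n + 1)).1 = mildU u₀ (w n).1 (w n).2 := fun n ↦ rfl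
  have hwθ : ∀ n, (w (n + 1)).2 = mildTheta θ₀ (w n).1 (w n).2 := fun n ↦ rfl
  have hz1 : DecayBound 1 M (0 : ℝ → E3 → E3) := fun t ht x ↦ by
    have := pnorm_pos ht x
    simp only [Pi.zero_apply, norm_zero]; positivity
  have hz3 : DecayBound 3 (M / lam) (0 : ℝ → E3 → ℝ) := fun t ht x ↦ by
    have := pnorm_pos ht x
    simp only [Pi.zero_apply, norm_zero]; positivity
  have hzm : AEStronglyMeasurable (fun p : ℝ × E3 ↦ (0 : ℝ → E3 → E3) p.1 p.2) halfSpaceTime :=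
    aestronglyMeasurable_const
  have hzm' : AEStronglyMeasurable (fun p : ℝ × E3 ↦ (0 : ℝ → E3 → ℝ) p.1 p.2) halfSpaceTime :=
    aestronglyMeasurable_const
  have hm : ∀ n, AEStronglyMeasurable (fun p : ℝ × E3 ↦ (w n).1 p.1 p.2) halfSpaceTime ∧
      AEStronglyMeasurable (fun p : ℝ × E3 ↦ (w n).2 p.1 p.2) halfSpaceTime := fun n ↦ by
    induction n with
    | zero => exact ⟨hzm, hzm'⟩
    | succ n ih =>
      exact ⟨(stronglyMeasurable_mildU hu₀ ih.1 ih.2).aestronglyMeasurable,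
        (stronglyMeasurable_mildTheta hθ₀ ih.1 ih.2).aestronglyMeasurable⟩
  have hb : ∀ n, DecayBound 1 M (w n).1 ∧ DecayBound 3 (M / lam) (w n).2 := fun n ↦ by
    induction n with
    | zero => exact ⟨hz1, hz3⟩
    | succ n ih =>
      have h := hc M hM hMM₀ (w n).1 0 (w n).2 0 (ih.1.forceBound (hm n).1) (hz1.forceBound hzm)
        ((ih.2.mono hMl).forceBound (hm n).2) ((hz3.mono hMl).forceBound hzm') M hM
        (by simpa using ih.1.forceBound (hm n).1) (by simpa using ih.2.forceBound (hm n).2) u₀ θ₀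
      refine ⟨fun t ht x ↦ ?_, fun t ht x ↦ ?_⟩
      · have e := norm_add_le (mildU u₀ (w n).1 (w n).2 t x - mildU u₀ 0 0 t x) (mildU u₀ 0 0 t x)
        rw [sub_add_cancel] at e
        exact (e.trans (add_le_add (h.1 t ht x) (h1 t ht x))).trans_eq (by ring)
      · have e := norm_add_le (mildTheta θ₀ (w n).1 (w n).2 t x - mildTheta θ₀ 0 0 t x)
          (mildTheta θ₀ 0 0 t x)
        rw [sub_add_cancel] at e
        exact (e.trans (add_le_add (h.2 t ht x) (h3 t ht x))).trans_eq (by ring)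
  have hF1 : ∀ n, ForceBound 1 M (w n).1 := fun n ↦ (hb n).1.forceBound (hm n).1
  have hF3 : ∀ n, ForceBound 3 M (w n).2 := fun n ↦ ((hb n).2.mono hMl).forceBound (hm n).2
  have hd : ∀ n, DecayBound 1 (M / 2 / 2 ^ n) (fun t x ↦ (w (n + 1)).1 t x - (w n).1 t x) ∧
      DecayBound 3 (M / lam / 2 / 2 ^ n) (fun t x ↦ (w (n + 1)).2 t x - (w n).2 t x) := fun n ↦ by
    induction n with
    | zero =>
      refine ⟨fun t ht x ↦ ?_, fun t ht x ↦ ?_⟩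
      · have := h1 t ht x
        simpa [hw, picard] using this
      · have := h3 t ht x
        have e : M / lam / 2 = M / 2 / lam := by ring
        simpa [hw, picard, e] using this
    | succ n ih =>
      have h := hc M hM hMM₀ _ _ _ _ (hF1 (n + 1)) (hF1 n) (hF3 (n + 1)) (hF3 n) (M / 2 / 2 ^ n)
        (by positivity) (ih.1.forceBound ((hm _).1.sub (hm n).1))
        ((ih.2.mono (le_of_eq (by ring))).forceBound ((hm _).2.sub (hm n).2)) u₀ θ₀
      exact ⟨h.1.mono (le_of_eq (by ring)), h.2.mono (le_of_eq (by ring))⟩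
  obtain ⟨u, hum, hub, hud, hul⟩ := exists_limit_of_geometric (fun n ↦ (hm n).1) (fun n ↦ (hb n).1)
    (fun n ↦ (hd n).1)
  obtain ⟨θ, hθm, hθb, hθd, hθl⟩ := exists_limit_of_geometric (fun n ↦ (hm n).2) (fun n ↦ (hb n).2)
    (fun n ↦ (hd n).2)
  have hu := hub.forceBound hum
  have hθ := (hθb.mono hMl).forceBound hθm
  -- The right-hand sides pass to the limit by the contraction estimate itself, applied to an
  -- iterate and the limit; no convergence theorem for integrals is needed.
  have hlim : ∀ n, _ := fun n ↦ hc M hM hMM₀ _ _ _ _ (hF1 n) hu (hF3 n) hθ (M / 2 ^ n) (by positivity)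
    ((hud n).forceBound ((hm n).1.sub hum))
    (((hθd n).mono (le_of_eq (by ring))).forceBound ((hm n).2.sub hθm)) u₀ θ₀
  have hpow : ∀ c : ℝ, Tendsto (fun n : ℕ ↦ c / 2 ^ n) atTop (𝓝 0) := fun c ↦ by
    simpa [div_eq_mul_inv, inv_pow] using (tendsto_pow_atTop_nhds_zero_of_lt_one
      (r := (2 : ℝ)⁻¹) (by norm_num) (by norm_num)).const_mul c
  refine ⟨u, θ, hu, hθ, hub, hθb.mono hMl, fun t ht x ↦ ⟨?_, ?_⟩⟩
  · refine tendsto_nhds_unique ((tendsto_add_atTop_iff_nat 1).2 (hul t ht x)) ?_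
    rw [tendsto_iff_norm_sub_tendsto_zero]
    exact squeeze_zero (fun _ ↦ norm_nonneg _) (fun n ↦ ((hlim n).1 t ht x).trans_eq
      (show _ = M / 2 / pnorm t x ^ 1 / 2 ^ n by ring)) (hpow _)
  · refine tendsto_nhds_unique ((tendsto_add_atTop_iff_nat 1).2 (hθl t ht x)) ?_
    rw [tendsto_iff_norm_sub_tendsto_zero]
    exact squeeze_zero (fun _ ↦ norm_nonneg _) (fun n ↦ ((hlim n).2 t ht x).trans_eq
      (show _ = M / 2 / lam / pnorm t x ^ 3 / 2 ^ n by ring)) (hpow _)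

/-! ### Weighted suprema -/

lemma ae_ne_zero : ∀ᵐ x : E3, x ≠ 0 :=
  compl_mem_ae_iff.2 (measure_singleton (0 : E3))

lemma norm_le_div_of_enorm_le {F : Type*} [NormedAddCommGroup F] {v : F} {r c : ℝ} {m : ℕ}
    (hr : 0 < r) (hc : 0 ≤ c) (h : ENNReal.ofReal (r ^ m) * ‖v‖ₑ ≤ ENNReal.ofReal c) :
    ‖v‖ ≤ c / r ^ m := by
  rw [← ofReal_norm, ← ENNReal.ofReal_mul (by positivity), ENNReal.ofReal_le_ofReal_iff hc] at h
  rwa [le_div_iff₀' (by positivity)]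

lemma enorm_mul_le_of_norm_le {F : Type*} [NormedAddCommGroup F] {v : F} {r R c : ℝ} {m : ℕ}
    (hr : 0 ≤ r) (hrR : r ≤ R) (hR : 0 < R) (h : ‖v‖ ≤ c / R ^ m) :
    ENNReal.ofReal (r ^ m) * ‖v‖ₑ ≤ ENNReal.ofReal c := by
  rw [← ofReal_norm, ← ENNReal.ofReal_mul (by positivity)]
  refine ENNReal.ofReal_le_ofReal ?_
  calc r ^ m * ‖v‖ ≤ R ^ m * (c / R ^ m) := by gcongr
    _ = c := mul_div_cancel₀ _ (by positivity)

lemma ae_norm_le_of_weightedSup_le {F : Type*} [NormedAddCommGroup F] {m : ℕ} {f : E3 → F} {c : ℝ}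
    (hc : 0 ≤ c) (h : weightedSup m f ≤ ENNReal.ofReal c) : ∀ᵐ x, ‖f x‖ ≤ c / ‖x‖ ^ m := by
  filter_upwards [ENNReal.ae_le_essSup (μ := volume)
    (fun x : E3 ↦ ENNReal.ofReal (‖x‖ ^ m) * ‖f x‖ₑ), ae_ne_zero] with x hx h0
  exact norm_le_div_of_enorm_le (norm_pos_iff.2 h0) hc (hx.trans h)

lemma weightedSup_le {F : Type*} [NormedAddCommGroup F] {m : ℕ} {f : E3 → F} {c t : ℝ} (ht : 0 < t)
    (h : ∀ x, ‖f x‖ ≤ c / pnorm t x ^ m) : weightedSup m f ≤ ENNReal.ofReal c :=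
  essSup_le_of_ae_le _ (Eventually.of_forall fun x ↦
    enorm_mul_le_of_norm_le (norm_nonneg x) (norm_le_pnorm t x) (pnorm_pos ht x) (h x))

lemma forceBound_of_parabolicSup_le {F : Type*} [NormedAddCommGroup F] {m : ℕ} {f : ℝ → E3 → F} {c : ℝ}
    (hc : 0 ≤ c) (hm : AEStronglyMeasurable (fun p : ℝ × E3 ↦ f p.1 p.2) halfSpaceTime)
    (h : parabolicSup m f ≤ ENNReal.ofReal c) : ForceBound m c f where
  measurable := hm
  bound := by
    filter_upwards [ENNReal.ae_le_essSup (μ := halfSpaceTime)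
      (fun p : ℝ × E3 ↦ ENNReal.ofReal ((√p.1 + ‖p.2‖) ^ m) * ‖f p.1 p.2‖ₑ),
      ae_halfSpaceTime_pos] with p hp h0
    exact norm_le_div_of_enorm_le (pnorm_pos h0 p.2) hc (hp.trans h)

lemma DecayBound.parabolicSup_le {F : Type*} [NormedAddCommGroup F] {m : ℕ} {f : ℝ → E3 → F} {c : ℝ}
    (h : DecayBound m c f) : parabolicSup m f ≤ ENNReal.ofReal c := by
  refine essSup_le_of_ae_le _ ?_
  filter_upwards [ae_halfSpaceTime_pos] with p hp
  exact enorm_mul_le_of_norm_le (pnorm_nonneg p.1 p.2) le_rfl (pnorm_pos hp p.2) (h p.1 hp p.2)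

/-! ### Small data -/

/-- The hypotheses on the data, in the form used for the estimates. -/
structure SmallData (δ : ℝ) (u₀ : E3 → E3) (θ₀ : E3 → ℝ) : Prop where
  measurable_u : AEStronglyMeasurable u₀ volume
  norm_u : DecayingDatum 1 δ (fun y ↦ ‖u₀ y‖)
  theta : DecayingDatum 3 δ θ₀
  mass : ∫⁻ x, ‖θ₀ x‖ₑ ≤ ENNReal.ofReal δ
  divFree : DivFree u₀

lemma SmallData.coord {δ : ℝ} {u₀ : E3 → E3} {θ₀ : E3 → ℝ} (h : SmallData δ u₀ θ₀) (k : Fin 3) :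
    DecayingDatum 1 δ (fun y ↦ u₀ y k) where
  measurable := aestronglyMeasurable_coord h.measurable_u k
  bound := by
    filter_upwards [h.norm_u.bound] with y hy
    rw [abs_norm] at hy
    exact (abs_coord_le_norm _ k).trans hy
  mass R hR := by
    refine (lintegral_mono fun y ↦ ?_).trans (h.norm_u.mass R hR)
    rw [← ofReal_norm, ← ofReal_norm, norm_norm, Real.norm_eq_abs]
    exact ENNReal.ofReal_le_ofReal (abs_coord_le_norm _ k)

lemma exists_smallData : ∃ c : ℝ, 0 < c ∧ ∀ (ε : ℝ), 0 < ε → ∀ (u₀ : E3 → E3) (θ₀ : E3 → ℝ),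
    AEStronglyMeasurable u₀ volume → AEStronglyMeasurable θ₀ volume → DivFree u₀ →
    eLpNorm θ₀ 1 volume ≤ ENNReal.ofReal ε → weightedSup 3 θ₀ ≤ ENNReal.ofReal ε →
    weightedSup 1 u₀ ≤ ENNReal.ofReal ε → SmallData (c * ε) u₀ θ₀ := by
  obtain ⟨c, hc, Hc⟩ := exists_lintegral_ball_inv_sq
  refine ⟨c + 1, by positivity, fun ε hε u₀ θ₀ hu hθ hdiv hL hθ3 hu1 ↦ ?_⟩
  rw [eLpNorm_one_eq_lintegral_enorm] at hL
  have hle : ε ≤ (c + 1) * ε := by nlinarith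
  have hle' : c * ε ≤ (c + 1) * ε := by nlinarith
  have hL' := hL.trans (ENNReal.ofReal_le_ofReal hle)
  have hub := ae_norm_le_of_weightedSup_le hε.le hu1
  refine ⟨hu, ⟨hu.norm, ?_, fun R hR ↦ ?_⟩, ⟨hθ, ?_, fun R hR ↦ ?_⟩, hL', hdiv⟩
  · filter_upwards [hub] with y hy
    rw [abs_norm]
    exact hy.trans (by gcongr)
  -- On the ball |y|^{-1} ≤ R |y|^{-2}, and the mass of |y|^{-2} is known.
  · calc _ ≤ ∫⁻ y in Metric.ball (0 : E3) R,
          ENNReal.ofReal (ε * R) * ENNReal.ofReal ((‖y‖ ^ 2)⁻¹) := by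
          refine lintegral_mono_ae ?_
          filter_upwards [ae_restrict_of_ae hub, ae_restrict_of_ae ae_ne_zero,
            ae_restrict_mem measurableSet_ball] with y hy h0 hyR
          rw [mem_ball_zero_iff] at hyR
          have hy0 := norm_pos_iff.2 h0
          rw [← ofReal_norm, norm_norm, ← ENNReal.ofReal_mul (by positivity)]
          refine ENNReal.ofReal_le_ofReal (hy.trans ?_)
          rw [pow_one, ← div_eq_mul_inv, div_le_div_iff₀ hy0 (by positivity)]
          nlinarith [mul_nonneg hε.le hy0.le]
      _ = ENNReal.ofReal (ε * R) * ∫⁻ y in Metric.ball (0 : E3) R, ENNReal.ofReal ((‖y‖ ^ 2)⁻¹) :=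
          lintegral_const_mul' _ _ ENNReal.ofReal_ne_top
      _ ≤ ENNReal.ofReal (ε * R) * ENNReal.ofReal (c * R) := by gcongr; exact Hc R hR
      _ ≤ _ := by
          rw [← ENNReal.ofReal_mul (by positivity)]
          refine ENNReal.ofReal_le_ofReal ?_
          have e : R ^ 3 / R ^ 1 = R * R := by field_simp
          rw [e]
          nlinarith [mul_pos hR hR]
  · filter_upwards [ae_norm_le_of_weightedSup_le hε.le hθ3] with y hy
    exact hy.trans (by gcongr)
  -- For order 3 the required mass does not depend on R, and it is exactly what the L¹ smallness
  -- supplies.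
  · rw [div_self (by positivity), mul_one]
    exact (setLIntegral_le_lintegral _ _).trans hL'

/-! ### Bounds for the right-hand sides -/

/-- The modulus of continuity in time of the solution. -/
def solutionModulus (t h : ℝ) : ℝ := h / t + timeModulus t h / √t

lemma solutionModulus_nonneg {t h : ℝ} (ht : 0 < t) (hh : 0 ≤ h) : 0 ≤ solutionModulus t h := by
  have := timeModulus_nonneg ht.le hh
  unfold solutionModulus; positivity

/-- One power of √t + |x| is given up for √t, turning the decay of the Duhamel increments into that
of the solution spaces (for the temperature, from order 4 to 3). -/
lemma timeModulus_div_le {t h M C : ℝ} {m : ℕ} (ht : 0 < t) (hh : 0 ≤ h) (hC : 0 ≤ C) (x : E3)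
    (hM : M ≤ C * timeModulus t h / pnorm t x ^ (m + 1)) :
    M ≤ C * solutionModulus t h / pnorm t x ^ m := by
  have hN := pnorm_pos ht x
  have hq := Real.sqrt_pos.2 ht
  have hmod := timeModulus_nonneg ht.le hh
  refine hM.trans ?_
  rw [pow_succ, mul_comm (pnorm t x ^ m), ← div_div]
  gcongr
  calc C * timeModulus t h / pnorm t x ≤ C * timeModulus t h / √t := by
        gcongr; exact sqrt_le_pnorm t x
    _ ≤ C * solutionModulus t h := by
        rw [mul_div_assoc]
        unfold solutionModulus
        gcongr
        have : 0 ≤ h / t := by positivity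
        linarith

lemma exists_mildU_bound : ∃ A : ℝ, 0 ≤ A ∧ ∀ (δ : ℝ), 0 ≤ δ → ∀ (u₀ : E3 → E3) (θ₀ : E3 → ℝ),
    SmallData δ u₀ θ₀ → DecayBound 1 (A * δ) (mildU u₀ 0 0) ∧
    ∀ (M : ℝ) (u : ℝ → E3 → E3) (θ : ℝ → E3 → ℝ), 0 ≤ M → ForceBound 1 M u → ForceBound 3 M θ →
    ∀ t h : ℝ, 0 < t → 0 ≤ h → ∀ x : E3, ‖mildU u₀ u θ (t + h) x - mildU u₀ u θ t x‖ ≤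
      A * (δ + M * M + M) * solutionModulus t h / pnorm t x ^ 1 := by
  obtain ⟨A₁, hA₁, H₁⟩ := exists_lerayDiv_bound
  obtain ⟨A₂, hA₂, H₂⟩ := exists_buoyancy_bound
  obtain ⟨A₃, hA₃, H₃⟩ := exists_heatSemigroup_bound 1
  refine ⟨3 * (A₁ + A₂ + A₃), by positivity, fun δ hδ u₀ θ₀ hd ↦ ⟨fun t ht x ↦ ?_,
    fun M u θ hM hu hθ t h ht hh x ↦ ?_⟩⟩
  · have hN := pnorm_pos ht x
    have hk : ∀ k, |mildU u₀ 0 0 t x k| ≤ A₃ * δ / pnorm t x ^ 1 := fun k ↦ by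
      have e : mildU u₀ 0 0 t x k = heatSemigroup t (fun y ↦ u₀ y k) x := by
        simp [mildU, lerayDiv, duhamel]
      rw [e]
      exact (H₃ δ _ hδ (hd.coord k) t ht x).2.1
    refine (norm_le_of_forall_abs_le hk).trans ?_
    rw [← mul_div_assoc, ← mul_assoc]
    gcongr
    linarith
  · have hN := pnorm_pos ht x
    have hs := solutionModulus_nonneg ht hh
    have hk : ∀ k, |(mildU u₀ u θ (t + h) x - mildU u₀ u θ t x) k| ≤
        (A₁ + A₂ + A₃) * (δ + M * M + M) * solutionModulus t h / pnorm t x ^ 1 := fun k ↦ by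
      have b1 := timeModulus_div_le ht hh (by positivity) x (m := 1)
        ((H₁ (M * M) (fun l j s y ↦ u s y l * u s y j) (by positivity)
        (fun l j ↦ (hu.coord l).mul (hu.coord j)) k t ht x).2 h hh)
      have b2 := timeModulus_div_le ht hh (by positivity) x (m := 1)
        ((H₂ M θ hM hθ k t ht x).2 h hh)
      have b3 : |heatSemigroup (t + h) (fun y ↦ u₀ y k) x - heatSemigroup t (fun y ↦ u₀ y k) x| ≤
          A₃ * δ * solutionModulus t h / pnorm t x ^ 1 := by
        refine ((H₃ δ _ hδ (hd.coord k) t ht x).2.2 h hh).trans ?_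
        gcongr
        have := timeModulus_nonneg ht.le hh
        exact le_add_of_nonneg_right (by positivity)
      have e : (mildU u₀ u θ (t + h) x - mildU u₀ u θ t x) k =
          (heatSemigroup (t + h) (fun y ↦ u₀ y k) x - heatSemigroup t (fun y ↦ u₀ y k) x) -
          (lerayDiv (fun l j s y ↦ u s y l * u s y j) k (t + h) x -
            lerayDiv (fun l j s y ↦ u s y l * u s y j) k t x) +
          (duhamel (lerayKernel k 2) θ (t + h) x - duhamel (lerayKernel k 2) θ t x) := by
        simp only [mildU, PiLp.sub_apply]
        ring
      rw [e]
      calc _ ≤ A₃ * δ * solutionModulus t h / pnorm t x ^ 1 +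
            A₁ * (M * M) * solutionModulus t h / pnorm t x ^ 1 +
            A₂ * M * solutionModulus t h / pnorm t x ^ 1 :=
            (abs_add_le _ _).trans (add_le_add ((abs_sub _ _).trans (add_le_add b3 b1)) b2)
        _ = (A₃ * δ + A₁ * (M * M) + A₂ * M) * solutionModulus t h / pnorm t x ^ 1 := by ring
        _ ≤ _ := by
          gcongr
          have := mul_nonneg hM hM
          nlinarith [mul_nonneg hA₁ hδ, mul_nonneg hA₂ hδ, mul_nonneg hA₃ this, mul_nonneg hA₂ this,
            mul_nonneg hA₁ hM, mul_nonneg hA₃ hM]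
    exact (norm_le_of_forall_abs_le hk).trans_eq (by ring)

/-- The L¹ estimates ask of u and θ only the pointwise bounds, because θu has order 4. The L¹ norm
can thus be recovered after the fixed point is found. -/
lemma exists_mildTheta_bound : ∃ A : ℝ, 0 ≤ A ∧ ∀ (δ : ℝ), 0 ≤ δ → ∀ (u₀ : E3 → E3) (θ₀ : E3 → ℝ),
    SmallData δ u₀ θ₀ → DecayBound 3 (A * δ) (mildTheta θ₀ 0 0) ∧
    ∀ (M : ℝ) (u : ℝ → E3 → E3) (θ : ℝ → E3 → ℝ), 0 ≤ M → ForceBound 1 M u → ForceBound 3 M θ →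
    ∀ t : ℝ, 0 < t → ∫⁻ x, ‖mildTheta θ₀ u θ t x‖ₑ ≤ ENNReal.ofReal (A * (δ + M * M)) ∧
      ∀ h : ℝ, 0 ≤ h → (∀ x : E3, ‖mildTheta θ₀ u θ (t + h) x - mildTheta θ₀ u θ t x‖ ≤
        A * (δ + M * M) * solutionModulus t h / pnorm t x ^ 3) ∧
        ∫⁻ x, ‖mildTheta θ₀ u θ (t + h) x - mildTheta θ₀ u θ t x‖ₑ ≤
          ENNReal.ofReal (A * (δ + M * M) * solutionModulus t h) := by
  obtain ⟨A₁, hA₁, H₁⟩ := exists_heatDiv_bound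
  obtain ⟨A₂, hA₂, H₂⟩ := exists_heatSemigroup_L1_bound 3
  obtain ⟨A₃, hA₃, H₃⟩ := exists_heatSemigroup_bound 3
  refine ⟨A₁ + A₂ + A₃, by positivity, fun δ hδ u₀ θ₀ hd ↦ ⟨fun t ht x ↦ ?_,
    fun M u θ hM hu hθ t ht ↦ ?_⟩⟩
  · have hN := pnorm_pos ht x
    have e : mildTheta θ₀ 0 0 t x = heatSemigroup t θ₀ x := by simp [mildTheta, heatDiv, duhamel]
    rw [e]
    refine ((H₃ δ _ hδ hd.theta t ht x).2.1).trans ?_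
    gcongr
    linarith
  · set f : Fin 3 → ℝ → E3 → ℝ := fun l s y ↦ θ s y * u s y l with hf
    have hfb : ∀ l, ForceBound 4 (M * M) (f l) := fun l ↦ hθ.mul (hu.coord l)
    have hMM : 0 ≤ M * M := mul_nonneg hM hM
    obtain ⟨h1, h2, h3⟩ := H₁ (M * M) f hMM hfb t ht
    obtain ⟨g1, g2⟩ := H₂ δ θ₀ hδ hd.theta t ht
    have hmH : ∀ t, Measurable fun x ↦ heatSemigroup t θ₀ x := fun t ↦
      (stronglyMeasurable_heatSemigroup hd.theta.measurable).measurable.comp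
        (measurable_const.prodMk measurable_id)
    have hq := Real.sqrt_pos.2 ht
    refine ⟨?_, fun h hh ↦ ⟨fun x ↦ ?_, ?_⟩⟩
    · calc _ ≤ ∫⁻ x, (‖heatSemigroup t θ₀ x‖ₑ + ‖heatDiv f t x‖ₑ) :=
            lintegral_mono fun x ↦ enorm_sub_le
        _ = (∫⁻ x, ‖heatSemigroup t θ₀ x‖ₑ) + ∫⁻ x, ‖heatDiv f t x‖ₑ :=
            lintegral_add_left (hmH t).enorm _
        _ ≤ ENNReal.ofReal A₂ * ENNReal.ofReal δ + ENNReal.ofReal (A₁ * (M * M)) := by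
            refine add_le_add (g1.trans ?_) h2
            gcongr
            exact hd.mass
        _ ≤ _ := by
            rw [← ENNReal.ofReal_mul hA₂, ← ENNReal.ofReal_add (by positivity) (by positivity)]
            refine ENNReal.ofReal_le_ofReal ?_
            nlinarith [mul_nonneg hA₁ hδ, mul_nonneg hA₃ hδ, mul_nonneg hA₃ hMM, mul_nonneg hA₂ hMM]
    · have hN := pnorm_pos ht x
      have hs := solutionModulus_nonneg ht hh
      have b1 := timeModulus_div_le ht hh (by positivity) x (m := 3) ((h1 x).2 h hh)
      have b2 : |heatSemigroup (t + h) θ₀ x - heatSemigroup t θ₀ x| ≤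
          A₃ * δ * solutionModulus t h / pnorm t x ^ 3 := by
        refine ((H₃ δ _ hδ hd.theta t ht x).2.2 h hh).trans ?_
        gcongr
        have := timeModulus_nonneg ht.le hh
        exact le_add_of_nonneg_right (by positivity)
      have e : mildTheta θ₀ u θ (t + h) x - mildTheta θ₀ u θ t x =
          (heatSemigroup (t + h) θ₀ x - heatSemigroup t θ₀ x) -
          (heatDiv f (t + h) x - heatDiv f t x) := by
        simp only [mildTheta, hf]
        ring
      rw [e]
      calc _ ≤ A₃ * δ * solutionModulus t h / pnorm t x ^ 3 +
            A₁ * (M * M) * solutionModulus t h / pnorm t x ^ 3 :=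
            (abs_sub _ _).trans (add_le_add b2 b1)
        _ = (A₃ * δ + A₁ * (M * M)) * solutionModulus t h / pnorm t x ^ 3 := by ring
        _ ≤ _ := by
          gcongr
          nlinarith [mul_nonneg hA₁ hδ, mul_nonneg hA₂ hδ, mul_nonneg hA₃ hMM, mul_nonneg hA₂ hMM]
    · have hmod := timeModulus_nonneg ht.le hh
      calc _ ≤ ∫⁻ x, (‖heatSemigroup (t + h) θ₀ x - heatSemigroup t θ₀ x‖ₑ +
              ‖heatDiv f (t + h) x - heatDiv f t x‖ₑ) := by
            refine lintegral_mono fun x ↦ ?_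
            have e : mildTheta θ₀ u θ (t + h) x - mildTheta θ₀ u θ t x =
                (heatSemigroup (t + h) θ₀ x - heatSemigroup t θ₀ x) -
                (heatDiv f (t + h) x - heatDiv f t x) := by
              simp only [mildTheta, hf]
              ring
            simp only [e]
            exact enorm_sub_le
        _ = (∫⁻ x, ‖heatSemigroup (t + h) θ₀ x - heatSemigroup t θ₀ x‖ₑ) +
              ∫⁻ x, ‖heatDiv f (t + h) x - heatDiv f t x‖ₑ :=
            lintegral_add_left ((hmH _).sub (hmH t)).enorm _
        _ ≤ ENNReal.ofReal (A₂ * (h / t)) * ENNReal.ofReal δ +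
              ENNReal.ofReal (A₁ * (M * M) * timeModulus t h / √t) := by
            refine add_le_add ((g2 h hh).trans ?_) (h3 h hh)
            gcongr
            exact hd.mass
        _ ≤ _ := by
            rw [← ENNReal.ofReal_mul (by positivity), ← ENNReal.ofReal_add (by positivity)
              (by positivity)]
            refine ENNReal.ofReal_le_ofReal ?_
            set a := h / t with ha
            set b := timeModulus t h / √t with hb
            have ha0 : 0 ≤ a := by positivity
            have hb0 : 0 ≤ b := by positivity
            rw [mul_div_assoc, ← hb, solutionModulus, ← ha, ← hb]
            calc A₂ * a * δ + A₁ * (M * M) * b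
                ≤ (A₁ + A₂ + A₃) * (δ + M * M) * a + (A₁ + A₂ + A₃) * (δ + M * M) * b := by
                  rw [mul_right_comm A₂]
                  gcongr <;> linarith
              _ = _ := by ring

/-! ### Regularity of the fixed point -/

/-- `(u, θ)` satisfies the integral equations at every point, with decay of size `M`. -/
structure IsFixedPoint (δ M : ℝ) (u₀ : E3 → E3) (θ₀ : E3 → ℝ) (u : ℝ → E3 → E3) (θ : ℝ → E3 → ℝ) :
    Prop where
  nonneg_data : 0 ≤ δ
  nonneg : 0 ≤ M
  data : SmallData δ u₀ θ₀
  force_u : ForceBound 1 M u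
  force_theta : ForceBound 3 M θ
  decay_u : DecayBound 1 M u
  decay_theta : DecayBound 3 M θ
  zero_u : u 0 = u₀
  zero_theta : θ 0 = θ₀
  eq_u : ∀ t : ℝ, 0 < t → u t = mildU u₀ u θ t
  eq_theta : ∀ t : ℝ, 0 < t → θ t = mildTheta θ₀ u θ t

lemma mildU_congr {u₀ : E3 → E3} {u u' : ℝ → E3 → E3} {θ θ' : ℝ → E3 → ℝ}
    (hu : ∀ᵐ p ∂halfSpaceTime, u p.1 p.2 = u' p.1 p.2)
    (hθ : ∀ᵐ p ∂halfSpaceTime, θ p.1 p.2 = θ' p.1 p.2) (t : ℝ) :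
    mildU u₀ u θ t = mildU u₀ u' θ' t := by
  ext x k
  have h : ∀ l j, duhamel (gradLerayKernel l k j) (fun s y ↦ u s y l * u s y j) t x =
      duhamel (gradLerayKernel l k j) (fun s y ↦ u' s y l * u' s y j) t x := fun l j ↦ by
    refine duhamel_congr ?_ t x
    filter_upwards [hu] with p hp
    rw [hp]
  simp only [mildU, lerayDiv, h, duhamel_congr hθ]

lemma mildTheta_congr {θ₀ : E3 → ℝ} {u u' : ℝ → E3 → E3} {θ θ' : ℝ → E3 → ℝ}
    (hu : ∀ᵐ p ∂halfSpaceTime, u p.1 p.2 = u' p.1 p.2)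
    (hθ : ∀ᵐ p ∂halfSpaceTime, θ p.1 p.2 = θ' p.1 p.2) (t : ℝ) :
    mildTheta θ₀ u θ t = mildTheta θ₀ u' θ' t := by
  ext x
  have h : ∀ l, duhamel (gradHeatKernel l) (fun s y ↦ θ s y * u s y l) t x =
      duhamel (gradHeatKernel l) (fun s y ↦ θ' s y * u' s y l) t x := fun l ↦ by
    refine duhamel_congr ?_ t x
    filter_upwards [hu, hθ] with p hp hp'
    rw [hp, hp']
  simp only [mildTheta, heatDiv, h]

/-- The fixed point is determined only for t > 0. Overwriting it by the data at other times leaves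
the right-hand sides unchanged, as they integrate over positive times only. -/
theorem Contracts.exists_isFixedPoint {lam M₀ M δ : ℝ} (hc : Contracts lam M₀) (hlam : 1 ≤ lam)
    (hδ : 0 ≤ δ) (hM : 0 ≤ M) (hMM₀ : M ≤ M₀) {u₀ : E3 → E3} {θ₀ : E3 → ℝ} (hd : SmallData δ u₀ θ₀)
    (h1 : DecayBound 1 (M / 2) (mildU u₀ 0 0)) (h3 : DecayBound 3 (M / 2 / lam) (mildTheta θ₀ 0 0)) :
    ∃ u θ, IsFixedPoint δ M u₀ θ₀ u θ := by
  obtain ⟨u, θ, hu, hθ, hdu, hdθ, heq⟩ := hc.exists_fixedPoint hlam hM hMM₀ hd.measurable_u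
    hd.theta.measurable h1 h3
  set u' : ℝ → E3 → E3 := fun t ↦ if 0 < t then u t else u₀ with hu'
  set θ' : ℝ → E3 → ℝ := fun t ↦ if 0 < t then θ t else θ₀ with hθ'
  have eu : ∀ t, 0 < t → u' t = u t := fun t ht ↦ if_pos ht
  have eθ : ∀ t, 0 < t → θ' t = θ t := fun t ht ↦ if_pos ht
  have aeu : ∀ᵐ p ∂halfSpaceTime, u p.1 p.2 = u' p.1 p.2 := by
    filter_upwards [ae_halfSpaceTime_pos] with p hp
    rw [eu _ hp]
  have aeθ : ∀ᵐ p ∂halfSpaceTime, θ p.1 p.2 = θ' p.1 p.2 := by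
    filter_upwards [ae_halfSpaceTime_pos] with p hp
    rw [eθ _ hp]
  have hdu' : DecayBound 1 M u' := fun t ht x ↦ by rw [eu t ht]; exact hdu t ht x
  have hdθ' : DecayBound 3 M θ' := fun t ht x ↦ by rw [eθ t ht]; exact hdθ t ht x
  refine ⟨u', θ', hδ, hM, hd, hdu'.forceBound (hu.measurable.congr aeu),
    hdθ'.forceBound (hθ.measurable.congr aeθ), hdu', hdθ', if_neg (lt_irrefl _),
    if_neg (lt_irrefl _), fun t ht ↦ ?_, fun t ht ↦ ?_⟩
  · rw [eu t ht, ← mildU_congr aeu aeθ]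
    ext1 x
    exact (heq t ht x).1
  · rw [eθ t ht, ← mildTheta_congr aeu aeθ]
    ext1 x
    exact (heq t ht x).2

/-! ### Divergence and initial values of the right-hand sides. -/

lemma integrable_test_mul {φ g : E3 → ℝ} (hφ : Continuous φ) (hc : HasCompactSupport φ)
    (hg : AEStronglyMeasurable g volume) {B : ℝ} (hB : ∀ x, |g x| ≤ B) :
    Integrable (fun x ↦ φ x * g x) :=
  (hφ.integrable_of_hasCompactSupport hc).mul_bdd hg (Eventually.of_forall hB)

lemma div_pnorm_le {t c : ℝ} (ht : 0 < t) (hc : 0 ≤ c) (b : ℕ) (x : E3) :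
    c / pnorm t x ^ b ≤ c / √t ^ b := by
  have := Real.sqrt_pos.2 ht
  gcongr
  exact sqrt_le_pnorm t x

section Slices

variable {δ M : ℝ} {u₀ : E3 → E3} {θ₀ : E3 → ℝ} {u : ℝ → E3 → E3} {θ : ℝ → E3 → ℝ}

lemma integrable_test_heatSemigroup {b : ℕ} {f : E3 → ℝ} (hδ : 0 ≤ δ) (hf : DecayingDatum b δ f)
    {φ : E3 → ℝ} (hφ : Continuous φ) (hc : HasCompactSupport φ) {t : ℝ} (ht : 0 < t) :
    Integrable (fun x ↦ φ x * heatSemigroup t f x) := by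
  obtain ⟨A, hA, H⟩ := exists_heatSemigroup_bound b
  exact integrable_test_mul hφ hc ((stronglyMeasurable_heatSemigroup hf.measurable).measurable.comp
    (measurable_const.prodMk measurable_id)).aestronglyMeasurable
    fun x ↦ ((H δ f hδ hf t ht x).2.1).trans (div_pnorm_le ht (by positivity) _ _)

lemma integrable_test_duhamel {a b m : ℕ} {k : ℝ → E3 → ℝ} (hk : ParabolicKernel a k) (ha2 : 2 ≤ a)
    (ha4 : a ≤ 4) (hb2 : 2 ≤ b) (hb4 : b ≤ 4) (hab : a + b = m + 4) {f : ℝ → E3 → ℝ} (hM : 0 ≤ M)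
    (hf : ForceBound b M f) {φ : E3 → ℝ} (hφ : Continuous φ) (hc : HasCompactSupport φ) {t : ℝ}
    (ht : 0 < t) : Integrable (fun x ↦ φ x * duhamel k f t x) := by
  obtain ⟨A, hA, H⟩ := exists_duhamel_bound hk ha2 ha4 hb2 hb4 hab
  exact integrable_test_mul hφ hc ((stronglyMeasurable_duhamel hk.measurable hf.measurable).measurable.comp
    (measurable_const.prodMk measurable_id)).aestronglyMeasurable
    fun x ↦ ((H M f hM hf t ht x).2.2.1).trans (div_pnorm_le ht (by positivity) _ _)

lemma partialDeriv_comp_add_right (l : Fin 3) (φ : E3 → ℝ) (z x : E3) :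
    partialDeriv l (fun y ↦ φ (y + z)) x = partialDeriv l φ (x + z) := by
  rw [partialDeriv, fderiv_comp_add_right, partialDeriv]

lemma DecayingDatum.integrable_test {b : ℕ} {f : E3 → ℝ} (hf : DecayingDatum b δ f)
    {φ : E3 → ℝ} (hφ : Continuous φ) (hc : HasCompactSupport φ) : Integrable (fun x ↦ φ x * f x) :=
  hf.locallyIntegrable.integrable_smul_left_of_hasCompactSupport hφ hc

lemma SmallData.sum_integral_eq_zero (hd : SmallData δ u₀ θ₀) {φ : E3 → ℝ} (hφ : ContDiff ℝ ∞ φ)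
    (hc : HasCompactSupport φ) : ∑ k, ∫ x, partialDeriv k φ x * u₀ x k = 0 := by
  rw [← integral_finsetSum _ fun k _ ↦ (hd.coord k).integrable_test
    (contDiff_partialDeriv hφ k).continuous (hasCompactSupport_partialDeriv hc k), ← hd.divFree φ hφ hc]
  exact integral_congr_ae (Eventually.of_forall fun x ↦ (fderiv_apply_eq_sum φ x (u₀ x)).symm)

/-- The semigroup averages pairings with translates of φ, and each translate is again a test
function. -/
lemma SmallData.sum_integral_heatSemigroup_eq_zero (hδ : 0 ≤ δ) (hd : SmallData δ u₀ θ₀) {φ : E3 → ℝ}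
    (hφ : ContDiff ℝ ∞ φ) (hc : HasCompactSupport φ) {t : ℝ} (ht : 0 < t) :
    ∑ k, ∫ x, partialDeriv k φ x * heatSemigroup t (fun y ↦ u₀ y k) x = 0 := by
  have h := fun k ↦ integral_test_heatSemigroup hδ (hd.coord k) (contDiff_partialDeriv hφ k).continuous
    (hasCompactSupport_partialDeriv hc k) ht
  simp only [fun k ↦ (h k).1]
  rw [← integral_finsetSum _ fun k _ ↦ (h k).2]
  refine integral_eq_zero_of_ae (Eventually.of_forall fun z ↦ ?_)
  have hz := hd.sum_integral_eq_zero (φ := fun y ↦ φ (y + z)) (hφ.comp (by fun_prop))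
    (hc.comp_homeomorph (Homeomorph.addRight z))
  simp only [partialDeriv_comp_add_right] at hz
  simp only [← Finset.mul_sum, hz, mul_zero, Pi.zero_apply]

lemma divFree_mildU (hδ : 0 ≤ δ) (hM : 0 ≤ M) (hd : SmallData δ u₀ θ₀) (hu : ForceBound 1 M u)
    (hθ : ForceBound 3 M θ) {t : ℝ} (ht : 0 < t) : DivFree (mildU u₀ u θ t) := by
  intro φ hφ hc
  have cφ := fun k ↦ (contDiff_partialDeriv hφ k).continuous
  have sφ := fun k ↦ hasCompactSupport_partialDeriv hc k
  have hf := fun l j ↦ (hu.coord l).mul (hu.coord j)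
  have hMM : 0 ≤ M * M := mul_nonneg hM hM
  have i1 := fun k ↦ integrable_test_heatSemigroup hδ (hd.coord k) (cφ k) (sφ k) ht
  have i2 := fun k j l ↦ integrable_test_duhamel (m := 2) (b := 2) (parabolicKernel_gradLeray l k j)
    (by norm_num) le_rfl le_rfl (by norm_num) rfl hMM (hf l j) (cφ k) (sφ k) ht
  have i3 := fun k ↦ integrable_test_duhamel (m := 2) (b := 3) (parabolicKernel_leray k 2)
    (by norm_num) (by norm_num) (by norm_num) (by norm_num) rfl hM hθ (cφ k) (sφ k) ht
  have e : ∀ x, fderiv ℝ φ x (mildU u₀ u θ t x) =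
      ∑ k, (partialDeriv k φ x * heatSemigroup t (fun y ↦ u₀ y k) x -
        (∑ j, ∑ l, partialDeriv k φ x *
          duhamel (gradLerayKernel l k j) (fun s y ↦ u s y l * u s y j) t x) +
        partialDeriv k φ x * duhamel (lerayKernel k 2) θ t x) := fun x ↦ by
    rw [fderiv_apply_eq_sum]
    refine Finset.sum_congr rfl fun k _ ↦ ?_
    simp only [mildU, lerayDiv, ← Finset.mul_sum]
    ring
  have i2' := fun k ↦ integrable_finsetSum Finset.univ fun j _ ↦
    integrable_finsetSum Finset.univ fun l _ ↦ i2 k j l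
  simp only [e]
  refine (integral_finsetSum Finset.univ fun k _ ↦ ((i1 k).sub (i2' k)).add (i3 k)).trans ?_
  have e2 : ∀ k, ∫ x, (partialDeriv k φ x * heatSemigroup t (fun y ↦ u₀ y k) x -
        (∑ j, ∑ l, partialDeriv k φ x *
          duhamel (gradLerayKernel l k j) (fun s y ↦ u s y l * u s y j) t x) +
        partialDeriv k φ x * duhamel (lerayKernel k 2) θ t x) =
      (∫ x, partialDeriv k φ x * heatSemigroup t (fun y ↦ u₀ y k) x) -
        (∑ j, ∑ l, ∫ x, partialDeriv k φ x *
          duhamel (gradLerayKernel l k j) (fun s y ↦ u s y l * u s y j) t x) +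
        ∫ x, partialDeriv k φ x * duhamel (lerayKernel k 2) θ t x := fun k ↦ by
    refine (integral_add ((i1 k).sub (i2' k)) (i3 k)).trans ?_
    refine congrArg₂ (· + ·) ((integral_sub (i1 k) (i2' k)).trans (congrArg₂ (· - ·) rfl ?_)) rfl
    rw [integral_finsetSum _ fun j _ ↦ integrable_finsetSum Finset.univ fun l _ ↦ i2 k j l]
    exact Finset.sum_congr rfl fun j _ ↦ integral_finsetSum Finset.univ fun l _ ↦ i2 k j l
  refine (Finset.sum_congr rfl fun k _ ↦ e2 k).trans ?_
  simp only [Finset.sum_add_distrib, Finset.sum_sub_distrib]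
  rw [hd.sum_integral_heatSemigroup_eq_zero hδ hφ hc ht,
    sum_integral_test_duhamel_eq_zero (m := 2) (b := 3) (fun k ↦ parabolicKernel_leray k 2)
      (by norm_num) (by norm_num) (by norm_num) (by norm_num) rfl hM hθ cφ sφ
      (fun τ hτ y ↦ sum_integral_partialDeriv_mul_lerayKernel hφ hc 2 hτ y) ht]
  have e3 : ∑ k, ∑ j, ∑ l, ∫ x, partialDeriv k φ x *
      duhamel (gradLerayKernel l k j) (fun s y ↦ u s y l * u s y j) t x = 0 := by
    rw [Finset.sum_comm]
    refine Finset.sum_eq_zero fun j _ ↦ ?_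
    -- The sums are reordered so that k is innermost: the divergence acts on the first index of the
    -- kernel, for fixed j and l.
    rw [Finset.sum_comm]
    exact Finset.sum_eq_zero fun l _ ↦ sum_integral_test_duhamel_eq_zero (m := 2) (b := 2)
      (fun k ↦ parabolicKernel_gradLeray l k j) (by norm_num) le_rfl le_rfl (by norm_num) rfl hMM
      (hf l j) cφ sφ (fun τ hτ y ↦ sum_integral_partialDeriv_mul_gradLerayKernel hφ hc l j hτ y) ht
  rw [e3]
  norm_num

/-- Both Duhamel terms are at most a multiple of √t |x|^{-2}, and |x|^{-2} is locally integrable, so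
only the heat semigroup survives in the limit. -/
lemma tendsto_integral_test_mildU (hδ : 0 ≤ δ) (hM : 0 ≤ M) (hd : SmallData δ u₀ θ₀)
    (hu : ForceBound 1 M u) (hθ : ForceBound 3 M θ) {φ : E3 → ℝ} (hφ : Continuous φ)
    (hc : HasCompactSupport φ) (k : Fin 3) :
    Tendsto (fun t ↦ ∫ x, φ x * mildU u₀ u θ t x k) (𝓝[>] 0) (𝓝 (∫ x, φ x * u₀ x k)) := by
  obtain ⟨A₁, hA₁, H₁⟩ := exists_lerayDiv_bound
  obtain ⟨A₂, hA₂, H₂⟩ := exists_buoyancy_bound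
  have hMM : 0 ≤ M * M := mul_nonneg hM hM
  have hf := fun l j ↦ (hu.coord l).mul (hu.coord j)
  have hl : StronglyMeasurable fun q : ℝ × E3 ↦
      lerayDiv (fun l j s y ↦ u s y l * u s y j) k q.1 q.2 :=
    stronglyMeasurable_lerayDiv (fun l j ↦ (hf l j).measurable) k
  have t1 := (hd.coord k).tendsto_heatSemigroup hδ hφ hc
  have t2 := tendsto_integral_test_of_le (fun t ht x ↦ (H₁ (M * M) _ hMM hf k t ht x).1) hφ hc
  have t3 := tendsto_integral_test_of_le (fun t ht x ↦ (H₂ M θ hM hθ k t ht x).1) hφ hc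
  have t4 := (t1.sub t2).add t3
  rw [sub_zero, add_zero] at t4
  refine t4.congr' ?_
  filter_upwards [self_mem_nhdsWithin] with t ht
  have i1 := integrable_test_heatSemigroup hδ (hd.coord k) hφ hc ht
  have i2 : Integrable fun x ↦ φ x * lerayDiv (fun l j s y ↦ u s y l * u s y j) k t x :=
    integrable_test_mul hφ hc (hl.measurable.comp
      (measurable_const.prodMk measurable_id)).aestronglyMeasurable
      fun x ↦ ((H₁ (M * M) _ hMM hf k t ht x).1).trans (div_pnorm_le ht (by positivity) _ _)
  have i3 := integrable_test_duhamel (m := 2) (b := 3) (parabolicKernel_leray k 2)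
    (by norm_num) (by norm_num) (by norm_num) (by norm_num) rfl hM hθ hφ hc ht
  rw [← integral_sub i1 i2]
  refine (integral_add (i1.sub i2) i3).symm.trans ?_
  refine integral_congr_ae (Eventually.of_forall fun x ↦ ?_)
  simp only [mildU, Pi.sub_apply]
  ring

lemma tendsto_integral_test_mildTheta (hδ : 0 ≤ δ) (hM : 0 ≤ M) (hd : SmallData δ u₀ θ₀)
    (hu : ForceBound 1 M u) (hθ : ForceBound 3 M θ) {φ : E3 → ℝ} (hφ : ContDiff ℝ ∞ φ)
    (hc : HasCompactSupport φ) :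
    Tendsto (fun t ↦ ∫ x, φ x * mildTheta θ₀ u θ t x) (𝓝[>] 0) (𝓝 (∫ x, φ x * θ₀ x)) := by
  have hMM : 0 ≤ M * M := mul_nonneg hM hM
  have hf : ∀ l, ForceBound 4 (M * M) fun s y ↦ θ s y * u s y l := fun l ↦ hθ.mul (hu.coord l)
  have t1 := hd.theta.tendsto_heatSemigroup hδ hφ.continuous hc
  have t2 := tendsto_finsetSum Finset.univ fun l _ ↦
    tendsto_integral_test_duhamel_gradHeatKernel hMM (hf l) l hφ hc
  have t4 := t1.sub t2
  rw [Finset.sum_const_zero, sub_zero] at t4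
  refine t4.congr' ?_
  filter_upwards [self_mem_nhdsWithin] with t ht
  have i1 := integrable_test_heatSemigroup hδ hd.theta hφ.continuous hc ht
  have i2 := fun l ↦ integrable_test_duhamel (m := 4) (b := 4) (parabolicKernel_gradHeat l)
    (by norm_num) le_rfl (by norm_num) le_rfl rfl hMM (hf l) hφ.continuous hc ht
  rw [← integral_finsetSum _ fun l _ ↦ i2 l,
    ← integral_sub i1 (integrable_finsetSum _ fun l _ ↦ i2 l)]
  refine integral_congr_ae (Eventually.of_forall fun x ↦ ?_)
  simp only [mildTheta, heatDiv, ← Finset.mul_sum]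
  ring

end Slices

lemma tendsto_of_coord {ι : Type*} {l : Filter ι} {f : ι → E3} {a : E3}
    (h : ∀ k, Tendsto (fun i ↦ f i k) l (𝓝 (a k))) : Tendsto f l (𝓝 a) :=
  ((PiLp.continuous_toLp 2 fun _ : Fin 3 ↦ ℝ).tendsto a.ofLp).comp (tendsto_pi_nhds.2 h)

lemma integral_coord {f : E3 → E3} (hf : Integrable f) (k : Fin 3) : (∫ x, f x) k = ∫ x, f x k :=
  ((EuclideanSpace.proj k : E3 →L[ℝ] ℝ).integral_comp_comm hf).symm

/-! ### Continuity in time -/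

/-- The earlier of the two times is the base point, so one expression covers approach from both
sides. -/
lemma tendsto_solutionModulus {t' : ℝ} (ht' : 0 < t') :
    Tendsto (fun t ↦ solutionModulus (min t t') |t - t'|) (𝓝 t') (𝓝 0) := by
  have h : ContinuousAt (fun t ↦ solutionModulus (min t t') |t - t'|) t' := by
    unfold solutionModulus timeModulus
    have h1 : ContinuousAt (fun t : ℝ ↦ min t t') t' := by fun_prop
    have h2 : ContinuousAt (fun t : ℝ ↦ |t - t'|) t' := by fun_prop
    have hm : min t' t' ≠ 0 := by simpa using ht'.ne'
    have hs : √(min t' t') ≠ 0 := by simpa using (Real.sqrt_pos.2 ht').ne'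
    exact (h2.div h1 hm).add ((((continuousAt_const.mul ((h2.rpow_const (Or.inr (by norm_num))).mul
      (h1.rpow_const (Or.inr (by norm_num))))).add (continuousAt_const.mul
      (h2.rpow_const (Or.inr (by norm_num)))))).div h1.sqrt hs)
  have h0 : solutionModulus (min t' t') |t' - t'| = 0 := by
    simp [solutionModulus, timeModulus]
  rw [← h0]
  exact h

/-- The estimates control forward increments only; symmetry of d makes the continuity two-sided. -/
lemma tendsto_of_solutionModulus {d : ℝ → ℝ → ℝ≥0∞} {K : ℝ} (hsymm : ∀ t t', d t t' = d t' t)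
    (h : ∀ t s : ℝ, 0 < t → 0 ≤ s → d (t + s) t ≤ ENNReal.ofReal (K * solutionModulus t s)) {t' : ℝ}
    (ht' : 0 < t') : Tendsto (fun t ↦ d t t') (𝓝 t') (𝓝 0) := by
  have hlim := ENNReal.tendsto_ofReal ((tendsto_solutionModulus ht').const_mul K)
  rw [mul_zero, ENNReal.ofReal_zero] at hlim
  refine tendsto_of_tendsto_of_tendsto_of_le_of_le' tendsto_const_nhds hlim
    (Eventually.of_forall fun _ ↦ zero_le) ?_
  filter_upwards [lt_mem_nhds ht'] with t ht
  rcases le_total t t' with hle | hle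
  · rw [min_eq_left hle, abs_of_nonpos (by linarith), hsymm]
    have := h t (-(t - t')) ht (by linarith)
    rwa [show t + -(t - t') = t' by ring] at this
  · rw [min_eq_right hle, abs_of_nonneg (by linarith)]
    have := h t' (t - t') ht' (by linarith)
    rwa [show t' + (t - t') = t by ring] at this

lemma weightedSup_sub_comm {F : Type*} [NormedAddCommGroup F] (m : ℕ) (f g : E3 → F) :
    weightedSup m (fun x ↦ f x - g x) = weightedSup m (fun x ↦ g x - f x) := by
  unfold weightedSup
  congr 1
  ext x
  rw [← ofReal_norm, ← ofReal_norm, norm_sub_rev]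

/-! ### Local integrability -/

/-- On a bounded region every order up to 3 is dominated by order 3, whose mass on a ball of radius
R is at most cR/√s. This is integrable down to s = 0. -/
lemma ForceBound.locallyIntegrableOn {F : Type*} [NormedAddCommGroup F] {b : ℕ} {M : ℝ}
    {f : ℝ → E3 → F} (hb : b ≤ 3) (hM : 0 ≤ M) (hf : ForceBound b M f) :
    LocallyIntegrableOn (fun p : ℝ × E3 ↦ f p.1 p.2) (Ici 0 ×ˢ univ) volume := by
  obtain ⟨c, hc, Hc⟩ := exists_lintegral_ball_pnorm (a := 3) (by norm_num) (by norm_num)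
  rintro ⟨t, x⟩ ⟨ht, -⟩
  have ht0 : 0 ≤ t := ht
  set T := t + 1 with hT
  set R := ‖x‖ + 1 with hR
  have hR0 : 0 < R := by positivity
  have hT0 : 0 < T := by linarith
  have hnhds : (Ici 0 ×ˢ univ) ∩ (Iio T ×ˢ Metric.ball (0 : E3) R) ∈ 𝓝[Ici 0 ×ˢ univ] (t, x) :=
    inter_mem_nhdsWithin _ (prod_mem_nhds (Iio_mem_nhds (by linarith))
      (Metric.isOpen_ball.mem_nhds (by simp [hR])))
  refine ⟨_, hnhds, ?_⟩
  have hset : (Ici 0 ×ˢ univ) ∩ (Iio T ×ˢ Metric.ball (0 : E3) R) = Ico 0 T ×ˢ Metric.ball (0 : E3) R := by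
    ext p
    simp only [mem_inter_iff, mem_prod, mem_Ici, mem_univ, mem_Iio, mem_Ico]
    tauto
  have hmeas : (volume : Measure (ℝ × E3)).restrict (Ico 0 T ×ˢ Metric.ball (0 : E3) R) =
      (volume.restrict (Ioo 0 T)).prod (volume.restrict (Metric.ball (0 : E3) R)) := by
    rw [Measure.volume_eq_prod, ← Measure.prod_restrict, Measure.restrict_congr_set Ioo_ae_eq_Ico]
  have hle : (volume.restrict (Ioo 0 T)).prod (volume.restrict (Metric.ball (0 : E3) R)) ≤
      halfSpaceTime := by
    rw [halfSpaceTime, Measure.prod_restrict, ← Measure.volume_eq_prod]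
    exact Measure.restrict_mono (Set.prod_mono Ioo_subset_Ioi_self (subset_univ _)) le_rfl
  rw [hset, IntegrableOn, hmeas]
  refine ⟨hf.measurable.mono_measure hle, ?_⟩
  set L := √T + R with hL
  have hL0 : 0 ≤ L := by positivity
  rw [hasFiniteIntegral_iff_enorm]
  have hmem : ∀ᵐ p ∂((volume.restrict (Ioo 0 T)).prod (volume.restrict (Metric.ball (0 : E3) R))),
      p ∈ Ioo 0 T ×ˢ Metric.ball (0 : E3) R := by
    rw [Measure.prod_restrict]
    exact ae_restrict_mem (measurableSet_Ioo.prod measurableSet_ball)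
  calc _ ≤ ∫⁻ p, ENNReal.ofReal (M * L ^ (3 - b)) * ENNReal.ofReal ((pnorm p.1 p.2 ^ 3)⁻¹)
        ∂((volume.restrict (Ioo 0 T)).prod (volume.restrict (Metric.ball (0 : E3) R))) := by
        refine lintegral_mono_ae ?_
        filter_upwards [ae_mono hle hf.bound, hmem] with p hp hpm
        have hN := pnorm_pos hpm.1.1 p.2
        rw [← ofReal_norm, ← ENNReal.ofReal_mul (by positivity)]
        refine ENNReal.ofReal_le_ofReal (hp.trans ?_)
        have hNL : pnorm p.1 p.2 ≤ L := add_le_add (Real.sqrt_le_sqrt hpm.1.2.le)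
          (mem_ball_zero_iff.1 hpm.2).le
        have e : (pnorm p.1 p.2 ^ 3)⁻¹ = (pnorm p.1 p.2 ^ (3 - b))⁻¹ * (pnorm p.1 p.2 ^ b)⁻¹ := by
          rw [← mul_inv, ← pow_add, Nat.sub_add_cancel hb]
        rw [e, div_eq_mul_inv, mul_assoc, ← mul_assoc (L ^ _)]
        refine mul_le_mul_of_nonneg_left (le_mul_of_one_le_left (by positivity) ?_) hM
        rw [← div_eq_mul_inv, one_le_div (by positivity)]
        gcongr
    _ = ENNReal.ofReal (M * L ^ (3 - b)) * ∫⁻ s in Ioo 0 T, ∫⁻ y in Metric.ball (0 : E3) R,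
          ENNReal.ofReal ((pnorm s y ^ 3)⁻¹) := by
        rw [lintegral_const_mul' _ _ ENNReal.ofReal_ne_top]
        exact congrArg _ (lintegral_prod _
          (measurable_pnorm.pow_const 3).inv.ennreal_ofReal.aemeasurable)
    _ ≤ ENNReal.ofReal (M * L ^ (3 - b)) *
          ∫⁻ s in Ioo 0 T, ENNReal.ofReal (c * R) * ENNReal.ofReal (s ^ (-(1 / 2) : ℝ)) := by
        refine mul_le_mul_right ?_ _
        refine setLIntegral_mono' measurableSet_Ioo fun s hs ↦ (Hc s hs.1 R hR0).trans_eq ?_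
        rw [← ENNReal.ofReal_mul (by positivity), ← inv_sqrt_eq_rpow hs.1.le]
        congr 1
        field_simp
    _ < ⊤ := by
        rw [lintegral_const_mul' _ _ ENNReal.ofReal_ne_top, lintegral_Ioo_rpow (by norm_num) hT0.le]
        exact ENNReal.mul_lt_top ENNReal.ofReal_lt_top
          (ENNReal.mul_lt_top ENNReal.ofReal_lt_top ENNReal.ofReal_lt_top)

lemma locallyIntegrable_of_bound {F : Type*} [NormedAddCommGroup F] {f : E3 → F}
    (hf : AEStronglyMeasurable f volume) {B : ℝ} (hB : ∀ x, ‖f x‖ ≤ B) : LocallyIntegrable f :=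
  (locallyIntegrable_const B).mono hf (Eventually.of_forall fun x ↦ (hB x).trans (le_abs_self B))

/-! ### The fixed point is a mild solution -/

section FixedPoint

variable {δ M : ℝ} {u₀ : E3 → E3} {θ₀ : E3 → ℝ} {u : ℝ → E3 → E3} {θ : ℝ → E3 → ℝ}

lemma IsFixedPoint.measurable_u (h : IsFixedPoint δ M u₀ θ₀ u θ) {t : ℝ} (ht : 0 < t) :
    AEStronglyMeasurable (u t) volume := by
  rw [h.eq_u t ht]
  exact ((stronglyMeasurable_mildU h.data.measurable_u h.force_u.measurable
    h.force_theta.measurable).measurable.comp (measurable_const.prodMk measurable_id)).aestronglyMeasurable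

lemma IsFixedPoint.measurable_theta (h : IsFixedPoint δ M u₀ θ₀ u θ) {t : ℝ} (ht : 0 < t) :
    AEStronglyMeasurable (θ t) volume := by
  rw [h.eq_theta t ht]
  exact ((stronglyMeasurable_mildTheta h.data.theta.measurable h.force_u.measurable
    h.force_theta.measurable).measurable.comp (measurable_const.prodMk measurable_id)).aestronglyMeasurable

lemma IsFixedPoint.norm_u_le (h : IsFixedPoint δ M u₀ θ₀ u θ) {t : ℝ} (ht : 0 < t) (x : E3) :
    ‖u t x‖ ≤ M / √t ^ 1 :=
  (h.decay_u t ht x).trans (div_pnorm_le ht h.nonneg _ _)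

lemma IsFixedPoint.norm_theta_le (h : IsFixedPoint δ M u₀ θ₀ u θ) {t : ℝ} (ht : 0 < t) (x : E3) :
    ‖θ t x‖ ≤ M / √t ^ 3 :=
  (h.decay_theta t ht x).trans (div_pnorm_le ht h.nonneg _ _)

lemma SmallData.locallyIntegrable (hd : SmallData δ u₀ θ₀) : LocallyIntegrable u₀ := fun x ↦ by
  obtain ⟨s, hs, hi⟩ := hd.norm_u.locallyIntegrable x
  exact ⟨s, hs, (integrable_norm_iff hd.measurable_u.restrict).1 hi⟩

lemma IsFixedPoint.locallyIntegrable_u (h : IsFixedPoint δ M u₀ θ₀ u θ) {t : ℝ} (ht : 0 ≤ t) :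
    LocallyIntegrable (u t) := by
  rcases ht.eq_or_lt with rfl | ht
  · rw [h.zero_u]
    exact h.data.locallyIntegrable
  · exact locallyIntegrable_of_bound (h.measurable_u ht) (h.norm_u_le ht)

lemma IsFixedPoint.locallyIntegrable_theta (h : IsFixedPoint δ M u₀ θ₀ u θ) {t : ℝ} (ht : 0 ≤ t) :
    LocallyIntegrable (θ t) := by
  rcases ht.eq_or_lt with rfl | ht
  · rw [h.zero_theta]
    exact h.data.theta.locallyIntegrable
  · exact locallyIntegrable_of_bound (h.measurable_theta ht) (h.norm_theta_le ht)

lemma IsFixedPoint.memX (h : IsFixedPoint δ M u₀ θ₀ u θ) : MemX u where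
  locallyIntegrable := h.force_u.locallyIntegrableOn (by norm_num) h.nonneg
  locallyIntegrable_slice _ ht := h.locallyIntegrable_u ht
  divFree t ht := by
    rcases ht.eq_or_lt with rfl | ht
    · rw [h.zero_u]
      exact h.data.divFree
    · rw [h.eq_u t ht]
      exact divFree_mildU h.nonneg_data h.nonneg h.data h.force_u h.force_theta ht
  norm_lt_top := h.decay_u.parabolicSup_le.trans_lt ENNReal.ofReal_lt_top
  tendsto_initial φ hφ hc := by
    have hI : ∀ t, 0 ≤ t → Integrable (fun x ↦ φ x • u t x) := fun t ht ↦
      (h.locallyIntegrable_u ht).integrable_smul_left_of_hasCompactSupport hφ.continuous hc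
    refine tendsto_of_coord fun k ↦ ?_
    have ht := tendsto_integral_test_mildU h.nonneg_data h.nonneg h.data h.force_u h.force_theta
      hφ.continuous hc k
    rw [integral_coord (hI 0 le_rfl), h.zero_u]
    refine ht.congr' ?_
    filter_upwards [self_mem_nhdsWithin] with t ht
    rw [integral_coord (hI t (le_of_lt ht)), h.eq_u t ht]
    rfl
  continuous_time t' ht' := by
    obtain ⟨A, hA, H⟩ := exists_mildU_bound
    refine tendsto_of_solutionModulus (d := fun t t' ↦ weightedSup 1 (fun x ↦ u t x - u t' x))
      (K := A * (δ + M * M + M)) (fun t t' ↦ weightedSup_sub_comm 1 _ _) (fun t s ht hs ↦ ?_) ht'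
    refine weightedSup_le ht fun x ↦ ?_
    rw [h.eq_u t ht, h.eq_u (t + s) (by linarith)]
    exact (H δ h.nonneg_data u₀ θ₀ h.data).2 M u θ h.nonneg h.force_u h.force_theta t s ht hs x

lemma IsFixedPoint.normX_le (h : IsFixedPoint δ M u₀ θ₀ u θ) : normX u ≤ ENNReal.ofReal M :=
  h.decay_u.parabolicSup_le

lemma exists_normY_bound : ∃ A : ℝ, 0 ≤ A ∧ ∀ (δ M : ℝ) (u₀ : E3 → E3) (θ₀ : E3 → ℝ)
    (u : ℝ → E3 → E3) (θ : ℝ → E3 → ℝ), IsFixedPoint δ M u₀ θ₀ u θ →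
    normY θ ≤ ENNReal.ofReal (A * (δ + M * M) + M) := by
  obtain ⟨A, hA, H⟩ := exists_mildTheta_bound
  refine ⟨A, hA, fun δ M u₀ θ₀ u θ h ↦ ?_⟩
  have hδ := h.nonneg_data
  have hM := h.nonneg
  rw [ENNReal.ofReal_add (by positivity) hM]
  refine add_le_add (essSup_le_of_ae_le _ ?_) h.decay_theta.parabolicSup_le
  filter_upwards [ae_restrict_mem measurableSet_Ioi] with t ht
  rw [eLpNorm_one_eq_lintegral_enorm, h.eq_theta t ht]
  exact ((H δ hδ u₀ θ₀ h.data).2 M u θ hM h.force_u h.force_theta t ht).1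

lemma IsFixedPoint.memY (h : IsFixedPoint δ M u₀ θ₀ u θ) : MemY θ where
  locallyIntegrable := h.force_theta.locallyIntegrableOn le_rfl h.nonneg
  locallyIntegrable_slice _ ht := h.locallyIntegrable_theta ht
  norm_lt_top := by
    obtain ⟨A, -, H⟩ := exists_normY_bound
    exact (H δ M u₀ θ₀ u θ h).trans_lt ENNReal.ofReal_lt_top
  tendsto_initial φ hφ hc := by
    have ht := tendsto_integral_test_mildTheta h.nonneg_data h.nonneg h.data h.force_u h.force_theta
      hφ hc
    simp only [smul_eq_mul]
    rw [h.zero_theta]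
    refine ht.congr' ?_
    filter_upwards [self_mem_nhdsWithin] with t ht
    rw [h.eq_theta t ht]
  continuous_time_L1 t' ht' := by
    obtain ⟨A, hA, H⟩ := exists_mildTheta_bound
    refine tendsto_of_solutionModulus (d := fun t t' ↦ eLpNorm (fun x ↦ θ t x - θ t' x) 1 volume)
      (K := A * (δ + M * M)) (fun t t' ↦ eLpNorm_sub_comm _ _ _ _) (fun t s ht hs ↦ ?_) ht'
    rw [eLpNorm_one_eq_lintegral_enorm, h.eq_theta t ht, h.eq_theta (t + s) (by linarith)]
    exact (((H δ h.nonneg_data u₀ θ₀ h.data).2 M u θ h.nonneg h.force_u h.force_theta t ht).2 s hs).2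
  continuous_time_sup t' ht' := by
    obtain ⟨A, hA, H⟩ := exists_mildTheta_bound
    refine tendsto_of_solutionModulus (d := fun t t' ↦ weightedSup 3 (fun x ↦ θ t x - θ t' x))
      (K := A * (δ + M * M)) (fun t t' ↦ weightedSup_sub_comm 3 _ _) (fun t s ht hs ↦ ?_) ht'
    refine weightedSup_le ht fun x ↦ ?_
    rw [h.eq_theta t ht, h.eq_theta (t + s) (by linarith)]
    exact (((H δ h.nonneg_data u₀ θ₀ h.data).2 M u θ h.nonneg h.force_u h.force_theta t ht).2 s hs).1 x

lemma mildTheta_eq (hM : 0 ≤ M) (hu : ForceBound 1 M u) (hθ : ForceBound 3 M θ) {t : ℝ} (ht : 0 < t)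
    (x : E3) : mildTheta θ₀ u θ t x = heatSemigroup t θ₀ x - convectionTheta u θ t x := by
  rw [convectionTheta_eq hM hu hθ ht, mildTheta]

lemma mildU_eq (hM : 0 ≤ M) (hu : ForceBound 1 M u) {t : ℝ} (ht : 0 < t) (x : E3) (k : Fin 3) :
    mildU u₀ u θ t x k =
      heatSemigroup t (fun y ↦ u₀ y k) x - convectionU u t x k + buoyancy θ t x k := by
  rw [convectionU_eq hM hu ht, buoyancy_eq, mildU]

lemma IsFixedPoint.isMildSolution (h : IsFixedPoint δ M u₀ θ₀ u θ) : IsMildSolution u₀ θ₀ u θ where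
  memX := h.memX
  memY := h.memY
  initial_u := by rw [h.zero_u]
  initial_theta := by rw [h.zero_theta]
  eq_theta t ht := Eventually.of_forall fun x ↦ by
    rw [← mildTheta_eq h.nonneg h.force_u h.force_theta ht, ← h.eq_theta t ht]
  eq_u t ht := Eventually.of_forall fun x k ↦ by
    rw [← mildU_eq h.nonneg h.force_u ht, ← h.eq_u t ht]

end FixedPoint

/-! ### Uniqueness -/

/-- Tonelli applied to the norm of the difference. Joint measurability is essential: equality on
every slice alone does not control a space-time set. -/
lemma ae_halfSpaceTime_eq {F : Type*} [NormedAddCommGroup F] {f g : ℝ → E3 → F}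
    (hf : AEStronglyMeasurable (fun p : ℝ × E3 ↦ f p.1 p.2) halfSpaceTime)
    (hg : AEStronglyMeasurable (fun p : ℝ × E3 ↦ g p.1 p.2) halfSpaceTime)
    (h : ∀ t : ℝ, 0 < t → ∀ᵐ x, f t x = g t x) : ∀ᵐ p ∂halfSpaceTime, f p.1 p.2 = g p.1 p.2 := by
  have hd : AEStronglyMeasurable (fun p : ℝ × E3 ↦ f p.1 p.2 - g p.1 p.2) halfSpaceTime := hf.sub hg
  rw [halfSpaceTime_eq_prod] at hd ⊢
  have h0 : ∫⁻ p, ‖f p.1 p.2 - g p.1 p.2‖ₑ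
      ∂((volume.restrict (Ioi (0 : ℝ))).prod (volume : Measure E3)) = 0 := by
    rw [lintegral_prod _ hd.enorm]
    refine (lintegral_congr_ae (g := 0) ?_).trans lintegral_zero
    filter_upwards [ae_restrict_mem measurableSet_Ioi] with t ht
    refine (lintegral_congr_ae (g := 0) ?_).trans lintegral_zero
    filter_upwards [h t ht] with x hx
    simp [hx]
  rw [lintegral_eq_zero_iff' hd.enorm] at h0
  filter_upwards [h0] with p hp
  simpa [sub_eq_zero] using hp

lemma aestronglyMeasurable_halfSpaceTime {F : Type*} [NormedAddCommGroup F]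
    {f : ℝ → E3 → F}
    (h : LocallyIntegrableOn (fun p : ℝ × E3 ↦ f p.1 p.2) (Ici 0 ×ˢ univ) volume) :
    AEStronglyMeasurable (fun p : ℝ × E3 ↦ f p.1 p.2) halfSpaceTime :=
  h.aestronglyMeasurable.mono_measure
    (Measure.restrict_mono (Set.prod_mono Ioi_subset_Ici_self le_rfl) le_rfl)

/-- `(u, θ)` has decay of size `M` and satisfies the integral equations almost everywhere. -/
structure IsWeakFixedPoint (M : ℝ) (u₀ : E3 → E3) (θ₀ : E3 → ℝ) (u : ℝ → E3 → E3)
    (θ : ℝ → E3 → ℝ) : Prop where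
  force_u : ForceBound 1 M u
  force_theta : ForceBound 3 M θ
  eq_u : ∀ t : ℝ, 0 < t → u t =ᵐ[volume] mildU u₀ u θ t
  eq_theta : ∀ t : ℝ, 0 < t → θ t =ᵐ[volume] mildTheta θ₀ u θ t

lemma IsMildSolution.isWeakFixedPoint {M : ℝ} {u₀ : E3 → E3} {θ₀ : E3 → ℝ} {u : ℝ → E3 → E3}
    {θ : ℝ → E3 → ℝ} (h : IsMildSolution u₀ θ₀ u θ) (hM : 0 ≤ M) (hX : normX u ≤ ENNReal.ofReal M)
    (hY : normY θ ≤ ENNReal.ofReal M) : IsWeakFixedPoint M u₀ θ₀ u θ := by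
  have hu : ForceBound 1 M u := forceBound_of_parabolicSup_le hM
    (aestronglyMeasurable_halfSpaceTime h.memX.locallyIntegrable) hX
  have hθ : ForceBound 3 M θ := forceBound_of_parabolicSup_le hM
    (aestronglyMeasurable_halfSpaceTime h.memY.locallyIntegrable)
    (le_add_self.trans hY)
  refine ⟨hu, hθ, fun t ht ↦ ?_, fun t ht ↦ ?_⟩
  · filter_upwards [h.eq_u t ht] with x hx
    ext k
    rw [hx k, mildU_eq hM hu ht]
  · filter_upwards [h.eq_theta t ht] with x hx
    rw [hx, mildTheta_eq hM hu hθ ht]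

lemma IsWeakFixedPoint.ae_eq_u {M : ℝ} {u₀ : E3 → E3} {θ₀ : E3 → ℝ} {u : ℝ → E3 → E3}
    {θ : ℝ → E3 → ℝ} (h : IsWeakFixedPoint M u₀ θ₀ u θ) (hu₀ : AEStronglyMeasurable u₀ volume) :
    ∀ᵐ p ∂halfSpaceTime, u p.1 p.2 = mildU u₀ u θ p.1 p.2 :=
  ae_halfSpaceTime_eq h.force_u.measurable (stronglyMeasurable_mildU hu₀ h.force_u.measurable
    h.force_theta.measurable).aestronglyMeasurable h.eq_u

lemma IsWeakFixedPoint.ae_eq_theta {M : ℝ} {u₀ : E3 → E3} {θ₀ : E3 → ℝ} {u : ℝ → E3 → E3}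
    {θ : ℝ → E3 → ℝ} (h : IsWeakFixedPoint M u₀ θ₀ u θ) (hθ₀ : AEStronglyMeasurable θ₀ volume) :
    ∀ᵐ p ∂halfSpaceTime, θ p.1 p.2 = mildTheta θ₀ u θ p.1 p.2 :=
  ae_halfSpaceTime_eq h.force_theta.measurable (stronglyMeasurable_mildTheta hθ₀ h.force_u.measurable
    h.force_theta.measurable).aestronglyMeasurable h.eq_theta

lemma ForceBound.ae_eq_of_forall_pow {F : Type*} [NormedAddCommGroup F] {b : ℕ} {ρ : ℝ}
    {f g : ℝ → E3 → F} (h : ∀ n : ℕ, ForceBound b (ρ / 2 ^ n) (fun s y ↦ f s y - g s y)) :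
    ∀ᵐ p ∂halfSpaceTime, f p.1 p.2 = g p.1 p.2 := by
  filter_upwards [ae_all_iff.2 fun n ↦ (h n).bound] with p hp
  have hlim : Tendsto (fun n : ℕ ↦ ρ / 2 ^ n / pnorm p.1 p.2 ^ b) atTop (𝓝 0) := by
    have := (tendsto_pow_atTop_nhds_zero_of_lt_one (r := (2 : ℝ)⁻¹) (by norm_num)
      (by norm_num)).const_mul (ρ / pnorm p.1 p.2 ^ b)
    rw [mul_zero] at this
    refine this.congr fun n ↦ ?_
    rw [inv_pow]
    ring
  exact sub_eq_zero.1 (norm_le_zero_iff.1 (ge_of_tendsto' hlim hp))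

theorem Contracts.unique {lam M₀ M : ℝ} (hc : Contracts lam M₀) (hlam : 1 ≤ lam)
    (hM : 0 ≤ M) (hMM₀ : M ≤ M₀) {u₀ : E3 → E3} {θ₀ : E3 → ℝ} (hu₀ : AEStronglyMeasurable u₀ volume)
    (hθ₀ : AEStronglyMeasurable θ₀ volume) {u u' : ℝ → E3 → E3} {θ θ' : ℝ → E3 → ℝ}
    (h : IsWeakFixedPoint M u₀ θ₀ u θ) (h' : IsWeakFixedPoint M u₀ θ₀ u' θ') {t : ℝ} (ht : 0 < t) :
    u t =ᵐ[volume] u' t ∧ θ t =ᵐ[volume] θ' t := by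
  have hlam0 : 0 < lam := by linarith
  -- The temperature difference is at most 2M and must be at most ρ/lam; the velocity difference is
  -- then covered because lam ≥ 1.
  set ρ := lam * (M + M) with hρ
  have hρ0 : 0 ≤ ρ := by positivity
  have key : ∀ n : ℕ, ForceBound 1 (ρ / 2 ^ n) (fun s y ↦ u s y - u' s y) ∧
      ForceBound 3 (ρ / 2 ^ n / lam) (fun s y ↦ θ s y - θ' s y) := fun n ↦ by
    induction n with
    | zero =>
      refine ⟨(h.force_u.sub h'.force_u).congr_bound ?_,
        (h.force_theta.sub h'.force_theta).congr_bound ?_⟩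
      · rw [pow_zero, div_one, hρ]
        nlinarith
      · rw [pow_zero, div_one, hρ, mul_div_cancel_left₀ _ hlam0.ne']
    | succ n ih =>
      have hh := hc M hM hMM₀ u u' θ θ' h.force_u h'.force_u h.force_theta h'.force_theta _
        (by positivity) ih.1 ih.2 u₀ θ₀
      have e : ρ / 2 ^ n / 2 = ρ / 2 ^ (n + 1) := by rw [pow_succ, div_div]
      rw [e] at hh
      refine ⟨⟨ih.1.measurable, ?_⟩, ⟨ih.2.measurable, ?_⟩⟩
      · filter_upwards [h.ae_eq_u hu₀, h'.ae_eq_u hu₀, ae_halfSpaceTime_pos] with p hp hp' h0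
        have := hh.1 p.1 h0 p.2
        simp only at this
        rwa [← hp, ← hp'] at this
      · filter_upwards [h.ae_eq_theta hθ₀, h'.ae_eq_theta hθ₀, ae_halfSpaceTime_pos] with p hp hp' h0
        have := hh.2 p.1 h0 p.2
        simp only at this
        rwa [← hp, ← hp'] at this
  have eu := ForceBound.ae_eq_of_forall_pow fun n ↦ (key n).1
  have eθ : ∀ᵐ p ∂halfSpaceTime, θ p.1 p.2 = θ' p.1 p.2 :=
    ForceBound.ae_eq_of_forall_pow (ρ := ρ / lam) fun n ↦ (key n).2.congr_bound (le_of_eq (by ring))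
  -- Equality in space-time makes the two right-hand sides identical at every time, and each
  -- solution equals its own right-hand side almost everywhere in x.
  refine ⟨(h.eq_u t ht).trans ?_, (h.eq_theta t ht).trans ?_⟩
  · rw [mildU_congr eu eθ]
    exact (h'.eq_u t ht).symm
  · rw [mildTheta_congr eu eθ]
    exact (h'.eq_theta t ht).symm

end Boussinesq

end

theorem proposition2p3 :
    ∃ ε₀ : ℝ, 0 < ε₀ ∧ ∃ C : ℝ, 0 < C ∧
      ∀ ε : ℝ, 0 < ε → ε ≤ ε₀ →
      ∀ (u₀ : Boussinesq.E3 → Boussinesq.E3) (θ₀ : Boussinesq.E3 → ℝ),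
        AEStronglyMeasurable u₀ volume → AEStronglyMeasurable θ₀ volume →
        Boussinesq.DivFree u₀ →
        eLpNorm θ₀ 1 volume < ENNReal.ofReal ε →
        Boussinesq.weightedSup 3 θ₀ < ENNReal.ofReal ε →
        Boussinesq.weightedSup 1 u₀ < ENNReal.ofReal ε →
        ∃ (u : ℝ → Boussinesq.E3 → Boussinesq.E3) (θ : ℝ → Boussinesq.E3 → ℝ),
          (Boussinesq.IsMildSolution u₀ θ₀ u θ ∧
            Boussinesq.normX u ≤ ENNReal.ofReal (C * ε) ∧
            Boussinesq.normY θ ≤ ENNReal.ofReal (C * ε)) ∧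
          ∀ (u' : ℝ → Boussinesq.E3 → Boussinesq.E3) (θ' : ℝ → Boussinesq.E3 → ℝ),
            (Boussinesq.IsMildSolution u₀ θ₀ u' θ' ∧
              Boussinesq.normX u' ≤ ENNReal.ofReal (C * ε) ∧
              Boussinesq.normY θ' ≤ ENNReal.ofReal (C * ε)) →
            ∀ t : ℝ, 0 ≤ t → u' t =ᵐ[volume] u t ∧ θ' t =ᵐ[volume] θ t := by
  obtain ⟨lam, hlam, M₀, hM₀, hc⟩ := Boussinesq.exists_contracts
  obtain ⟨c, hc0, Hdata⟩ := Boussinesq.exists_smallData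
  obtain ⟨A₁, hA₁, H₁⟩ := Boussinesq.exists_mildU_bound
  obtain ⟨A₂, hA₂, H₂⟩ := Boussinesq.exists_mildTheta_bound
  obtain ⟨A₃, hA₃, H₃⟩ := Boussinesq.exists_normY_bound
  have hlam0 : 0 < lam := by linarith
  -- The fixed point is sought in the ball of radius Bε: the linear evolution of the data, of size
  -- at most (A₁ + A₂)cε, is then at most Bε/(2 lam).
  set B : ℝ := 2 * lam * (A₁ + A₂) * c with hB
  have hB0 : 0 ≤ B := by positivity
  -- This covers the full norm of the temperature, including its L¹ part A₃(cε + B²ε²), where ε² ≤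
  -- ε.
  set C : ℝ := A₃ * (c + B * B) + B + 1 with hC
  have hC0 : 0 < C := by positivity
  -- The threshold involves C rather than B because competing solutions are known only to lie in the
  -- ball of radius Cε, and the contraction must hold there.
  refine ⟨min 1 (M₀ / C), by positivity, C, hC0, fun ε hε hε₀ u₀ θ₀ hu₀ hθ₀ hdiv hL h3 h1 ↦ ?_⟩
  have hε1 : ε ≤ 1 := hε₀.trans (min_le_left _ _)
  have hCM : C * ε ≤ M₀ := (le_div_iff₀' hC0).1 (hε₀.trans (min_le_right _ _))
  have hBC : B * ε ≤ C * ε := by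
    have : 0 ≤ A₃ * (c + B * B) := by positivity
    gcongr
    linarith
  have hd := Hdata ε hε u₀ θ₀ hu₀ hθ₀ hdiv hL.le h3.le h1.le
  have hcε : 0 ≤ c * ε := by positivity
  have hAl : (A₁ + A₂) * (c * ε) = B * ε / 2 / lam := by
    rw [hB]
    field_simp
  have hAl' : B * ε / 2 / lam ≤ B * ε / 2 := div_le_self (by positivity) hlam
  have b1 : Boussinesq.DecayBound 1 (B * ε / 2) (Boussinesq.mildU u₀ 0 0) :=
    (H₁ _ hcε u₀ θ₀ hd).1.mono (by nlinarith [mul_nonneg hA₂ hcε])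
  have b3 : Boussinesq.DecayBound 3 (B * ε / 2 / lam) (Boussinesq.mildTheta θ₀ 0 0) :=
    (H₂ _ hcε u₀ θ₀ hd).1.mono (by nlinarith [mul_nonneg hA₁ hcε])
  obtain ⟨u, θ, hfix⟩ := hc.exists_isFixedPoint hlam hcε (by positivity) (hBC.trans hCM) hd b1 b3
  have hX : Boussinesq.normX u ≤ ENNReal.ofReal (C * ε) :=
    hfix.normX_le.trans (ENNReal.ofReal_le_ofReal hBC)
  have hY : Boussinesq.normY θ ≤ ENNReal.ofReal (C * ε) := by
    refine (H₃ _ _ u₀ θ₀ u θ hfix).trans (ENNReal.ofReal_le_ofReal ?_)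
    have e1 : B * ε * (B * ε) ≤ B * B * ε := by
      nlinarith [mul_nonneg (mul_nonneg hB0 hB0) (mul_nonneg hε.le (sub_nonneg.2 hε1))]
    calc A₃ * (c * ε + B * ε * (B * ε)) + B * ε ≤ A₃ * (c * ε + B * B * ε) + B * ε := by gcongr
      _ ≤ C * ε := by rw [hC]; nlinarith
  have hCε : 0 ≤ C * ε := by positivity
  refine ⟨u, θ, ⟨hfix.isMildSolution, hX, hY⟩, fun u' θ' ⟨hs, hX', hY'⟩ t ht ↦ ?_⟩
  rcases ht.eq_or_lt with rfl | ht
  · exact ⟨hs.initial_u.trans hfix.isMildSolution.initial_u.symm,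
      hs.initial_theta.trans hfix.isMildSolution.initial_theta.symm⟩
  · exact hc.unique hlam hCε hCM hu₀ hθ₀ (hs.isWeakFixedPoint hCε hX' hY')
      (hfix.isMildSolution.isWeakFixedPoint hCε hX hY) ht
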